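/- Fix a dimension $d$. For a finite set $P\subset\mathbb{R}^d$ of $n\ge 2$ distinct points and $p\in P$, let $\mathsf{d}(p,P)=\min_{q\in P\setminus\{p\}}\|p-q\|$ be the (Euclidean) distance from $p$ to its nearest neighbor. For $1\le k\le n$, the $k$-th nearest neighbor distance of $P$ is the $k$-th smallest element of the multiset $\{\mathsf{d}(p,P) : p\in P\}$, and the furthest nearest neighbor distance of $P$ is $\max_{p\in P}\mathsf{d}(p,P)$. The model of computation is the randomized real RAM: registers and array entries hold real numbers; the arithmetic operations, comparisons, square root, floor, access to an array entry by its index, and drawing a uniformly random integer from a range $\{0,\dots,N\}$ take unit time each; allocating an array takes time proportional to its length; programs contain only integer constants. There is no built-in hash table. **Theorem.** For every $d$ there are a program of this model and a constant $C$ such that, given any $n\ge 2$ distinct points of $\mathbb{R}^d$ (listed in any order) and any integer $1\le k\le n$, the program computes the $k$-th nearest neighbor distance of the point set exactly (the output is correct for every outcome of the random choices for which the program halts), in expected time at most $Cn$ (in particular, it halts with probability one). Likewise, in particular (the case $k=n$), there is a program that, given any $n\ge 2$ distinct points of $\mathbb{R}^d$, computes their furthest nearest neighbor distance exactly, in expected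 time at most $C'n$ for a constant $C'$ depending only on $d$. -/

import Mathlib

/-! ## The model of computation: a randomized real RAM with floor

A program uses scalar registers, each holding one real number, and arrays of real numbers. The
unit-cost primitives are real arithmetic, floor, square root, comparison, access to an array entry
by its index, and drawing a uniformly random integer from a range `{0, …, N}`. Allocating an array
costs its length. There is no built-in dictionary or hash table, and the only constants in a
program text are integers. -/

namespace RealRAM

/-- Memory: scalar registers and arrays, both named by natural numbers. A program text mentions
only finitely many names. -/
structure State where
  reg : ℕ → ℝ
  arr : ℕ → List ℝ

/-- Expressions. -/
inductive Expr where
  | const (z : ℤ)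
  | var (x : ℕ)
  | get (a : ℕ) (i : Expr)
  | add (e f : Expr)
  | sub (e f : Expr)
  | mul (e f : Expr)
  | div (e f : Expr)
  | floor (e : Expr)
  | sqrt (e : Expr)

/-- Value of an expression. All primitives are total: division by zero, the square root of a
negative number and reading outside an array give `0`; an index is rounded down to a natural
number. -/
noncomputable def Expr.eval (s : State) : Expr → ℝ
  | .const z => z
  | .var x => s.reg x
  | .get a i => (s.arr a).getD ⌊i.eval s⌋₊ 0
  | .add e f => e.eval s + f.eval s
  | .sub e f => e.eval s - f.eval s
  | .mul e f => e.eval s * f.eval s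
  | .div e f => e.eval s / f.eval s
  | .floor e => (⌊e.eval s⌋ : ℝ)
  | .sqrt e => Real.sqrt (e.eval s)

/-- Number of primitive operations performed when an expression is evaluated. -/
def Expr.ops : Expr → ℕ
  | .const _ => 1
  | .var _ => 1
  | .get _ i => i.ops + 1
  | .add e f => e.ops + f.ops + 1
  | .sub e f => e.ops + f.ops + 1
  | .mul e f => e.ops + f.ops + 1
  | .div e f => e.ops + f.ops + 1
  | .floor e => e.ops + 1
  | .sqrt e => e.ops + 1

/-- Comparisons. -/
inductive Test where
  | le (e f : Expr)
  | lt (e f : Expr)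

def Test.holds (s : State) : Test → Prop
  | .le e f => e.eval s ≤ f.eval s
  | .lt e f => e.eval s < f.eval s

def Test.ops : Test → ℕ
  | .le e f => e.ops + f.ops + 1
  | .lt e f => e.ops + f.ops + 1

/-- Programs. -/
inductive Cmd where
  | skip
  /-- register `x` := value of `e` -/
  | assign (x : ℕ) (e : Expr)
  /-- entry `i` of array `a` := value of `e`; no effect if `i` is outside the array -/
  | store (a : ℕ) (i e : Expr)
  /-- array `a` := a new array of zeros, whose length is the value of `e` -/
  | alloc (a : ℕ) (e : Expr)
  /-- register `x` := a fresh, uniformly random integer in `{0, …, N}`, `N` the value of `e` -/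
  | rand (x : ℕ) (e : Expr)
  | seq (c d : Cmd)
  | ite (b : Test) (c d : Cmd)
  | loop (b : Test) (c : Cmd)

def State.setReg (s : State) (x : ℕ) (v : ℝ) : State :=
  { s with reg := Function.update s.reg x v }

def State.setArr (s : State) (a : ℕ) (l : List ℝ) : State :=
  { s with arr := Function.update s.arr a l }

/-- A configuration: the commands still to be executed, in order, and the memory. The machine has
halted when no command is left. -/
abbrev Config := List Cmd × State

open Classical in
/-- One step of the machine, as a probability distribution on the next configuration. -/
noncomputable def step : Config → PMF Config
  | ([], s) => PMF.pure ([], s)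
  | (.skip :: K, s) => PMF.pure (K, s)
  | (.assign x e :: K, s) => PMF.pure (K, s.setReg x (e.eval s))
  | (.store a i e :: K, s) =>
      PMF.pure (K, s.setArr a ((s.arr a).set ⌊i.eval s⌋₊ (e.eval s)))
  | (.alloc a e :: K, s) => PMF.pure (K, s.setArr a (List.replicate ⌊e.eval s⌋₊ 0))
  | (.rand x e :: K, s) =>
      (PMF.uniformOfFintype (Fin (⌊e.eval s⌋₊ + 1))).map fun j => (K, s.setReg x ((j : ℕ) : ℝ))
  | (.seq c d :: K, s) => PMF.pure (c :: d :: K, s)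
  | (.ite b c d :: K, s) => PMF.pure (if b.holds s then (c :: K, s) else (d :: K, s))
  | (.loop b c :: K, s) => PMF.pure (if b.holds s then (c :: .loop b c :: K, s) else (K, s))

/-- The time taken by the next step. It is at least one until the machine halts. -/
noncomputable def cost : Config → ℕ
  | ([], _) => 0
  | (.skip :: _, _) => 1
  | (.assign _ e :: _, _) => 1 + e.ops
  | (.store _ i e :: _, _) => 1 + i.ops + e.ops
  | (.alloc _ e :: _, s) => 1 + e.ops + ⌊e.eval s⌋₊
  | (.rand _ e :: _, _) => 1 + e.ops
  | (.seq _ _ :: _, _) => 1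
  | (.ite b _ _ :: _, _) => 1 + b.ops
  | (.loop b _ :: _, _) => 1 + b.ops

/-- Distribution of the configuration after `t` steps. -/
noncomputable def runDist : ℕ → Config → PMF Config
  | 0, c => PMF.pure c
  | t + 1, c => (step c).bind (runDist t)

/-- Expected total running time: the sum over all `t` of the expected cost of step `t`. It is
infinite unless the machine halts with probability one. -/
noncomputable def expectedTime (c : Config) : ENNReal :=
  ∑' t : ℕ, ∑' c' : Config, runDist t c c' * (cost c' : ENNReal)

/-- Started in memory `s`, the program `P` has expected running time at most `T`, and whenever it
halts, whatever the outcome of the random choices, register `0` holds `v`. -/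
def Computes (P : Cmd) (s : State) (v : ℝ) (T : ENNReal) : Prop :=
  (∀ t : ℕ, ∀ c ∈ (runDist t ([P], s)).support, c.1 = [] → c.2.reg 0 = v) ∧
    expectedTime ([P], s) ≤ T

/-- The memory that presents `n` points of `ℝ^d` to a program: register `0` holds `n`, and for
`j < d` array `j` holds the `j`-th coordinates of the points; everything else is zero or empty. -/
noncomputable def inputState {d n : ℕ} (p : Fin n → EuclideanSpace ℝ (Fin d)) : State where
  reg x := if x = 0 then (n : ℝ) else 0
  arr a := if h : a < d then List.ofFn fun i => p i ⟨a, h⟩ else []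

end RealRAM

/-! ## Nearest neighbour distances -/

/-- Distance of `x` to its nearest neighbour in `S \ {x}`. -/
noncomputable def nearestDist {E : Type*} [MetricSpace E] (S : Finset E) (x : E) : ℝ :=
  sInf (dist x '' ((S : Set E) \ {x}))

/-- The `k`-th smallest element of a multiset (counted with multiplicity, from `k = 1`). -/
noncomputable def kthSmallest (M : Multiset ℝ) (k : ℕ) : ℝ :=
  (M.sort (· ≤ ·)).getD (k - 1) 0

/-- The `k`-th nearest neighbour distance of `S`: the `k`-th smallest element of the multiset of
the nearest neighbour distances of the points of `S`. -/
noncomputable def kthNNDist {E : Type*} [MetricSpace E] (S : Finset E) (k : ℕ) : ℝ :=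
  kthSmallest (S.val.map (nearestDist S)) k

/-- The furthest nearest neighbour distance of `S`. -/
noncomputable def furthestNNDist {E : Type*} [MetricSpace E] (S : Finset E) : ℝ :=
  sSup (nearestDist S '' (S : Set E))

/-! The method is net-and-prune. Put `J = n - k + 1`; the sought number is the `J`-th largest
nearest neighbour distance. It is first located up to a constant factor and then computed exactly.

Approximation. A set `W` of active points is kept, together with candidates `A ⊆ W` and a rank `j`.
A random active point is drawn, and `ℓ` is its nearest neighbour distance within `W`. If fewer than
`j` candidates have distance at least `ℓ`, then `ℓ` is too large: every active point at distance at
least `ℓ` from the others is discarded and `j` is lowered (`Approx.prune`). Otherwise a grid of side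
`s = 8dℓ` is laid out. If at least `j` candidates have distance above `2ds`, then `ℓ` is much too
small: `W` is replaced by a net at scale `s`, and the candidates with smaller distance lose their
status (`Approx.net`). If neither happens, `ℓ` is within a constant factor of the answer
(`Approx.bounds`). Pruning does not increase the distances of the survivors, because the nearest
neighbour of a survivor survives. Passing to a net changes distances by `O(s)`, but the scales of
successive nets grow by a factor above `8d`, so the errors form a geometric series and all
candidates keep their true distance up to the factor `1 + 8d`.

Linear time. Pruning removes all points ranked at or above the pivot; thinning removes a fixed
fraction of those ranked at or below it, since a net drops at least one in `3^d + 1` of the points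
with a close neighbour (`card_close_le`). A random pivot has both ranks at least a quarter of `|W|`
with probability at least one half (`sq_card_le_sum_min`), so the size falls geometrically in
expectation, and `Run.loop_pivot` turns this into a linear bound.

One round in linear time. All distances in a range `(2ds, Rs)` are resolved by one grid of side `s`
(`run_grid`, `le_gridVal_iff`). A greedy net is built with at most one point per cell, and then
every point updates the stored distance of the net points in the `(2R+1)^d` surrounding cells.
Points outside the net are known to have distance at most `2ds` and need no further work. Cells are
looked up by hashing with chaining: a cell index vector is packed into one integer `q`, whose slot
is `⌊m · frac(rq/N)⌋` for a random `r < N`; two different keys collide with probability at most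
`5/m` (`card_slot_eq_le`).

Exactness. Once the answer is known up to a constant, one more grid of suitable side and radius
yields an array with the same `J`-th largest entry as the true distances (`IsLargest.gridVal`), and
quickselect extracts it (`run_select`).

The probabilistic semantics is handled by an expected-time transformer `ert`, whose value bounds the
accumulated cost plus a final charge. A charge of `⊤` on wrong outputs gives correctness and the
time bound by one argument (`Run.computes`). -/

namespace RealRAM

open scoped ENNReal

/-! ## Expected running times, compositionally -/

open Classical in
/-- `ert c f s` bounds the expected running time of `c` from `s`, where the final memory `s'` is
charged `f s'` more. -/
noncomputable def ert : Cmd → (State → ℝ≥0∞) → State → ℝ≥0∞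
  | .skip, f, s => 1 + f s
  | .assign x e, f, s => ((1 + e.ops : ℕ) : ℝ≥0∞) + f (s.setReg x (e.eval s))
  | .store a i e, f, s =>
      ((1 + i.ops + e.ops : ℕ) : ℝ≥0∞) + f (s.setArr a ((s.arr a).set ⌊i.eval s⌋₊ (e.eval s)))
  | .alloc a e, f, s =>
      ((1 + e.ops + ⌊e.eval s⌋₊ : ℕ) : ℝ≥0∞) + f (s.setArr a (List.replicate ⌊e.eval s⌋₊ 0))
  | .rand x e, f, s =>
      ((1 + e.ops : ℕ) : ℝ≥0∞) +
        ∑ j : Fin (⌊e.eval s⌋₊ + 1), ((⌊e.eval s⌋₊ + 1 : ℕ) : ℝ≥0∞)⁻¹ * f (s.setReg x ((j : ℕ) : ℝ))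
  | .seq c d, f, s => 1 + ert c (ert d f) s
  | .ite b c d, f, s =>
      ((1 + b.ops : ℕ) : ℝ≥0∞) + if b.holds s then ert c f s else ert d f s
  | .loop b c, f, s =>
      ⨅ X : State → ℝ≥0∞,
        ⨅ _ : ∀ s, ((1 + b.ops : ℕ) : ℝ≥0∞) + (if b.holds s then ert c X s else f s) ≤ X s, X s

open Classical in
/-- The functional whose least fixed point is `ert (.loop b c) f`. -/
noncomputable def ertLoop (b : Test) (c : Cmd) (f X : State → ℝ≥0∞) (s : State) : ℝ≥0∞ :=
  ((1 + b.ops : ℕ) : ℝ≥0∞) + if b.holds s then ert c X s else f s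

theorem ert_loop (b : Test) (c : Cmd) (f : State → ℝ≥0∞) (s : State) :
    ert (.loop b c) f s = ⨅ X : State → ℝ≥0∞, ⨅ _ : ∀ s, ertLoop b c f X s ≤ X s, X s := rfl

theorem ert_mono (c : Cmd) : ∀ {f g : State → ℝ≥0∞}, (∀ s, f s ≤ g s) → ∀ s, ert c f s ≤ ert c g s := by
  induction c with
  | skip => intro f g h s; simpa [ert] using h s
  | assign x e => intro f g h s; simp only [ert]; gcongr; exact h _
  | store a i e => intro f g h s; simp only [ert]; gcongr; exact h _
  | alloc a e => intro f g h s; simp only [ert]; gcongr; exact h _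
  | rand x e => intro f g h s; simp only [ert]; gcongr; exact h _
  | seq c d hc hd => intro f g h s; simp only [ert]; gcongr; exact hc (hd h) s
  | ite b c d hc hd =>
    intro f g h s; simp only [ert]; gcongr; split_ifs
    · exact hc h s
    · exact hd h s
  | loop b c hc =>
    intro f g h s
    rw [ert_loop, ert_loop]
    refine le_iInf₂ fun X hX => iInf₂_le_of_le X (fun s => le_trans ?_ (hX s)) le_rfl
    unfold ertLoop
    gcongr
    split_ifs
    · exact le_rfl
    · exact h s

theorem ertLoop_mono (b : Test) (c : Cmd) (f : State → ℝ≥0∞) {X Y : State → ℝ≥0∞}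
    (h : ∀ s, X s ≤ Y s) (s : State) : ertLoop b c f X s ≤ ertLoop b c f Y s := by
  unfold ertLoop
  gcongr
  split_ifs
  · exact ert_mono c h s
  · exact le_rfl

theorem ert_loop_le (b : Test) (c : Cmd) (f X : State → ℝ≥0∞)
    (h : ∀ s, ertLoop b c f X s ≤ X s) (s : State) : ert (.loop b c) f s ≤ X s := by
  rw [ert_loop]
  exact iInf₂_le_of_le X h le_rfl

/-- Knaster–Tarski: the infimum of all pre-fixed points of a monotone functional is again pre-fixed.
-/
theorem ertLoop_ert_le (b : Test) (c : Cmd) (f : State → ℝ≥0∞) (s : State) :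
    ertLoop b c f (ert (.loop b c) f) s ≤ ert (.loop b c) f s := by
  rw [ert_loop]
  exact le_iInf₂ fun X hX =>
    (ertLoop_mono b c f (fun s => ert_loop_le b c f X hX s) s).trans (hX s)

/-- By monotonicity the image of a pre-fixed point is pre-fixed, so the least one lies below its own
image. This justifies unrolling one iteration. -/
theorem ert_loop_unfold_le (b : Test) (c : Cmd) (f : State → ℝ≥0∞) (s : State) :
    ert (.loop b c) f s ≤ ertLoop b c f (ert (.loop b c) f) s :=
  ert_loop_le b c f _ (fun s => ertLoop_mono b c f (fun s => ertLoop_ert_le b c f s) s) s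

/-! ### Soundness -/

/-- The expected remaining time of a configuration, with final charge `f`. -/
noncomputable def ertConf (f : State → ℝ≥0∞) : List Cmd → State → ℝ≥0∞
  | [], s => f s
  | c :: K, s => ert c (ertConf f K) s

theorem tsum_pure_mul {α : Type*} (a : α) (g : α → ℝ≥0∞) :
    ∑' x, PMF.pure a x * g x = g a := by
  classical
  rw [tsum_eq_single a]
  · simp
  · intro b hb; simp [PMF.pure_apply, hb]

theorem tsum_map_mul {α β : Type*} (p : PMF α) (φ : α → β) (g : β → ℝ≥0∞) :
    ∑' y, p.map φ y * g y = ∑' x, p x * g (φ x) := by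
  classical
  simp only [PMF.map_apply, ← ENNReal.tsum_mul_right]
  rw [ENNReal.tsum_comm]
  refine tsum_congr fun x => ?_
  rw [tsum_eq_single (φ x)]
  · simp
  · intro b hb; simp [hb]

theorem tsum_bind_mul {α β : Type*} (p : PMF α) (q : α → PMF β) (g : β → ℝ≥0∞) :
    ∑' y, p.bind q y * g y = ∑' x, p x * ∑' y, q x y * g y := by
  simp only [PMF.bind_apply, ← ENNReal.tsum_mul_right, ← ENNReal.tsum_mul_left]
  rw [ENNReal.tsum_comm]
  simp only [mul_assoc]

/-- The supermartingale property: `ertConf` is a potential whose expected drop in one step pays for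
the cost of that step. -/
theorem cost_add_step_le (f : State → ℝ≥0∞) (c : Config) :
    (cost c : ℝ≥0∞) + ∑' c', step c c' * ertConf f c'.1 c'.2 ≤ ertConf f c.1 c.2 := by
  obtain ⟨K, s⟩ := c
  cases K with
  | nil => simp [cost, step]
  | cons c K =>
    cases c with
    | skip => simp [cost, step, ertConf, ert]
    | assign x e => simp [cost, step, ertConf, ert]
    | store a i e => simp [cost, step, ertConf, ert]
    | alloc a e => simp [cost, step, ertConf, ert]
    | rand x e =>
      simp only [cost, step, tsum_map_mul, ertConf, ert]
      refine add_le_add_right (le_of_eq ?_) _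
      refine (tsum_map_mul (PMF.uniformOfFintype (Fin (⌊e.eval s⌋₊ + 1))) Fin.val
        fun j => ertConf f K (s.setReg x (j : ℝ))).trans ?_
      rw [tsum_fintype]
      simp only [PMF.uniformOfFintype_apply, Fintype.card_fin]
    | seq c d => simp [cost, step, ertConf, ert]
    | ite b c d =>
      simp only [cost, step, tsum_pure_mul, ertConf, ert]
      split_ifs <;> simp [ertConf]
    | loop b c =>
      simp only [cost, step, tsum_pure_mul, ertConf]
      refine le_trans (le_of_eq ?_) (ertLoop_ert_le b c _ s)
      unfold ertLoop
      split_ifs <;> simp [ertConf]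

theorem tsum_runDist_succ (t : ℕ) (c : Config) (g : Config → ℝ≥0∞) :
    ∑' c', runDist (t + 1) c c' * g c' = ∑' c₁, step c c₁ * ∑' c', runDist t c₁ c' * g c' := by
  rw [runDist, tsum_bind_mul]

/-- Telescoping the one-step inequality. The first summand gives the time bound as `t` grows; the
second controls where the machine can halt. -/
theorem sum_cost_add_le (f : State → ℝ≥0∞) (t : ℕ) : ∀ c : Config,
    (∑ i ∈ Finset.range t, ∑' c', runDist i c c' * (cost c' : ℝ≥0∞)) +
      ∑' c', runDist t c c' * ertConf f c'.1 c'.2 ≤ ertConf f c.1 c.2 := by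
  induction t with
  | zero => intro c; simp [runDist]
  | succ t ih =>
    intro c
    refine le_trans ?_ (cost_add_step_le f c)
    rw [Finset.sum_range_succ']
    simp only [tsum_runDist_succ]
    rw [show ∑' c', runDist 0 c c' * (cost c' : ℝ≥0∞) = cost c by simp [runDist],
      add_right_comm, add_comm]
    gcongr
    rw [← Summable.tsum_finsetSum (fun _ _ => ENNReal.summable), ← ENNReal.tsum_add]
    refine ENNReal.tsum_le_tsum fun c₁ => ?_
    rw [← Finset.mul_sum, ← mul_add]
    gcongr
    exact ih c₁

/-- `Run c s T Q`: from memory `s`, the command `c` has expected time at most `T`, and every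
possible final memory satisfies `Q`. -/
def Run (c : Cmd) (s : State) (T : ℕ) (Q : State → Prop) : Prop :=
  ∀ (f : State → ℝ≥0∞) (B : ℝ≥0∞), (∀ s', Q s' → f s' ≤ B) → ert c f s ≤ T + B

theorem Run.computes {c : Cmd} {s : State} {T : ℕ} {v : ℝ}
    (h : Run c s T fun s' => s'.reg 0 = v) : Computes c s v T := by
  classical
  -- Halting in a wrong memory with positive probability would make the expected charge infinite,
  -- although it is bounded by `T`.
  set f : State → ℝ≥0∞ := fun s' => if s'.reg 0 = v then 0 else ⊤ with hf
  have hle : ertConf f [c] s ≤ T := by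
    have := h f 0 (fun s' hs' => by simp [hf, hs'])
    simpa [ertConf] using this
  constructor
  · intro t c' hc' hnil
    by_contra hv
    have h1 := (le_add_self.trans (sum_cost_add_le f t ([c], s))).trans hle
    have h2 : runDist t ([c], s) c' * ertConf f c'.1 c'.2 ≤ T :=
      (ENNReal.le_tsum c').trans h1
    rw [hnil] at h2
    have h3 : ertConf f [] c'.2 = ⊤ := by simp [ertConf, hf, hv]
    rw [h3, ENNReal.mul_top ((PMF.mem_support_iff _ _).1 hc')] at h2
    exact absurd h2 (by simp)
  · unfold expectedTime
    rw [ENNReal.tsum_eq_iSup_nat]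
    exact iSup_le fun t => (le_self_add.trans (sum_cost_add_le f t ([c], s))).trans hle

/-! ### Frames -/

/-- The registers a command may change. -/
def Cmd.writesReg : Cmd → ℕ → Prop
  | .skip, _ => False
  | .assign x _, y => y = x
  | .store _ _ _, _ => False
  | .alloc _ _, _ => False
  | .rand x _, y => y = x
  | .seq c d, y => c.writesReg y ∨ d.writesReg y
  | .ite _ c d, y => c.writesReg y ∨ d.writesReg y
  | .loop _ c, y => c.writesReg y

/-- The arrays a command may change. -/
def Cmd.writesArr : Cmd → ℕ → Prop
  | .skip, _ => False
  | .assign _ _, _ => False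
  | .store a _ _, y => y = a
  | .alloc a _, y => y = a
  | .rand _ _, _ => False
  | .seq c d, y => c.writesArr y ∨ d.writesArr y
  | .ite _ c d, y => c.writesArr y ∨ d.writesArr y
  | .loop _ c, y => c.writesArr y

/-- The two memories agree where `c` does not write. -/
def Agree (c : Cmd) (s s' : State) : Prop :=
  (∀ x, ¬ c.writesReg x → s'.reg x = s.reg x) ∧ (∀ a, ¬ c.writesArr a → s'.arr a = s.arr a)

theorem Agree.refl (c : Cmd) (s : State) : Agree c s s := ⟨fun _ _ => rfl, fun _ _ => rfl⟩

theorem Agree.mono {c d : Cmd} {s s' : State} (h : Agree c s s')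
    (hr : ∀ x, c.writesReg x → d.writesReg x) (ha : ∀ x, c.writesArr x → d.writesArr x) :
    Agree d s s' :=
  ⟨fun x hx => h.1 x fun hc => hx (hr x hc), fun a hx => h.2 a fun hc => hx (ha a hc)⟩

theorem Agree.trans {c : Cmd} {s s' s'' : State} (h : Agree c s s') (h' : Agree c s' s'') :
    Agree c s s'' :=
  ⟨fun x hx => (h'.1 x hx).trans (h.1 x hx), fun a ha => (h'.2 a ha).trans (h.2 a ha)⟩

theorem ert_le_of_agree (c : Cmd) : ∀ {f g : State → ℝ≥0∞} {s : State},
    (∀ s', Agree c s s' → f s' ≤ g s') → ert c f s ≤ ert c g s := by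
  induction c with
  | skip => intro f g s h; simpa [ert] using h s (Agree.refl _ _)
  | assign x e =>
    intro f g s h; simp only [ert]; gcongr
    exact h _ ⟨fun y hy => Function.update_of_ne hy _ _, fun _ _ => rfl⟩
  | store a i e =>
    intro f g s h; simp only [ert]; gcongr
    exact h _ ⟨fun _ _ => rfl, fun y hy => Function.update_of_ne hy _ _⟩
  | alloc a e =>
    intro f g s h; simp only [ert]; gcongr
    exact h _ ⟨fun _ _ => rfl, fun y hy => Function.update_of_ne hy _ _⟩
  | rand x e =>
    intro f g s h; simp only [ert]; gcongr
    exact h _ ⟨fun y hy => Function.update_of_ne hy _ _, fun _ _ => rfl⟩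
  | seq c d hc hd =>
    intro f g s h; simp only [ert]; gcongr
    refine hc fun s' hs' => hd fun s'' hs'' => h s'' ?_
    exact (hs'.mono (fun _ => Or.inl) (fun _ => Or.inl)).trans
      (hs''.mono (fun _ => Or.inr) (fun _ => Or.inr))
  | ite b c d hc hd =>
    intro f g s h; simp only [ert]; gcongr; split_ifs
    · exact hc fun s' hs' => h s' (hs'.mono (fun _ => Or.inl) (fun _ => Or.inl))
    · exact hd fun s' hs' => h s' (hs'.mono (fun _ => Or.inr) (fun _ => Or.inr))
  | loop b c hc =>
    classical
    intro f g s h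
    -- Infinite outside the states that agree with `s`, so the pre-fixed point condition has to be
    -- checked only on the agreeing ones.
    set X : State → ℝ≥0∞ := fun s' =>
      if Agree (.loop b c) s s' then ert (.loop b c) g s' else ⊤ with hX
    have := ert_loop_le b c f X (fun s' => ?_) s
    · simpa [hX, Agree.refl] using this
    by_cases hs' : Agree (.loop b c) s s'
    · have hXs : X s' = ert (.loop b c) g s' := by simp [hX, hs']
      rw [hXs]
      refine le_trans ?_ (ertLoop_ert_le b c g s')
      unfold ertLoop
      gcongr
      split_ifs
      · refine hc fun s'' hs'' => ?_
        have : Agree (.loop b c) s s'' := hs'.trans (hs''.mono (fun _ => id) (fun _ => id))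
        simp [hX, this]
      · exact h s' hs'
    · simp [hX, hs']

/-- Disagreeing states never arise, so their charge may be replaced by `0` before the given bound is
applied. -/
theorem Run.frame {c : Cmd} {s : State} {T : ℕ} {Q : State → Prop} (h : Run c s T Q) :
    Run c s T fun s' => Q s' ∧ Agree c s s' := by
  classical
  intro f B hB
  refine le_trans (ert_le_of_agree c (g := fun s' => if Agree c s s' then f s' else 0) ?_)
    (h _ B ?_)
  · intro s' hs'; simp [hs']
  · intro s' hs'
    by_cases hA : Agree c s s'
    · simpa [hA] using hB s' ⟨hs', hA⟩
    · simp [hA]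

/-! ### Rules -/

theorem Run.mono {c : Cmd} {s : State} {T T' : ℕ} {Q Q' : State → Prop} (h : Run c s T Q)
    (hT : T ≤ T') (hQ : ∀ s', Q s' → Q' s') : Run c s T' Q' := fun f B hB =>
  (h f B fun s' hs' => hB s' (hQ s' hs')).trans (by gcongr)

theorem Run.seq {c d : Cmd} {s : State} {T₁ T₂ : ℕ} {R Q : State → Prop} (hc : Run c s T₁ R)
    (hd : ∀ s', R s' → Run d s' T₂ Q) : Run (.seq c d) s (1 + T₁ + T₂) Q := by
  intro f B hB
  simp only [ert]
  have := hc (ert d f) (T₂ + B) fun s' hs' => hd s' hs' f B hB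
  calc 1 + ert c (ert d f) s ≤ 1 + (T₁ + (T₂ + B)) := by gcongr
    _ = _ := by push_cast; ring

theorem Run.ite {b : Test} {c d : Cmd} {s : State} {T : ℕ} {Q : State → Prop}
    (hc : b.holds s → Run c s T Q) (hd : ¬ b.holds s → Run d s T Q) :
    Run (.ite b c d) s (1 + b.ops + T) Q := by
  intro f B hB
  simp only [ert]
  rw [Nat.cast_add (1 + b.ops), add_assoc]
  gcongr
  split_ifs with h
  · exact hc h f B hB
  · exact hd h f B hB

theorem Run.skip {s : State} {Q : State → Prop} (h : Q s) : Run .skip s 1 Q := by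
  intro f B hB
  simp only [ert, Nat.cast_one]
  gcongr
  exact hB s h

theorem Run.assign {x : ℕ} {e : Expr} {s : State} {Q : State → Prop}
    (h : Q (s.setReg x (e.eval s))) : Run (.assign x e) s (1 + e.ops) Q := by
  intro f B hB
  simp only [ert]
  gcongr
  exact hB _ h

theorem Run.store {a : ℕ} {i e : Expr} {s : State} {Q : State → Prop}
    (h : Q (s.setArr a ((s.arr a).set ⌊i.eval s⌋₊ (e.eval s)))) :
    Run (.store a i e) s (1 + i.ops + e.ops) Q := by
  intro f B hB
  simp only [ert]
  gcongr
  exact hB _ h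

theorem Run.alloc {a : ℕ} {e : Expr} {s : State} {Q : State → Prop}
    (h : Q (s.setArr a (List.replicate ⌊e.eval s⌋₊ 0))) :
    Run (.alloc a e) s (1 + e.ops + ⌊e.eval s⌋₊) Q := by
  intro f B hB
  simp only [ert]
  gcongr
  exact hB _ h

theorem Run.loop_false {b : Test} {c : Cmd} {s : State} {Q : State → Prop} (hb : ¬ b.holds s)
    (h : Q s) : Run (.loop b c) s (1 + b.ops) Q := by
  intro f B hB
  refine (ert_loop_unfold_le b c f s).trans ?_
  unfold ertLoop
  rw [if_neg hb]
  gcongr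
  exact hB s h

theorem Run.loop_true {b : Test} {c : Cmd} {s : State} {T₁ T₂ : ℕ} {R Q : State → Prop}
    (hb : b.holds s) (hc : Run c s T₁ R) (hl : ∀ s', R s' → Run (.loop b c) s' T₂ Q) :
    Run (.loop b c) s (1 + b.ops + T₁ + T₂) Q := by
  intro f B hB
  refine (ert_loop_unfold_le b c f s).trans ?_
  unfold ertLoop
  rw [if_pos hb]
  have := hc (ert (.loop b c) f) (T₂ + B) fun s' hs' => hl s' hs' f B hB
  calc ((1 + b.ops : ℕ) : ℝ≥0∞) + ert c (ert (.loop b c) f) s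
      ≤ ((1 + b.ops : ℕ) : ℝ≥0∞) + (T₁ + (T₂ + B)) := by gcongr
    _ = _ := by push_cast; ring

theorem avg_le {N : ℕ} {T : ℕ → ℕ} {G : ℕ} (B : ℝ≥0∞) (g : ℕ → ℝ≥0∞)
    (hg : ∀ j < N + 1, g j ≤ T j + B)
    (hT : ∑ j ∈ Finset.range (N + 1), T j ≤ (N + 1) * G) :
    ∑ j : Fin (N + 1), ((N + 1 : ℕ) : ℝ≥0∞)⁻¹ * g j ≤ G + B := by
  have hN : ((N + 1 : ℕ) : ℝ≥0∞) ≠ 0 := by simp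
  have hN' : ((N + 1 : ℕ) : ℝ≥0∞) ≠ ⊤ := ENNReal.natCast_ne_top _
  rw [← Finset.mul_sum, Fin.sum_univ_eq_sum_range (fun j => g j)]
  calc ((N + 1 : ℕ) : ℝ≥0∞)⁻¹ * ∑ j ∈ Finset.range (N + 1), g j
      ≤ ((N + 1 : ℕ) : ℝ≥0∞)⁻¹ * ∑ j ∈ Finset.range (N + 1), ((T j : ℝ≥0∞) + B) := by
        gcongr with j hj; exact hg j (Finset.mem_range.1 hj)
    _ = ((N + 1 : ℕ) : ℝ≥0∞)⁻¹ *
          (((∑ j ∈ Finset.range (N + 1), T j : ℕ) : ℝ≥0∞) + (N + 1 : ℕ) * B) := by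
        rw [Finset.sum_add_distrib]; simp
    _ ≤ ((N + 1 : ℕ) : ℝ≥0∞)⁻¹ * ((((N + 1) * G : ℕ) : ℝ≥0∞) + (N + 1 : ℕ) * B) := by
        gcongr
    _ = G + B := by
        rw [Nat.cast_mul, ← mul_add, ← mul_assoc, ENNReal.inv_mul_cancel hN hN', one_mul]

/-- Only the average of the bounds `T j` counts, so single outcomes may be expensive. The analysis
of hashing enters here. -/
theorem Run.seq_rand {x : ℕ} {e : Expr} {c : Cmd} {s : State} {T : ℕ → ℕ} {G N : ℕ}
    {Q : State → Prop} (hN : ⌊e.eval s⌋₊ + 1 = N)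
    (hc : ∀ j < N, Run c (s.setReg x (j : ℝ)) (T j) Q)
    (hT : ∑ j ∈ Finset.range N, T j ≤ N * G) :
    Run (.seq (.rand x e) c) s (2 + e.ops + G) Q := by
  subst hN
  intro f B hB
  simp only [ert]
  have := avg_le B (fun j => ert c f (s.setReg x (j : ℝ))) (fun j hj => hc j hj f B hB) hT
  calc _ ≤ 1 + (((1 + e.ops : ℕ) : ℝ≥0∞) + (G + B)) := by gcongr
    _ = _ := by push_cast; ring

/-- A loop whose body starts with a random choice and shrinks, on average, a size `m`. -/
theorem Run.loop_pivot {b : Test} {x : ℕ} {e : Expr} {c : Cmd} (Inv : ℕ → State → Prop)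
    (C : ℕ) {Q : State → Prop} (hQ : ∀ m s, Inv m s → ¬ b.holds s → Q s)
    (hstep : ∀ m s, Inv m s → b.holds s → ∃ T g : ℕ → ℕ,
      (∀ j < ⌊e.eval s⌋₊ + 1,
        Run c (s.setReg x (j : ℝ)) (T j) fun s' => ∃ m' ≤ g j, Inv m' s') ∧
      ∑ j ∈ Finset.range (⌊e.eval s⌋₊ + 1), (T j + C * g j + (3 + b.ops + e.ops)) ≤
        (⌊e.eval s⌋₊ + 1) * (C * m))
    {m : ℕ} {s : State} (hs : Inv m s) :
    Run (.loop b (.seq (.rand x e) c)) s (C * m + (1 + b.ops)) Q := by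
  classical
  intro f B hB
  -- A memory may satisfy `Inv` for several sizes `m`; the infimum over all of them is the required
  -- pre-fixed point.
  set X : State → ℝ≥0∞ := fun s =>
    ⨅ m : ℕ, ⨅ _ : Inv m s, ((C * m + (1 + b.ops) : ℕ) : ℝ≥0∞) + B with hX
  refine (ert_loop_le b _ f X (fun s => ?_) s).trans (iInf₂_le m hs)
  refine le_iInf₂ fun m hm => ?_
  unfold ertLoop
  split_ifs with hb
  · obtain ⟨T, g, hc, hsum⟩ := hstep m s hm hb
    simp only [ert]
    -- The overhead `3 + b.ops + e.ops` is `2 + e.ops` for the sequencing and the random draw, and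
    -- `1 + b.ops` for the next loop test.
    have h1 := avg_le (T := fun j => T j + C * g j + (3 + b.ops + e.ops)) (G := C * m)
      B (fun j => ert c X (s.setReg x (j : ℝ)) + ((2 + e.ops : ℕ) : ℝ≥0∞)) ?_ hsum
    · have h2 : ∑ j : Fin (⌊e.eval s⌋₊ + 1), ((⌊e.eval s⌋₊ + 1 : ℕ) : ℝ≥0∞)⁻¹ *
            (ert c X (s.setReg x (((j : ℕ) : ℝ))) + ((2 + e.ops : ℕ) : ℝ≥0∞)) =
          ∑ j : Fin (⌊e.eval s⌋₊ + 1), ((⌊e.eval s⌋₊ + 1 : ℕ) : ℝ≥0∞)⁻¹ *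
            ert c X (s.setReg x (((j : ℕ) : ℝ))) + ((2 + e.ops : ℕ) : ℝ≥0∞) := by
        simp only [mul_add, Finset.sum_add_distrib]
        congr 1
        rw [Finset.sum_const, Finset.card_univ, Fintype.card_fin, nsmul_eq_mul, ← mul_assoc,
          ENNReal.mul_inv_cancel (by simp) (ENNReal.natCast_ne_top _), one_mul]
      rw [h2] at h1
      calc _ = ((1 + b.ops : ℕ) : ℝ≥0∞) + (∑ j : Fin (⌊e.eval s⌋₊ + 1),
            ((⌊e.eval s⌋₊ + 1 : ℕ) : ℝ≥0∞)⁻¹ * ert c X (s.setReg x (((j : ℕ) : ℝ))) +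
              ((2 + e.ops : ℕ) : ℝ≥0∞)) := by push_cast; ring
        _ ≤ ((1 + b.ops : ℕ) : ℝ≥0∞) + (((C * m : ℕ) : ℝ≥0∞) + B) := by gcongr
        _ = _ := by push_cast; ring
    · intro j hj
      have := hc j hj X (((C * g j + (1 + b.ops) : ℕ) : ℝ≥0∞) + B) ?_
      · calc _ ≤ (T j + (((C * g j + (1 + b.ops) : ℕ) : ℝ≥0∞) + B)) + ((2 + e.ops : ℕ) : ℝ≥0∞) := by
              gcongr
          _ = _ := by push_cast; ring
      · rintro s' ⟨m', hm', hI⟩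
        refine (iInf₂_le m' hI).trans ?_
        gcongr
  · have := hB s (hQ m s hm hb)
    calc ((1 + b.ops : ℕ) : ℝ≥0∞) + f s ≤ ((1 + b.ops : ℕ) : ℝ≥0∞) + B := by gcongr
      _ ≤ ((C * m + (1 + b.ops) : ℕ) : ℝ≥0∞) + B := by
        gcongr ?_ + B
        exact_mod_cast Nat.le_add_left _ _

/-- A counting loop. -/
theorem Run.for_loop {x y : ℕ} {c : Cmd} (m : ℕ) (Inv : ℕ → State → Prop) (t : ℕ → ℕ)
    (hx : ∀ i s, Inv i s → s.reg x = i) (hy : ∀ i s, Inv i s → s.reg y = m)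
    (hc : ∀ i < m, ∀ s, Inv i s → Run c s (t i) (Inv (i + 1))) {s : State} (h0 : Inv 0 s) :
    Run (.loop (.lt (.var x) (.var y)) c) s (∑ i ∈ Finset.range m, (t i + 4) + 4) (Inv m) := by
  suffices h : ∀ k, ∀ i s, i + k = m → Inv i s →
      Run (.loop (.lt (.var x) (.var y)) c) s (∑ j ∈ Finset.Ico i m, (t j + 4) + 4) (Inv m) by
    rw [Finset.range_eq_Ico]
    exact h m 0 s (zero_add m) h0
  intro k
  induction k with
  | zero =>
    intro i s hi hI
    obtain rfl : i = m := by omega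
    refine (Run.loop_false ?_ hI).mono ?_ (fun _ => id)
    · simp [Test.holds, Expr.eval, hx _ s hI, hy _ s hI]
    · simp [Test.ops, Expr.ops]
  | succ k ih =>
    intro i s hi hI
    refine (Run.loop_true (T₂ := ∑ j ∈ Finset.Ico (i + 1) m, (t j + 4) + 4) ?_
      (hc i (by omega) s hI) (fun s' hs' => ih (i + 1) s' (by omega) hs')).mono ?_ (fun _ => id)
    · simp only [Test.holds, Expr.eval, hx _ s hI, hy _ s hI]; exact_mod_cast (by omega : i < m)
    · rw [Finset.sum_eq_sum_Ico_succ_bot (by omega : i < m)]; simp [Test.ops, Expr.ops]; omega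

/-! ### Straight-line code -/

/-- Commands without loops, allocations and random choices. -/
def Cmd.Simple : Cmd → Prop
  | .skip => True
  | .assign _ _ => True
  | .store _ _ _ => True
  | .alloc _ _ => False
  | .rand _ _ => False
  | .seq c d => c.Simple ∧ d.Simple
  | .ite _ c d => c.Simple ∧ d.Simple
  | .loop _ _ => False

open Classical in
/-- The effect of a simple command. -/
noncomputable def Cmd.exec : Cmd → State → State
  | .assign x e, s => s.setReg x (e.eval s)
  | .store a i e, s => s.setArr a ((s.arr a).set ⌊i.eval s⌋₊ (e.eval s))
  | .seq c d, s => d.exec (c.exec s)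
  | .ite b c d, s => if b.holds s then c.exec s else d.exec s
  | _, s => s

/-- Total number of operations in the text of a command. -/
def Cmd.size : Cmd → ℕ
  | .skip => 1
  | .assign _ e => 1 + e.ops
  | .store _ i e => 1 + i.ops + e.ops
  | .alloc _ e => 1 + e.ops
  | .rand _ e => 1 + e.ops
  | .seq c d => 1 + c.size + d.size
  | .ite b c d => 1 + b.ops + (c.size + d.size)
  | .loop b c => 1 + b.ops + c.size

/-- `size` counts both branches of every conditional, so it bounds the time on every path. -/
theorem Run.of_simple {c : Cmd} : ∀ {s : State} {Q : State → Prop}, c.Simple → Q (c.exec s) →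
    Run c s c.size Q := by
  induction c with
  | skip => intro s Q _ h; exact Run.skip h
  | assign x e => intro s Q _ h; exact Run.assign h
  | store a i e => intro s Q _ h; exact Run.store h
  | alloc a e => intro s Q hs; exact hs.elim
  | rand x e => intro s Q hs; exact hs.elim
  | seq c d hc hd =>
    intro s Q hs h
    exact Run.seq (hc (Q := fun s' => s' = c.exec s) hs.1 rfl)
      (fun s' hs' => hd hs.2 (by subst hs'; exact h))
  | ite b c d hc hd =>
    intro s Q hs h
    refine Run.ite (fun hb => ?_) (fun hb => ?_)
    · exact (hc hs.1 (by simpa [Cmd.exec, hb] using h)).mono (by omega) (fun _ => id)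
    · exact (hd hs.2 (by simpa [Cmd.exec, hb] using h)).mono (by omega) (fun _ => id)
  | loop b c => intro s Q hs; exact hs.elim

/-! ## Hashing integers -/

/-- The slot of the integer `q` in a table of length `m`, for the random multiplier `r`. -/
noncomputable def slot (m N r : ℕ) (q : ℤ) : ℕ := ⌊(m : ℝ) * Int.fract ((r : ℝ) * q / N)⌋₊

theorem slot_lt {m : ℕ} (hm : 0 < m) (N r : ℕ) (q : ℤ) : slot m N r q < m := by
  unfold slot
  have hm' : (0 : ℝ) < m := by exact_mod_cast hm
  rw [Nat.floor_lt (mul_nonneg hm'.le (Int.fract_nonneg _))]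
  exact mul_lt_of_lt_one_right hm' (Int.fract_lt_one _)

theorem card_le_of_sub_le {S : Finset ℕ} {L : ℕ} (h : ∀ a ∈ S, ∀ b ∈ S, a ≤ b + L) :
    S.card ≤ L + 1 := by
  rcases S.eq_empty_or_nonempty with rfl | hS
  · simp
  · have : S ⊆ Finset.Icc (S.min' hS) (S.min' hS + L) := fun a ha =>
      Finset.mem_Icc.2 ⟨S.min'_le a ha, h a ha _ (S.min'_mem hS)⟩
    refine (Finset.card_le_card this).trans ?_
    simp; omega

/-- Equal slots force the two fractional parts to differ by less than `1/m`. After multiplication by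
`N`, the integer parts combine into `z`. -/
theorem exists_mul_sub_mul_lt {m N r : ℕ} (hm : 0 < m) (hN : 0 < N) {a b : ℤ}
    (h : slot m N r a = slot m N r b) :
    ∃ z : ℤ, (m : ℤ) * |r * (a - b) - z * N| < N := by
  refine ⟨⌊(r : ℝ) * a / N⌋ - ⌊(r : ℝ) * b / N⌋, ?_⟩
  have hN' : (0 : ℝ) < N := by exact_mod_cast hN
  have hm' : (0 : ℝ) < m := by exact_mod_cast hm
  have h1 : |(m : ℝ) * Int.fract ((r : ℝ) * a / N) - m * Int.fract ((r : ℝ) * b / N)| < 1 := by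
    have ha := Nat.floor_le (mul_nonneg hm'.le (Int.fract_nonneg ((r : ℝ) * a / N)))
    have hb := Nat.floor_le (mul_nonneg hm'.le (Int.fract_nonneg ((r : ℝ) * b / N)))
    have ha' := Nat.lt_floor_add_one ((m : ℝ) * Int.fract ((r : ℝ) * a / N))
    have hb' := Nat.lt_floor_add_one ((m : ℝ) * Int.fract ((r : ℝ) * b / N))
    unfold slot at h
    rw [h] at ha ha'
    rw [abs_lt]; constructor <;> linarith
  have h2 : (N : ℝ) * (Int.fract ((r : ℝ) * a / N) - Int.fract ((r : ℝ) * b / N)) =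
      r * (a - b) - (⌊(r : ℝ) * a / N⌋ - ⌊(r : ℝ) * b / N⌋) * N := by
    unfold Int.fract; field_simp; ring
  have h3 : (m : ℝ) * |(r : ℝ) * (a - b) - (⌊(r : ℝ) * a / N⌋ - ⌊(r : ℝ) * b / N⌋) * N| < N := by
    rw [← h2, abs_mul, abs_of_pos hN']
    rw [← mul_sub, abs_mul, abs_of_pos hm'] at h1
    nlinarith
  exact_mod_cast h3

/-- A collision puts `rD`, with `D = |a - b|`, within `N/m` of a multiple `zN`. For each of the `D +
1` possible `z`, such `r` span less than `2N/(mD)`, so there are at most `2N/(mD) + 1` of them. No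
primality of `N` is involved; it only has to be large compared with `mD`. -/
theorem card_slot_eq_le {m N : ℕ} (hm : 0 < m) {a b : ℤ} (hab : a ≠ b)
    (hN : 2 * m * (a - b).natAbs ≤ N) :
    m * ((Finset.range N).filter fun r => slot m N r a = slot m N r b).card ≤ 5 * N := by
  obtain ⟨D, hD⟩ : ∃ D, D = (a - b).natAbs := ⟨_, rfl⟩
  rw [← hD] at hN
  have hD0 : 0 < D := by rw [hD]; omega
  have hN0 : 0 < N := lt_of_lt_of_le (by positivity) hN
  set S : ℕ → Finset ℕ := fun z =>
    (Finset.range N).filter fun r => (m : ℤ) * |(r : ℤ) * D - z * N| < N with hS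
  -- Since `0 ≤ r < N` and the deviation is below `N`, only `0 ≤ z ≤ D` can occur.
  have hsub : ((Finset.range N).filter fun r => slot m N r a = slot m N r b) ⊆
      (Finset.range (D + 1)).biUnion S := by
    intro r hr
    rw [Finset.mem_filter, Finset.mem_range] at hr
    obtain ⟨z, hz⟩ := exists_mul_sub_mul_lt hm hN0 hr.2
    obtain ⟨z', hz'⟩ : ∃ z' : ℤ, (m : ℤ) * |(r : ℤ) * D - z' * N| < N := by
      rcases le_total 0 (a - b) with h | h
      · exact ⟨z, by rwa [show (D : ℤ) = a - b by omega]⟩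
      · refine ⟨-z, ?_⟩
        rw [show (D : ℤ) = -(a - b) by omega,
          show (r : ℤ) * -(a - b) - -z * N = -(r * (a - b) - z * N) by ring, abs_neg]
        exact hz
    have hlt : |(r : ℤ) * D - z' * N| < N := by
      refine lt_of_le_of_lt ?_ hz'
      exact le_mul_of_one_le_left (abs_nonneg _) (by exact_mod_cast hm)
    rw [abs_lt] at hlt
    have hr1 : (r : ℤ) + 1 ≤ N := by exact_mod_cast hr.1
    have hz0 : 0 ≤ z' := by
      by_contra hneg
      have : z' * N ≤ -1 * N := by
        apply mul_le_mul_of_nonneg_right (by omega) (by positivity)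
      have : (0 : ℤ) ≤ r * D := by positivity
      linarith
    have hzD : z' ≤ D := by
      by_contra hgt
      have h1 : ((D : ℤ) + 1) * N ≤ z' * N := by
        apply mul_le_mul_of_nonneg_right (by omega) (by positivity)
      have h2 : ((r : ℤ) + 1) * D ≤ N * D := by
        apply mul_le_mul_of_nonneg_right hr1 (by positivity)
      have : (0 : ℤ) < D := by exact_mod_cast hD0
      nlinarith
    obtain ⟨z'', rfl⟩ := Int.eq_ofNat_of_zero_le hz0
    rw [Finset.mem_biUnion]
    exact ⟨z'', Finset.mem_range.2 (by omega), Finset.mem_filter.2 ⟨Finset.mem_range.2 hr.1, hz'⟩⟩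
  have hcard : ∀ z, (S z).card ≤ 2 * N / (D * m) + 1 := by
    intro z
    refine card_le_of_sub_le fun r hr r' hr' => ?_
    rw [← Nat.sub_le_iff_le_add', Nat.le_div_iff_mul_le (by positivity)]
    have h1 := (Finset.mem_filter.1 hr).2
    have h2 := (Finset.mem_filter.1 hr').2
    rcases le_total r r' with h | h
    · simp [Nat.sub_eq_zero_of_le h]
    · zify [h]
      have h3 := abs_sub ((r : ℤ) * D - z * N) (r' * D - z * N)
      have h4 := le_abs_self (((r : ℤ) * D - z * N) - (r' * D - z * N))
      have hm' : (0 : ℤ) < m := by exact_mod_cast hm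
      nlinarith
  have htot := (Finset.card_le_card hsub).trans Finset.card_biUnion_le
  have htot' := htot.trans (Finset.sum_le_card_nsmul _ _ _ fun z _ => hcard z)
  rw [Finset.card_range, smul_eq_mul] at htot'
  have hdiv : (2 * N / (D * m)) * (D * m) ≤ 2 * N := Nat.div_mul_le_self _ _
  set q := 2 * N / (D * m)
  set t := ((Finset.range N).filter fun r => slot m N r a = slot m N r b).card
  -- With `D + 1 ≤ 2D`, the product splits into `2mDq ≤ 4N`, by `hdiv`, and `2mD ≤ N`, by `hN`.
  have e1 : m * t ≤ m * ((D + 1) * (q + 1)) := Nat.mul_le_mul_left _ htot'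
  have e2 : m * ((D + 1) * (q + 1)) ≤ m * ((2 * D) * (q + 1)) := by
    gcongr; omega
  nlinarith

/-- Total number of coincidences with a query, over all multipliers. -/
theorem sum_card_slot_le {m N : ℕ} (hm : 0 < m) (K : Finset ℕ) (hK : K.card ≤ m) (key : ℕ → ℤ)
    (hinj : Set.InjOn key K) (q : ℤ) (hN : ∀ u ∈ K, 2 * m * (key u - q).natAbs ≤ N) :
    ∑ r ∈ Finset.range N, (K.filter fun u => slot m N r (key u) = slot m N r q).card ≤ 6 * N := by
  have hswap : ∑ r ∈ Finset.range N, (K.filter fun u => slot m N r (key u) = slot m N r q).card =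
      ∑ u ∈ K, ((Finset.range N).filter fun r => slot m N r (key u) = slot m N r q).card := by
    simp only [Finset.card_filter]
    exact Finset.sum_comm
  -- The query itself may be a key: it then coincides for all `N` multipliers, but only once, by
  -- injectivity. The at most `m` other keys contribute at most `5N/m` each.
  rw [hswap, ← Finset.sum_filter_add_sum_filter_not K (fun u => key u = q)]
  have h1 : ∑ u ∈ K.filter (fun u => key u = q),
      ((Finset.range N).filter fun r => slot m N r (key u) = slot m N r q).card ≤ N := by
    have hc : (K.filter (fun u => key u = q)).card ≤ 1 := by
      rw [Finset.card_le_one]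
      intro u hu v hv
      rw [Finset.mem_filter] at hu hv
      exact hinj hu.1 hv.1 (hu.2.trans hv.2.symm)
    refine (Finset.sum_le_card_nsmul _ _ N fun u _ => ?_).trans ?_
    · exact (Finset.card_filter_le _ _).trans (by simp)
    · simpa using Nat.mul_le_mul_right N hc
  have h2 : ∑ u ∈ K.filter (fun u => ¬ key u = q),
      ((Finset.range N).filter fun r => slot m N r (key u) = slot m N r q).card ≤ 5 * N := by
    refine Nat.le_of_mul_le_mul_left ?_ hm
    rw [Finset.mul_sum]
    refine (Finset.sum_le_card_nsmul _ _ (5 * N) fun u hu => ?_).trans ?_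
    · rw [Finset.mem_filter] at hu
      exact card_slot_eq_le hm hu.2 (hN u hu.1)
    · rw [smul_eq_mul]
      exact Nat.mul_le_mul_right _ ((Finset.card_filter_le _ _).trans hK)
  omega

/-! ### Keys -/

/-- The integer with digits `v 0, …, v (k - 1)` in base `B`. -/
def horner (B : ℤ) (v : ℕ → ℤ) : ℕ → ℤ
  | 0 => 0
  | k + 1 => horner B v k * B + v k

theorem horner_congr {B : ℤ} {v w : ℕ → ℤ} {k : ℕ} (h : ∀ a < k, v a = w a) :
    horner B v k = horner B w k := by
  induction k with
  | zero => rfl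
  | succ k ih => simp [horner, ih fun a ha => h a (by omega), h k (by omega)]

theorem horner_add (B : ℤ) (v w : ℕ → ℤ) (k : ℕ) :
    horner B v k + horner B w k = horner B (fun a => v a + w a) k := by
  induction k with
  | zero => simp [horner]
  | succ k ih => simp only [horner, ← ih]; ring

theorem horner_sub (B : ℤ) (v w : ℕ → ℤ) (k : ℕ) :
    horner B v k - horner B w k = horner B (fun a => v a - w a) k := by
  induction k with
  | zero => simp [horner]
  | succ k ih => simp only [horner, ← ih]; ring

/-- The last digit is divisible by `B` and smaller than `B` in absolute value, hence zero; then
divide by `B`. Applied to differences of digit vectors, this makes the packing of cell indices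
injective. -/
theorem eq_zero_of_horner_eq_zero {B : ℤ} {v : ℕ → ℤ} {k : ℕ} (hv : ∀ a < k, |v a| < B)
    (h : horner B v k = 0) : ∀ a < k, v a = 0 := by
  induction k with
  | zero => intro a ha; omega
  | succ k ih =>
    simp only [horner] at h
    have h0 : v k = 0 := by
      refine Int.eq_zero_of_abs_lt_dvd (m := B) ⟨-horner B v k, by linarith⟩ (hv k (by omega))
    have hB : B ≠ 0 := fun hB => by
      have := hv k (by omega); rw [hB] at this; exact absurd this (not_lt.2 (abs_nonneg _))
    have h1 : horner B v k = 0 := by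
      rw [h0, add_zero] at h
      exact (mul_eq_zero.1 h).resolve_right hB
    intro a ha
    rcases Nat.lt_succ_iff_lt_or_eq.1 ha with h2 | rfl
    · exact ih (fun a ha => hv a (by omega)) h1 a h2
    · exact h0

/-- Integrality matters: digits are at most `B - 1` in absolute value, so the geometric sum is at
most `B ^ k - 1`. -/
theorem abs_horner_lt {B : ℤ} (hB : 0 < B) {v : ℕ → ℤ} {k : ℕ} (hv : ∀ a < k, |v a| < B) :
    |horner B v k| < B ^ k := by
  induction k with
  | zero => simp [horner]
  | succ k ih =>
    have h1 := ih fun a ha => hv a (by omega)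
    have h2 := hv k (by omega)
    calc |horner B v (k + 1)| ≤ |horner B v k * B| + |v k| := abs_add_le _ _
      _ = |horner B v k| * B + |v k| := by rw [abs_mul, abs_of_pos hB]
      _ < B ^ (k + 1) := by rw [pow_succ]; nlinarith

/-! ## Ranks -/

/-- Among the elements of small upper rank take one with the least value: all the others lie above
it, so they are counted by its rank. -/
theorem four_mul_card_rank_le (S : Finset ℕ) (D : ℕ → ℝ) :
    4 * (S.filter fun i => 4 * (S.filter fun b => D i ≤ D b).card < S.card).card ≤ S.card := by
  set Z := S.filter fun i => 4 * (S.filter fun b => D i ≤ D b).card < S.card with hZ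
  rcases Z.eq_empty_or_nonempty with h | h
  · simp [h]
  · obtain ⟨i, hi, hmin⟩ := Z.exists_min_image D h
    have : Z ⊆ S.filter fun b => D i ≤ D b := fun b hb =>
      Finset.mem_filter.2 ⟨(Finset.mem_filter.1 hb).1, hmin b hb⟩
    have := Finset.card_le_card this
    have := (Finset.mem_filter.1 hi).2
    omega

/-- A uniformly random element removes, on average, a constant fraction when everything above it or
everything below it is removed. -/
theorem sq_card_le_sum_min (S : Finset ℕ) (D : ℕ → ℝ) :
    S.card * S.card ≤ 8 * ∑ i ∈ S, min (S.filter fun b => D i ≤ D b).card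
      (S.filter fun b => D b ≤ D i).card := by
  have h1 := four_mul_card_rank_le S D
  have h2 := four_mul_card_rank_le S (fun i => - D i)
  simp only [neg_le_neg_iff] at h2
  set Z := S.filter fun i => 4 * (S.filter fun b => D i ≤ D b).card < S.card
  set Z' := S.filter fun i => 4 * (S.filter fun b => D b ≤ D i).card < S.card
  -- At most a quarter of the elements fails on either side, so at least half have both ranks at
  -- least `|S|/4`.
  have h3 : S.card ≤ 2 * (S \ (Z ∪ Z')).card := by
    have := Finset.card_union_le Z Z'
    have := Finset.le_card_sdiff (Z ∪ Z') S
    omega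
  have h4 : (S \ (Z ∪ Z')).card * S.card ≤ ∑ i ∈ S \ (Z ∪ Z'),
      4 * min (S.filter fun b => D i ≤ D b).card (S.filter fun b => D b ≤ D i).card := by
    rw [← smul_eq_mul]
    refine Finset.card_nsmul_le_sum _ _ _ fun i hi => ?_
    simp only [Finset.mem_sdiff, Finset.mem_union, not_or, Z, Z', Finset.mem_filter, not_and,
      not_lt] at hi
    have := hi.2.1 hi.1
    have := hi.2.2 hi.1
    omega
  have h5 := h4.trans (Finset.sum_le_sum_of_subset (Finset.sdiff_subset))
  rw [← Finset.mul_sum] at h5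
  nlinarith

/-! ## Nearest neighbours of an indexed family -/

section NN

variable {X : Type*} [MetricSpace X]

/-- Distance of `x i` to the nearest of the other points with index in `S`. -/
noncomputable def nnd (x : ℕ → X) (S : Finset ℕ) (i : ℕ) : ℝ :=
  sInf ((fun j => dist (x i) (x j)) '' (S.erase i : Set ℕ))

variable {x : ℕ → X} {S T : Finset ℕ} {i j : ℕ} {t : ℝ}

theorem nnd_le (hj : j ∈ S) (hij : j ≠ i) : nnd x S i ≤ dist (x i) (x j) :=
  csInf_le ⟨0, by rintro _ ⟨k, _, rfl⟩; exact dist_nonneg⟩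
    ⟨j, by simpa using ⟨hj, hij⟩, rfl⟩

theorem exists_ne_of_two_le_card (hS : 2 ≤ S.card) (i : ℕ) : ∃ j ∈ S, j ≠ i := by
  obtain ⟨a, ha, b, hb, hab⟩ := Finset.one_lt_card.1 hS
  by_cases h : a = i
  · exact ⟨b, hb, fun hbi => hab (h.trans hbi.symm)⟩
  · exact ⟨a, ha, h⟩

theorem exists_eq_nnd (hS : 2 ≤ S.card) (i : ℕ) : ∃ j ∈ S, j ≠ i ∧ nnd x S i = dist (x i) (x j) := by
  obtain ⟨j, hj, hji⟩ := exists_ne_of_two_le_card hS i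
  have hne : ((fun j => dist (x i) (x j)) '' (S.erase i : Set ℕ)).Nonempty :=
    ⟨_, j, by simpa using ⟨hj, hji⟩, rfl⟩
  obtain ⟨k, hk, hk'⟩ := hne.csInf_mem ((Finset.finite_toSet _).image _)
  simp only [Finset.coe_erase, Set.mem_sdiff, Finset.mem_coe, Set.mem_singleton_iff] at hk
  exact ⟨k, hk.1, hk.2, hk'.symm⟩

/-- Two elements are required: otherwise the infimum may run over the empty set and take the default
value `0`. -/
theorem nnd_mono (hTS : T ⊆ S) (hT : 2 ≤ T.card) : nnd x S i ≤ nnd x T i := by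
  obtain ⟨j, hj, hji, h⟩ := exists_eq_nnd (x := x) hT i
  rw [h]
  exact nnd_le (hTS hj) hji

/-- Translates between the two ways of naming an active point: by its position in the list, as
programs do, and by its index in the input. -/
theorem nnd_comp_image (x : ℕ → X) (w : ℕ → ℕ) (hw : Set.InjOn w S) (hi : i ∈ S) :
    nnd x (S.image w) (w i) = nnd (fun k => x (w k)) S i := by
  unfold nnd
  congr 1
  ext r
  simp only [Set.mem_image, Finset.coe_erase, Finset.coe_image, Set.mem_sdiff,
    Set.mem_singleton_iff, Finset.mem_coe]
  constructor
  · rintro ⟨_, ⟨⟨k, hk, rfl⟩, hki⟩, rfl⟩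
    exact ⟨k, ⟨hk, fun h => hki (h ▸ rfl)⟩, rfl⟩
  · rintro ⟨k, ⟨hk, hki⟩, rfl⟩
    exact ⟨w k, ⟨⟨k, hk, rfl⟩, fun h => hki (hw hk hi h)⟩, rfl⟩

end NN

/-! ## Grids and nets -/

section Grid

variable {d : ℕ}

/-- The grid cell, of side `s`, of a point. -/
noncomputable def cell (s : ℝ) (y : EuclideanSpace ℝ (Fin d)) (a : ℕ) : ℤ :=
  if h : a < d then ⌊y ⟨a, h⟩ / s⌋ else 0

/-- The cells of two points differ by at most `k` in every coordinate. -/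
def Near (s : ℝ) (k : ℤ) (y z : EuclideanSpace ℝ (Fin d)) : Prop :=
  ∀ a < d, |cell s z a - cell s y a| ≤ k

theorem Near.symm {s : ℝ} {k : ℤ} {y z : EuclideanSpace ℝ (Fin d)} (h : Near s k y z) :
    Near s k z y := fun a ha => by rw [abs_sub_comm]; exact h a ha

theorem Near.refl (s : ℝ) {k : ℤ} (hk : 0 ≤ k) (y : EuclideanSpace ℝ (Fin d)) :
    Near s k y y := fun a _ => by simpa using hk

theorem abs_coord_le_dist (y z : EuclideanSpace ℝ (Fin d)) (a : Fin d) :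
    |y a - z a| ≤ dist y z := by
  rw [dist_eq_norm]
  simpa using PiLp.norm_apply_le (y - z) a

/-- Coordinates in adjacent intervals differ by at most `2s`. Using `√d ≤ d` keeps all thresholds of
the algorithm integer multiples of the side. -/
theorem dist_le_of_near {s : ℝ} (hs : 0 < s) {y z : EuclideanSpace ℝ (Fin d)}
    (h : Near s 1 y z) : dist y z ≤ 2 * d * s := by
  have hc : ∀ a, |y a - z a| ≤ 2 * s := by
    intro a
    have := h a a.2
    simp only [cell, a.2, dif_pos, Fin.eta] at this
    have h1 := Int.floor_le (y a / s)
    have h2 := Int.lt_floor_add_one (y a / s)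
    have h3 := Int.floor_le (z a / s)
    have h4 := Int.lt_floor_add_one (z a / s)
    rw [abs_le] at this
    have h5 : ((-1 : ℤ) : ℝ) ≤ ((⌊z a / s⌋ - ⌊y a / s⌋ : ℤ) : ℝ) := by exact_mod_cast this.1
    have h6 : ((⌊z a / s⌋ - ⌊y a / s⌋ : ℤ) : ℝ) ≤ ((1 : ℤ) : ℝ) := by exact_mod_cast this.2
    push_cast at h5 h6
    have h7 : |y a / s - z a / s| ≤ 2 := by rw [abs_le]; constructor <;> linarith
    rw [← sub_div, abs_div, abs_of_pos hs, div_le_iff₀ hs] at h7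
    exact h7
  rw [EuclideanSpace.dist_eq]
  refine Real.sqrt_le_iff.2 ⟨by positivity, ?_⟩
  calc ∑ a, dist (y a) (z a) ^ 2 ≤ ∑ _a : Fin d, (2 * s) ^ 2 := by
        refine Finset.sum_le_sum fun a _ => ?_
        rw [Real.dist_eq]
        exact pow_le_pow_left₀ (abs_nonneg _) (hc a) 2
    _ = d * (2 * s) ^ 2 := by simp
    _ ≤ (2 * d * s) ^ 2 := by
        have : (d : ℝ) ≤ d * d := by exact_mod_cast Nat.le_mul_self d
        nlinarith [sq_nonneg s]

theorem near_of_dist_le {s : ℝ} (hs : 0 < s) {k : ℕ} {y z : EuclideanSpace ℝ (Fin d)}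
    (h : dist y z ≤ k * s) : Near s k y z := by
  intro a ha
  have h0 := (abs_coord_le_dist y z ⟨a, ha⟩).trans h
  simp only [cell, ha, dif_pos]
  have h7 : |y ⟨a, ha⟩ / s - z ⟨a, ha⟩ / s| ≤ k := by
    rwa [← sub_div, abs_div, abs_of_pos hs, div_le_iff₀ hs]
  rw [abs_le] at h7
  have h1 := Int.floor_le (y ⟨a, ha⟩ / s)
  have h2 := Int.lt_floor_add_one (y ⟨a, ha⟩ / s)
  have h3 := Int.floor_le (z ⟨a, ha⟩ / s)
  have h4 := Int.lt_floor_add_one (z ⟨a, ha⟩ / s)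
  have h5 : ((⌊z ⟨a, ha⟩ / s⌋ - ⌊y ⟨a, ha⟩ / s⌋ : ℤ) : ℝ) < ((k + 1 : ℤ) : ℝ) := by
    push_cast; linarith
  have h6 : ((-(k + 1) : ℤ) : ℝ) < ((⌊z ⟨a, ha⟩ / s⌋ - ⌊y ⟨a, ha⟩ / s⌋ : ℤ) : ℝ) := by
    push_cast; linarith
  rw [Int.cast_lt] at h5 h6
  rw [abs_le]; omega

variable (s : ℝ) (x : ℕ → EuclideanSpace ℝ (Fin d))

open Classical in
/-- The greedy net: an index is kept unless a kept one is in a neighbouring cell. -/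
noncomputable def net : ℕ → Finset ℕ
  | 0 => ∅
  | i + 1 => if ∃ u ∈ net i, Near s 1 (x i) (x u) then net i else insert i (net i)

theorem net_subset (m : ℕ) : net s x m ⊆ Finset.range m := by
  induction m with
  | zero => simp [net]
  | succ m ih =>
    have h : Finset.range m ⊆ Finset.range (m + 1) := Finset.range_mono (Nat.le_succ m)
    rw [net]
    split_ifs
    · exact ih.trans h
    · exact Finset.insert_subset (by simp) (ih.trans h)

theorem card_net_le (m : ℕ) : (net s x m).card ≤ m := by
  simpa using Finset.card_le_card (net_subset s x m)

theorem net_separated (m : ℕ) : ∀ u ∈ net s x m, ∀ v ∈ net s x m, u ≠ v →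
    ¬ Near s 1 (x u) (x v) := by
  induction m with
  | zero => simp [net]
  | succ m ih =>
    rw [net]
    split_ifs with h
    · exact ih
    · push Not at h
      intro u hu v hv huv
      rw [Finset.mem_insert] at hu hv
      rcases hu with rfl | hu <;> rcases hv with rfl | hv
      · exact absurd rfl huv
      · exact h v hv
      · exact fun hn => h u hu hn.symm
      · exact ih u hu v hv huv

theorem net_covers (m : ℕ) : ∀ i < m, i ∉ net s x m → ∃ u ∈ net s x m, Near s 1 (x i) (x u) := by
  induction m with
  | zero => intro i hi; omega
  | succ m ih =>
    intro i hi
    rw [net]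
    split_ifs with h
    · intro hin
      rcases Nat.lt_succ_iff_lt_or_eq.1 hi with hlt | rfl
      · exact ih i hlt hin
      · exact h
    · intro hin
      rw [Finset.mem_insert, not_or] at hin
      obtain ⟨u, hu, hn⟩ := ih i (by omega) hin.2
      exact ⟨u, Finset.mem_insert_of_mem hu, hn⟩

theorem net_mono (i : ℕ) : net s x i ⊆ net s x (i + 1) := by
  rw [net]; split_ifs
  · exact subset_rfl
  · exact Finset.subset_insert _ _

theorem net_mono_of_le {i j : ℕ} (h : i ≤ j) : net s x i ⊆ net s x j := by
  induction h with
  | refl => exact subset_rfl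
  | step _ ih => exact ih.trans (net_mono s x _)

variable {s x}

theorem lt_dist_of_mem_net (hs : 0 < s) {m u v : ℕ} (hu : u ∈ net s x m) (hv : v ∈ net s x m)
    (huv : u ≠ v) : s < dist (x u) (x v) := by
  by_contra h
  exact net_separated s x m u hu v hv huv (by simpa using near_of_dist_le (k := 1) hs (by simpa using h))

-- Two net points in one cell would be near each other, so net points are determined by their cells,
-- and only `3 ^ d` cells surround a point.
open Classical in
theorem card_net_near_le (m j : ℕ) :
    ((net s x m).filter fun i => Near s 1 (x j) (x i)).card ≤ 3 ^ d := by
  have hcard : (Fintype.piFinset fun _ : Fin d => Finset.Icc (-1 : ℤ) 1).card = 3 ^ d := by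
    simp [Fintype.card_piFinset]
  rw [← hcard]
  refine Finset.card_le_card_of_injOn (fun i (a : Fin d) => cell s (x i) a - cell s (x j) a) ?_ ?_
  · intro i hi
    have := (Finset.mem_filter.1 hi).2
    simp only [Finset.mem_coe, Fintype.mem_piFinset, Finset.mem_Icc]
    exact fun a => abs_le.1 (this a a.2)
  · intro i hi k hk h
    by_contra hik
    refine net_separated s x m i (Finset.mem_filter.1 hi).1 k (Finset.mem_filter.1 hk).1 hik ?_
    intro a ha
    have h1 := congrFun h ⟨a, ha⟩
    simp only at h1
    have h2 : cell s (x k) a - cell s (x i) a = 0 := by linarith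
    rw [h2]; simp

/-- The net drops a constant fraction of the points that have a close neighbour. -/
theorem card_close_le (hs : 0 < s) {m : ℕ} (hm : 2 ≤ m) {t : ℝ} (ht : t ≤ s) :
    ((Finset.range m).filter fun i => nnd x (Finset.range m) i ≤ t).card ≤
      (3 ^ d + 1) * (m - (net s x m).card) := by
  classical
  set L := (Finset.range m).filter fun i => nnd x (Finset.range m) i ≤ t
  set K := net s x m
  have hKm : (Finset.range m \ K).card = m - K.card := by
    rw [Finset.card_sdiff_of_subset (net_subset s x m), Finset.card_range]
  have h1 : (L.filter (· ∉ K)).card ≤ m - K.card := by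
    rw [← hKm]
    refine Finset.card_le_card fun i hi => ?_
    simp only [L, Finset.mem_filter] at hi
    exact Finset.mem_sdiff.2 ⟨hi.1.1, hi.2⟩
  -- The nearest neighbour of such a point lies in an adjacent cell and so was dropped from the net.
  -- Charging the point to it charges each dropped point at most `3 ^ d` times.
  have h2 : (L.filter (· ∈ K)).card ≤ 3 ^ d * (m - K.card) := by
    have : L.filter (· ∈ K) ⊆
        (Finset.range m \ K).biUnion fun j => K.filter fun i => Near s 1 (x j) (x i) := by
      intro i hi
      simp only [L, Finset.mem_filter] at hi
      obtain ⟨⟨him, hit⟩, hiK⟩ := hi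
      obtain ⟨j, hj, hji, hd⟩ := exists_eq_nnd (x := x) (S := Finset.range m) (by simpa) i
      have hn : Near s 1 (x i) (x j) := by
        simpa using near_of_dist_le (k := 1) hs (by simpa using hd ▸ hit.trans ht)
      have hjK : j ∉ K := fun hjK => net_separated s x m i hiK j hjK hji.symm hn
      exact Finset.mem_biUnion.2 ⟨j, Finset.mem_sdiff.2 ⟨hj, hjK⟩,
        Finset.mem_filter.2 ⟨hiK, hn.symm⟩⟩
    refine (Finset.card_le_card this).trans (Finset.card_biUnion_le.trans ?_)
    refine (Finset.sum_le_card_nsmul _ _ (3 ^ d) fun j _ => card_net_near_le m j).trans ?_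
    rw [hKm, smul_eq_mul, mul_comm]
  rw [← Finset.card_filter_add_card_filter_not (s := L) (· ∈ K)]
  linarith

end Grid

/-! ## Approximating a nearest neighbour distance by nets and pruning -/

section NetAndPrune

variable {d n J : ℕ} {x : ℕ → EuclideanSpace ℝ (Fin d)}

/-- The points with index in `W` approximate the points with index below `n`, where `A ⊆ W` are the
candidates: the `j` largest distances in `A` stand for the `J` largest of all. -/
structure Approx (x : ℕ → EuclideanSpace ℝ (Fin d)) (n J : ℕ) (W A : Finset ℕ) (j : ℕ) :
    Prop where
  subW : W ⊆ Finset.range n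
  subA : A ⊆ W
  two_le : 2 ≤ W.card
  pos : 1 ≤ j
  le_card : j ≤ A.card
  exists_split : ∃ H L : Finset ℕ, Finset.range n = A ∪ H ∪ L ∧ Disjoint A H ∧ H.card + j = J ∧
    (∀ h ∈ H, ∀ q ∈ A, nnd x (Finset.range n) q ≤ (1 + 8 * d) * nnd x (Finset.range n) h) ∧
    (∀ l ∈ L, ∀ q ∈ A, nnd x (Finset.range n) l ≤ (1 + 8 * d) * nnd x (Finset.range n) q)
  exists_sep : ∃ σ : ℝ, 0 ≤ σ ∧ (∀ u ∈ W, ∀ v ∈ W, u ≠ v → σ < dist (x u) (x v)) ∧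
    ∀ q ∈ A, nnd x W q ≤ nnd x (Finset.range n) q + 4 * d * σ ∧
      σ ≤ 2 * nnd x (Finset.range n) q

theorem Approx.init (hn : 2 ≤ n) (hJ : 1 ≤ J) (hJn : J ≤ n) (hx : Set.InjOn x (Finset.range n)) :
    Approx x n J (Finset.range n) (Finset.range n) J where
  subW := subset_rfl
  subA := subset_rfl
  two_le := by simpa
  pos := hJ
  le_card := by simpa
  exists_split := ⟨∅, ∅, by simp, by simp, by simp, by simp, by simp⟩
  exists_sep := by
    -- No net has been taken yet: the scale is `0`, and separation at scale `0` is distinctness.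
    refine ⟨0, le_rfl, fun u hu v hv huv => dist_pos.2 fun h => huv (hx hu hv h), fun q _ => ?_⟩
    obtain ⟨j, -, -, h⟩ := exists_eq_nnd (x := x) (S := Finset.range n) (by simpa) q
    rw [h]
    simp

/-- The additive error `4dσ` becomes a factor because the scale `σ` is at most twice the true
distance of each candidate. -/
theorem Approx.nnd_le_mul {W A : Finset ℕ} {j q : ℕ} (h : Approx x n J W A j) (hq : q ∈ A) :
    nnd x W q ≤ (1 + 8 * d) * nnd x (Finset.range n) q := by
  obtain ⟨σ, _, _, h2⟩ := h.exists_sep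
  obtain ⟨h3, h4⟩ := h2 q hq
  have : (4 * d : ℝ) * σ ≤ 4 * d * (2 * nnd x (Finset.range n) q) := by gcongr
  linarith

theorem Approx.nnd_le {W A : Finset ℕ} {j q : ℕ} (h : Approx x n J W A j) :
    nnd x (Finset.range n) q ≤ nnd x W q := nnd_mono h.subW h.two_le

/-- If `q` has its nearest neighbour `u` at distance below `ℓ`, then so has `u`; hence `u` stays and
the distance of `q` does not increase. The discarded candidates move to the high part `H`, which
accounts for the decrease of `j`. -/
theorem Approx.prune {W A : Finset ℕ} {j : ℕ} (h : Approx x n J W A j) {ℓ : ℝ}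
    (hc : (A.filter fun q => ℓ ≤ nnd x W q).card < j) :
    Approx x n J (W.filter fun q => nnd x W q < ℓ) (A.filter fun q => nnd x W q < ℓ)
      (j - (A.filter fun q => ℓ ≤ nnd x W q).card) := by
  classical
  have hcard := Finset.card_filter_add_card_filter_not (s := A) (fun q => ℓ ≤ nnd x W q)
  simp only [not_le] at hcard
  have hle := h.le_card
  have hnn : ∀ q ∈ W, nnd x W q < ℓ → ∃ u ∈ W.filter (fun q => nnd x W q < ℓ), u ≠ q ∧
      nnd x W q = dist (x q) (x u) := by
    intro q hq hlt
    obtain ⟨u, hu, huq, hd⟩ := exists_eq_nnd (x := x) h.two_le q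
    refine ⟨u, Finset.mem_filter.2 ⟨hu, ?_⟩, huq, hd⟩
    refine lt_of_le_of_lt (RealRAM.nnd_le hq huq.symm) ?_
    rwa [dist_comm, ← hd]
  have heq : ∀ q ∈ W, nnd x W q < ℓ → nnd x (W.filter fun q => nnd x W q < ℓ) q ≤ nnd x W q := by
    intro q hq hlt
    obtain ⟨u, hu, huq, hd⟩ := hnn q hq hlt
    rw [hd]; exact RealRAM.nnd_le hu huq
  have hsubA : (A.filter fun q => nnd x W q < ℓ) ⊆ A := Finset.filter_subset _ _
  refine ⟨(Finset.filter_subset _ _).trans h.subW, Finset.filter_subset_filter _ h.subA, ?_,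
    by omega, by omega, ?_, ?_⟩
  · obtain ⟨q, hq⟩ : (A.filter fun q => nnd x W q < ℓ).Nonempty := Finset.card_pos.1 (by omega)
    obtain ⟨hqA, hlt⟩ := Finset.mem_filter.1 hq
    obtain ⟨u, hu, huq, -⟩ := hnn q (h.subA hqA) hlt
    exact Finset.one_lt_card.2 ⟨u, hu, q, Finset.mem_filter.2 ⟨h.subA hqA, hlt⟩, huq⟩
  · obtain ⟨H, L, hP, hAH, hH, h1, h2⟩ := h.exists_split
    refine ⟨H ∪ A.filter (fun q => ℓ ≤ nnd x W q), L, ?_, ?_, ?_, ?_, ?_⟩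
    · rw [hP]
      ext q
      simp only [Finset.mem_union, Finset.mem_filter]
      have := lt_or_ge (nnd x W q) ℓ
      tauto
    · rw [Finset.disjoint_union_right]
      refine ⟨hAH.mono_left hsubA, ?_⟩
      rw [Finset.disjoint_filter]
      exact fun q _ hlt => not_le.2 hlt
    · rw [Finset.card_union_of_disjoint (hAH.symm.mono_right (Finset.filter_subset _ _))]
      omega
    · intro g hg q hq
      obtain ⟨hqA, hlt⟩ := Finset.mem_filter.1 hq
      rcases Finset.mem_union.1 hg with hg | hg
      · exact h1 g hg q hqA
      · obtain ⟨hgA, hge⟩ := Finset.mem_filter.1 hg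
        exact (h.nnd_le.trans (hlt.le.trans hge)).trans (h.nnd_le_mul hgA)
    · exact fun l hl q hq => h2 l hl q (hsubA hq)
  · obtain ⟨σ, h0, h1, h2⟩ := h.exists_sep
    refine ⟨σ, h0, fun u hu v hv => h1 u (Finset.mem_filter.1 hu).1 v (Finset.mem_filter.1 hv).1,
      fun q hq => ?_⟩
    obtain ⟨hqA, hlt⟩ := Finset.mem_filter.1 hq
    exact ⟨(heq q (h.subA hqA) hlt).trans (h2 q hqA).1, (h2 q hqA).2⟩

/-- Passing to a net `K` of `W`, at a scale `s` above the nearest neighbour distance `ℓ` of some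
point of `W`. -/
theorem Approx.net {W A K : Finset ℕ} {j p : ℕ} (h : Approx x n J W A j) (hd : 0 < d) (hp : p ∈ W)
    {s : ℝ} (hs : s = 8 * d * nnd x W p) (hKW : K ⊆ W)
    (hsep : ∀ u ∈ K, ∀ v ∈ K, u ≠ v → s < dist (x u) (x v))
    (hcov : ∀ y ∈ W, y ∉ K → ∃ u ∈ K, dist (x y) (x u) ≤ 2 * d * s)
    (hc : j ≤ (A.filter fun q => 2 * d * s < nnd x W q).card) :
    Approx x n J K (A.filter fun q => 2 * d * s < nnd x W q) j := by
  classical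
  have hd1 : (1 : ℝ) ≤ d := by exact_mod_cast hd
  -- A point missing from the net would have a net point within `2ds`.
  have hmem : ∀ q ∈ W, 2 * d * s < nnd x W q → q ∈ K := by
    intro q hq hlt
    by_contra hqK
    obtain ⟨u, hu, hud⟩ := hcov q hq hqK
    have := RealRAM.nnd_le (x := x) (hKW hu) (i := q) (fun h => hqK (h ▸ hu))
    linarith
  -- Any other active point has a representative in the net at the price of `2ds`, and this is not
  -- `q` itself because nothing lies that close to `q`.
  have hrep : ∀ q ∈ W, 2 * d * s < nnd x W q → ∀ u ∈ W, u ≠ q → ∃ v ∈ K, v ≠ q ∧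
      dist (x q) (x v) ≤ dist (x q) (x u) + 2 * d * s := by
    intro q hq hlt u hu huq
    have h0 : 0 ≤ s := by
      rw [hs]
      obtain ⟨v, _, _, hv⟩ := exists_eq_nnd (x := x) h.two_le p
      rw [hv]; positivity
    by_cases huK : u ∈ K
    · exact ⟨u, huK, huq, by nlinarith⟩
    · obtain ⟨v, hv, hvd⟩ := hcov u hu huK
      refine ⟨v, hv, ?_, (dist_triangle _ (x u) _).trans (by gcongr)⟩
      rintro rfl
      have := RealRAM.nnd_le (x := x) hu huq
      rw [dist_comm] at this
      linarith
  have hsubA : (A.filter fun q => 2 * d * s < nnd x W q) ⊆ A := Finset.filter_subset _ _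
  obtain ⟨q₀, hq₀⟩ : (A.filter fun q => 2 * d * s < nnd x W q).Nonempty :=
    Finset.card_pos.1 (h.pos.trans hc)
  refine ⟨hKW.trans h.subW, ?_, ?_, h.pos, hc, ?_, ?_⟩
  · intro q hq
    obtain ⟨hqA, hlt⟩ := Finset.mem_filter.1 hq
    exact hmem q (h.subA hqA) hlt
  · obtain ⟨hqA, hlt⟩ := Finset.mem_filter.1 hq₀
    obtain ⟨u, hu, huq⟩ := exists_ne_of_two_le_card h.two_le q₀
    obtain ⟨v, hv, hvq, -⟩ := hrep q₀ (h.subA hqA) hlt u hu huq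
    exact Finset.one_lt_card.2 ⟨v, hv, q₀, hmem q₀ (h.subA hqA) hlt, hvq⟩
  · obtain ⟨H, L, hP, hAH, hH, h1, h2⟩ := h.exists_split
    refine ⟨H, L ∪ A.filter (fun q => nnd x W q ≤ 2 * d * s), ?_, hAH.mono_left hsubA, hH,
      fun g hg q hq => h1 g hg q (hsubA hq), ?_⟩
    · rw [hP]
      ext q
      simp only [Finset.mem_union, Finset.mem_filter]
      have := le_or_gt (nnd x W q) (2 * d * s)
      tauto
    · intro l hl q hq
      obtain ⟨hqA, hlt⟩ := Finset.mem_filter.1 hq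
      rcases Finset.mem_union.1 hl with hl | hl
      · exact h2 l hl q hqA
      · obtain ⟨hlA, hle⟩ := Finset.mem_filter.1 hl
        exact (h.nnd_le.trans (hle.trans hlt.le)).trans (h.nnd_le_mul hqA)
  · obtain ⟨σ, h0, h1, h2⟩ := h.exists_sep
    obtain ⟨v, hv, hvp, hvd⟩ := exists_eq_nnd (x := x) h.two_le p
    -- The old set is `σ`-separated, so the pivot distance exceeds `σ`. Thus the old error `4dσ` is
    -- below `s/2`, and together with the new error `2ds` it stays below `4ds`.
    have hσ : 8 * d * σ < s := by
      rw [hs, hvd]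
      have := h1 p hp v hv hvp.symm
      gcongr
    have hds : s ≤ d * s := le_mul_of_one_le_left (by nlinarith [mul_nonneg (by positivity : (0:ℝ) ≤ 8 * d) h0]) hd1
    have h0s : 0 ≤ s := by nlinarith [mul_nonneg (by positivity : (0:ℝ) ≤ 8 * d) h0]
    refine ⟨s, h0s, hsep, fun q hq => ?_⟩
    obtain ⟨hqA, hlt⟩ := Finset.mem_filter.1 hq
    obtain ⟨h3, h4⟩ := h2 q hqA
    constructor
    · obtain ⟨u, hu, huq, hud⟩ := exists_eq_nnd (x := x) h.two_le q
      obtain ⟨v, hv, hvq, hvd⟩ := hrep q (h.subA hqA) hlt u hu huq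
      have := RealRAM.nnd_le (x := x) hv hvq
      nlinarith
    · nlinarith

/-- For the lower bound, `H` and the candidates above `ℓ` make up `J` points; the square arises
because points of `H` are compared with a candidate, whose own distance is known only up to a
factor. For the upper bound some candidate is at most `θ`, and this bounds all of `L`, so only fewer
than `J` points remain. -/
theorem Approx.bounds {W A : Finset ℕ} {j : ℕ} (h : Approx x n J W A j) {ℓ θ : ℝ} (hℓ : 0 ≤ ℓ)
    (hθ : 0 ≤ θ)
    (h1 : j ≤ (A.filter fun q => ℓ ≤ nnd x W q).card)
    (h2 : (A.filter fun q => θ < nnd x W q).card < j) :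
    J ≤ ((Finset.range n).filter fun q =>
        ℓ / (1 + 8 * d) ^ 2 ≤ nnd x (Finset.range n) q).card ∧
      ((Finset.range n).filter fun q => (1 + 8 * d) * θ < nnd x (Finset.range n) q).card < J := by
  classical
  obtain ⟨H, L, hP, hAH, hH, hHA, hLA⟩ := h.exists_split
  have hK : (1 : ℝ) ≤ 1 + 8 * d := by linarith [Nat.cast_nonneg (α := ℝ) d]
  constructor
  · obtain ⟨q₀, hq₀⟩ : (A.filter fun q => ℓ ≤ nnd x W q).Nonempty :=
      Finset.card_pos.1 (h.pos.trans h1)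
    obtain ⟨hqA, hlt⟩ := Finset.mem_filter.1 hq₀
    have key : ∀ q ∈ A, ℓ ≤ nnd x W q → ℓ / (1 + 8 * d) ≤ nnd x (Finset.range n) q :=
      fun q hq hl => by
        rw [div_le_iff₀' (by linarith)]; exact hl.trans (h.nnd_le_mul hq)
    have hsub : H ∪ (A.filter fun q => ℓ ≤ nnd x W q) ⊆ (Finset.range n).filter fun q =>
        ℓ / (1 + 8 * d) ^ 2 ≤ nnd x (Finset.range n) q := by
      intro q hq
      rcases Finset.mem_union.1 hq with hq | hq
      · refine Finset.mem_filter.2 ⟨by rw [hP]; simp [hq], ?_⟩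
        rw [sq, ← div_div, div_le_iff₀' (by linarith)]
        exact (key q₀ hqA hlt).trans (hHA q hq q₀ hqA)
      · obtain ⟨hq, hl⟩ := Finset.mem_filter.1 hq
        refine Finset.mem_filter.2 ⟨by rw [hP]; simp [hq], le_trans ?_ (key q hq hl)⟩
        rw [sq, ← div_div]
        exact div_le_self (by positivity) hK
    have := Finset.card_le_card hsub
    rw [Finset.card_union_of_disjoint (hAH.symm.mono_right (Finset.filter_subset _ _))] at this
    omega
  · obtain ⟨q₀, hq₀⟩ : (A.filter fun q => ¬ θ < nnd x W q).Nonempty := by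
      rw [← Finset.card_pos]
      have := Finset.card_filter_add_card_filter_not (s := A) (fun q => θ < nnd x W q)
      have := h.le_card
      omega
    obtain ⟨hqA, hle⟩ := Finset.mem_filter.1 hq₀
    have hsub : ((Finset.range n).filter fun q =>
        (1 + 8 * d) * θ < nnd x (Finset.range n) q) ⊆ H ∪ (A.filter fun q => θ < nnd x W q) := by
      intro q hq
      obtain ⟨hq, hlt⟩ := Finset.mem_filter.1 hq
      rw [hP, Finset.mem_union, Finset.mem_union] at hq
      rcases hq with (hq | hq) | hq
      · refine Finset.mem_union_right _ (Finset.mem_filter.2 ⟨hq, ?_⟩)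
        have := h.nnd_le (q := q)
        nlinarith
      · exact Finset.mem_union_left _ hq
      · exfalso
        have h3 := hLA q hq q₀ hqA
        have h4 : (1 + 8 * d) * nnd x (Finset.range n) q₀ ≤ (1 + 8 * d) * θ := by
          gcongr
          exact h.nnd_le.trans (not_lt.1 hle)
        linarith
    have := Finset.card_le_card hsub
    have := Finset.card_union_le H (A.filter fun q => θ < nnd x W q)
    omega

end NetAndPrune

/-! ## Order statistics -/

/-- `v` is the `J`-th largest of the values `D i`, `i ∈ S`. -/
def IsLargest (S : Finset ℕ) (D : ℕ → ℝ) (J : ℕ) (v : ℝ) : Prop :=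
  (S.filter fun i => v < D i).card < J ∧ J ≤ (S.filter fun i => v ≤ D i).card

theorem IsLargest.unique {S : Finset ℕ} {D : ℕ → ℝ} {J : ℕ} {v w : ℝ} (hv : IsLargest S D J v)
    (hw : IsLargest S D J w) : v = w := by
  have key : ∀ {v w : ℝ}, IsLargest S D J v → IsLargest S D J w → ¬ v < w := by
    intro v w hv hw h
    have : (S.filter fun i => w ≤ D i) ⊆ S.filter fun i => v < D i :=
      Finset.monotone_filter_right _ fun i _ hi => h.trans_le hi
    have := Finset.card_le_card this
    have := hv.1
    have := hw.2
    omega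
  exact le_antisymm (not_lt.1 (key hw hv)) (not_lt.1 (key hv hw))

theorem countP_sort_getD (l : List ℝ) (hl : l.Pairwise (· ≤ ·)) {k : ℕ} (hk : 1 ≤ k)
    (hkn : k ≤ l.length) :
    l.countP (fun a => decide (l.getD (k - 1) 0 < a)) < l.length - k + 1 ∧
      l.length - k + 1 ≤ l.countP (fun a => decide (l.getD (k - 1) 0 ≤ a)) := by
  have hk' : k - 1 < l.length := by omega
  have hget : l.getD (k - 1) 0 = l[k - 1] := by
    rw [List.getD_eq_getElem?_getD, List.getElem?_eq_getElem hk']; rfl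
  rw [hget]
  rw [List.pairwise_iff_getElem] at hl
  have hmono : ∀ i j (hi : i < l.length) (hj : j < l.length), i ≤ j → l[i] ≤ l[j] := by
    intro i j hi hj hij
    rcases hij.lt_or_eq with h | rfl
    · exact hl i j hi hj h
    · exact le_rfl
  constructor
  · have h0 : (l.take k).countP (fun a => decide (l[k - 1] < a)) = 0 := by
      rw [List.countP_eq_zero]
      intro a ha
      obtain ⟨i, hi, rfl⟩ := List.mem_iff_getElem.1 ha
      rw [List.length_take] at hi
      simp only [List.getElem_take, decide_eq_true_eq, not_lt]
      exact hmono _ _ _ _ (by omega)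
    have h1 := List.countP_append (p := fun a => decide (l[k - 1] < a)) (l₁ := l.take k)
      (l₂ := l.drop k)
    rw [List.take_append_drop, h0, zero_add] at h1
    rw [h1]
    have := List.countP_le_length (p := fun a => decide (l[k - 1] < a)) (l := l.drop k)
    rw [List.length_drop] at this
    omega
  · have h0 : (l.drop (k - 1)).countP (fun a => decide (l[k - 1] ≤ a)) =
        (l.drop (k - 1)).length := by
      rw [List.countP_eq_length]
      intro a ha
      obtain ⟨i, hi, rfl⟩ := List.mem_iff_getElem.1 ha
      simp only [List.getElem_drop, decide_eq_true_eq]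
      exact hmono _ _ _ _ (by omega)
    have h1 := List.countP_append (p := fun a => decide (l[k - 1] ≤ a)) (l₁ := l.take (k - 1))
      (l₂ := l.drop (k - 1))
    rw [List.take_append_drop, h0, List.length_drop] at h1
    omega

/-- Counting from above is the convenient form: `IsLargest` mentions only how many values exceed a
threshold, which is what the program can test. -/
theorem isLargest_kthSmallest {S : Finset ℕ} {D : ℕ → ℝ} {k : ℕ} (hk : 1 ≤ k) (hkn : k ≤ S.card) :
    IsLargest S D (S.card - k + 1) (kthSmallest (S.val.map D) k) := by
  have h := countP_sort_getD ((S.val.map D).sort (· ≤ ·)) (Multiset.pairwise_sort _ _) hk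
    (by simpa using hkn)
  simp only [Multiset.length_sort, Multiset.card_map, Finset.card_val] at h
  have hc : ∀ p : ℝ → Prop, ∀ _ : DecidablePred p,
      ((S.val.map D).sort (· ≤ ·)).countP (fun a => decide (p a)) =
        (S.filter fun i => p (D i)).card := by
    intro p _
    rw [← Multiset.coe_countP, Multiset.sort_eq, Multiset.countP_map]
    rfl
  unfold IsLargest kthSmallest
  rw [← hc (fun a => _ < a) (fun _ => inferInstance), ← hc (fun a => _ ≤ a) (fun _ => inferInstance)]
  exact h

/-! ## Memory -/

@[simp] theorem setReg_reg (s : State) (x y : ℕ) (v : ℝ) :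
    (s.setReg x v).reg y = if y = x then v else s.reg y := by
  simp [State.setReg, Function.update_apply]

@[simp] theorem setReg_arr (s : State) (x : ℕ) (v : ℝ) : (s.setReg x v).arr = s.arr := rfl

@[simp] theorem setArr_reg (s : State) (a : ℕ) (l : List ℝ) : (s.setArr a l).reg = s.reg := rfl

@[simp] theorem setArr_arr (s : State) (a b : ℕ) (l : List ℝ) :
    (s.setArr a l).arr b = if b = a then l else s.arr b := by
  simp [State.setArr, Function.update_apply]

/-- The list `f 0, …, f (L - 1)`. -/
def tab (L : ℕ) (f : ℕ → ℝ) : List ℝ := (List.range L).map f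

theorem tab_getD {L i : ℕ} (f : ℕ → ℝ) (h : i < L) : (tab L f).getD i 0 = f i := by
  simp [tab, List.getD_eq_getElem?_getD, h]

theorem tab_set (L i : ℕ) (f : ℕ → ℝ) (v : ℝ) :
    (tab L f).set i v = tab L (Function.update f i v) := by
  apply List.ext_getElem
  · simp [tab]
  · intro j h1 h2
    simp only [tab, List.getElem_set, List.getElem_map, List.getElem_range,
      Function.update_apply, eq_comm]

theorem tab_congr {L : ℕ} {f g : ℕ → ℝ} (h : ∀ i < L, f i = g i) : tab L f = tab L g :=
  List.map_congr_left fun i hi => h i (List.mem_range.1 hi)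

theorem replicate_eq_tab (L : ℕ) : List.replicate L (0 : ℝ) = tab L fun _ => 0 := by
  simp [tab, List.map_const']

/-- The `a`-th coordinate. -/
noncomputable def coord {d : ℕ} (y : EuclideanSpace ℝ (Fin d)) (a : ℕ) : ℝ :=
  if h : a < d then y ⟨a, h⟩ else 0

theorem cell_eq {d : ℕ} (S : ℝ) (y : EuclideanSpace ℝ (Fin d)) (a : ℕ) :
    cell S y a = ⌊coord y a / S⌋ := by
  unfold cell coord; split_ifs <;> simp

theorem dist_eq_sqrt_coord {d : ℕ} (y z : EuclideanSpace ℝ (Fin d)) :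
    dist y z = Real.sqrt (∑ a ∈ Finset.range d, (coord y a - coord z a) * (coord y a - coord z a)) := by
  rw [EuclideanSpace.dist_eq, ← Fin.sum_univ_eq_sum_range]
  congr 1
  refine Finset.sum_congr rfl fun a _ => ?_
  simp [coord, Real.dist_eq, sq]

/-- The coordinates of `x 0, …, x (n - 1)` are stored in the arrays below `d`. -/
def HasInput {d : ℕ} (x : ℕ → EuclideanSpace ℝ (Fin d)) (n : ℕ) (s : State) : Prop :=
  ∀ a < d, s.arr a = tab n fun i => coord (x i) a

/-! ## Names -/

/-! Registers: number of active points, rank, control flag, pivot, distance, grid side, position,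
counter, distance, base, modulus, multiplier, query, lookup result, flag. -/

notation "rM" => (2 : ℕ)
notation "rJ" => (3 : ℕ)
notation "rGo" => (4 : ℕ)
notation "rP" => (5 : ℕ)
notation "rL" => (6 : ℕ)
notation "rS" => (7 : ℕ)
notation "rI" => (8 : ℕ)
notation "rC" => (9 : ℕ)
notation "rD" => (10 : ℕ)
notation "rB" => (11 : ℕ)
notation "rN" => (12 : ℕ)
notation "rR" => (13 : ℕ)
notation "rQ" => (14 : ℕ)
notation "rX" => (15 : ℕ)
notation "rF" => (16 : ℕ)

/-! ## Expressions -/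

/-- Coordinate `a` of the active point at position `i`. -/
def coordE (d a : ℕ) (i : Expr) : Expr := .get a (.get d i)

def cellE (d a : ℕ) : Expr := .floor (.div (coordE d a (.var rI)) (.var rS))

def keyE (d : ℕ) : ℕ → Expr
  | 0 => .const 0
  | k + 1 => .add (.mul (keyE d k) (.var rB)) (cellE d k)

def offE (δ : ℕ → ℤ) : ℕ → Expr
  | 0 => .const 0
  | k + 1 => .add (.mul (offE δ k) (.var rB)) (.const (δ k))

/-- A sum of squares of integers dominates each of their absolute values; it serves to find a base
for the keys without computing maxima. -/
def cellSqE (d : ℕ) : ℕ → Expr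
  | 0 => .const 0
  | k + 1 => .add (cellSqE d k) (.mul (cellE d k) (cellE d k))

def powE : ℕ → Expr
  | 0 => .const 1
  | k + 1 => .mul (powE k) (.var rB)

def distSqE (d : ℕ) (i j : Expr) : ℕ → Expr
  | 0 => .const 0
  | k + 1 => .add (distSqE d i j k) (.mul (.sub (coordE d k i) (coordE d k j))
      (.sub (coordE d k i) (coordE d k j)))

/-- Distance of the active points at positions `i` and `j`. -/
def distE (d : ℕ) (i j : Expr) : Expr := .sqrt (distSqE d i j d)

/-- Slot of the integer `q`. -/
def slotE (q : Expr) : Expr :=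
  .mul (.var rM) (.sub (.div (.mul (.var rR) q) (.var rN))
    (.floor (.div (.mul (.var rR) q) (.var rN))))

/-- The active points: `w 0, …, w (m - 1)`, listed in array `d`. -/
structure Active {d : ℕ} (x : ℕ → EuclideanSpace ℝ (Fin d)) (n m : ℕ) (w : ℕ → ℕ) (s : State) :
    Prop where
  input : HasInput x n s
  arr : s.arr d = tab n fun i => (w i : ℝ)
  le : m ≤ n
  lt : ∀ i < m, w i < n

theorem Active.congr {d n m : ℕ} {x : ℕ → EuclideanSpace ℝ (Fin d)} {w : ℕ → ℕ} {s s' : State}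
    (h : Active x n m w s) (ha : ∀ a ≤ d, s'.arr a = s.arr a) : Active x n m w s' where
  input := fun a had => (ha a had.le).trans (h.input a had)
  arr := (ha d le_rfl).trans h.arr
  le := h.le
  lt := h.lt

section Eval

variable {d n m : ℕ} {x : ℕ → EuclideanSpace ℝ (Fin d)} {w : ℕ → ℕ} {s : State}

theorem eval_coordE (h : Active x n m w s) {a i : ℕ} (ha : a < d) (hi : i < m) {e : Expr}
    (he : ⌊e.eval s⌋₊ = i) : (coordE d a e).eval s = coord (x (w i)) a := by
  have hin : i < n := hi.trans_le h.le
  simp only [coordE, Expr.eval, he, h.arr, tab_getD _ hin, Nat.floor_natCast, h.input a ha,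
    tab_getD _ (h.lt i hi)]

theorem eval_cellE (h : Active x n m w s) {a i : ℕ} (ha : a < d) (hi : i < m)
    (he : s.reg rI = i) : (cellE d a).eval s = (cell (s.reg rS) (x (w i)) a : ℝ) := by
  have := eval_coordE h ha hi (e := .var rI) (by simp [Expr.eval, he])
  simp only [cellE, Expr.eval, this, cell_eq]

theorem eval_keyE (h : Active x n m w s) {i : ℕ} (hi : i < m) (he : s.reg rI = i) {B : ℤ}
    (hB : s.reg rB = B) {k : ℕ} (hk : k ≤ d) :
    (keyE d k).eval s = (horner B (cell (s.reg rS) (x (w i))) k : ℝ) := by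
  induction k with
  | zero => simp [keyE, horner, Expr.eval]
  | succ k ih =>
    simp only [keyE, Expr.eval, ih (by omega), eval_cellE h (by omega : k < d) hi he, hB, horner]
    push_cast; ring

theorem eval_offE {B : ℤ} (hB : s.reg rB = B) (δ : ℕ → ℤ) (k : ℕ) :
    (offE δ k).eval s = (horner B δ k : ℝ) := by
  induction k with
  | zero => simp [offE, horner, Expr.eval]
  | succ k ih => simp only [offE, Expr.eval, ih, hB, horner]; push_cast; ring

theorem eval_cellSqE (h : Active x n m w s) {i : ℕ} (hi : i < m) (he : s.reg rI = i)
    {k : ℕ} (hk : k ≤ d) : (cellSqE d k).eval s =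
      (∑ a ∈ Finset.range k, cell (s.reg rS) (x (w i)) a * cell (s.reg rS) (x (w i)) a : ℤ) := by
  induction k with
  | zero => simp [cellSqE, Expr.eval]
  | succ k ih =>
    simp only [cellSqE, Expr.eval, ih (by omega), eval_cellE h (by omega : k < d) hi he,
      Finset.sum_range_succ]
    push_cast; ring

theorem eval_powE (k : ℕ) : (powE k).eval s = s.reg rB ^ k := by
  induction k with
  | zero => simp [powE, Expr.eval]
  | succ k ih => simp only [powE, Expr.eval, ih, pow_succ]

theorem eval_distE (h : Active x n m w s) {i j : ℕ} (hi : i < m) (hj : j < m) {e f : Expr}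
    (he : ⌊e.eval s⌋₊ = i) (hf : ⌊f.eval s⌋₊ = j) :
    (distE d e f).eval s = dist (x (w i)) (x (w j)) := by
  have : ∀ k ≤ d, (distSqE d e f k).eval s = ∑ a ∈ Finset.range k,
      (coord (x (w i)) a - coord (x (w j)) a) * (coord (x (w i)) a - coord (x (w j)) a) := by
    intro k
    induction k with
    | zero => simp [distSqE, Expr.eval]
    | succ k ih =>
      intro hk
      simp only [distSqE, Expr.eval, ih (by omega), eval_coordE h (by omega : k < d) hi he,
        eval_coordE h (by omega : k < d) hj hf, Finset.sum_range_succ]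
  rw [distE, Expr.eval, this d le_rfl, dist_eq_sqrt_coord]

theorem floor_eval_slotE {N r : ℕ} (hm : s.reg rM = m) (hN : s.reg rN = N) (hr : s.reg rR = r)
    {q : ℤ} {e : Expr} (he : e.eval s = q) : ⌊(slotE e).eval s⌋₊ = slot m N r q := by
  simp only [slotE, Expr.eval, hm, hN, hr, he, slot, Int.fract]

end Eval

/-! ## Repeating a block of code over a list of parameters -/

def forEach {α : Type*} (Δ : List α) (body : α → Cmd) : Cmd :=
  Δ.foldr (fun δ c => .seq (body δ) c) .skip

theorem forEach_writesReg {α : Type*} (Δ : List α) (body : α → Cmd) (y : ℕ) :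
    (forEach Δ body).writesReg y ↔ ∃ δ ∈ Δ, (body δ).writesReg y := by
  induction Δ with
  | nil => simp [forEach, Cmd.writesReg]
  | cons δ Δ ih => simp only [forEach, List.foldr_cons, Cmd.writesReg] at ih ⊢; simp [ih]

theorem forEach_writesArr {α : Type*} (Δ : List α) (body : α → Cmd) (y : ℕ) :
    (forEach Δ body).writesArr y ↔ ∃ δ ∈ Δ, (body δ).writesArr y := by
  induction Δ with
  | nil => simp [forEach, Cmd.writesArr]
  | cons δ Δ ih => simp only [forEach, List.foldr_cons, Cmd.writesArr] at ih ⊢; simp [ih]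

theorem Run.forEach {α : Type*} (Δ : List α) (body : α → Cmd) (Inv : List α → State → Prop)
    (t : α → ℕ) (s : State) (h0 : Inv [] s)
    (hb : ∀ pre, ∀ δ ∈ Δ, ∀ s', Agree (forEach Δ body) s s' → Inv pre s' →
      Run (body δ) s' (t δ) (Inv (pre ++ [δ]))) :
    Run (forEach Δ body) s ((Δ.map fun δ => t δ + 1).sum + 1) (Inv Δ) := by
  have key : ∀ suf : List α, suf ⊆ Δ → ∀ pre s', Agree (RealRAM.forEach Δ body) s s' → Inv pre s' →
      Run (RealRAM.forEach suf body) s' ((suf.map fun δ => t δ + 1).sum + 1) (Inv (pre ++ suf)) := by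
    intro suf
    induction suf with
    | nil =>
      intro _ pre s' _ hI
      simpa [RealRAM.forEach] using Run.skip hI
    | cons δ suf ih =>
      intro hsub pre s' hA hI
      have hδ : δ ∈ Δ := hsub (by simp)
      have h1 := (hb pre δ hδ s' hA hI).frame
      refine (Run.seq h1 (T₂ := (suf.map fun δ => t δ + 1).sum + 1) fun s'' hs'' => ?_).mono ?_
        (fun _ => id)
      · have := ih (fun a ha => hsub (by simp [ha])) (pre ++ [δ]) s''
          (hA.trans (hs''.2.mono (fun y hy => (forEach_writesReg _ _ _).2 ⟨δ, hδ, hy⟩)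
            (fun y hy => (forEach_writesArr _ _ _).2 ⟨δ, hδ, hy⟩))) hs''.1
        simpa [RealRAM.forEach] using this
      · simp; omega
  simpa using key Δ (fun _ => id) [] s (Agree.refl _ _) h0

/-- A counting loop; the memory agrees with the initial one outside what the body writes. -/
theorem Run.for_loop_agree {x y : ℕ} {c : Cmd} (m : ℕ) (Inv : ℕ → State → Prop) (t : ℕ → ℕ)
    {s : State} (hx : ∀ i s, Inv i s → s.reg x = i) (hy : s.reg y = m) (hyc : ¬ c.writesReg y)
    (hc : ∀ i < m, ∀ s', Agree c s s' → Inv i s' → Run c s' (t i) (Inv (i + 1)))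
    (h0 : Inv 0 s) :
    Run (.loop (.lt (.var x) (.var y)) c) s (∑ i ∈ Finset.range m, (t i + 4) + 4) (Inv m) := by
  refine (Run.for_loop m (fun i s' => Inv i s' ∧ Agree c s s') t (fun i s' h => hx i s' h.1)
    (fun i s' h => (h.2.1 y hyc).trans hy) ?_ ⟨h0, Agree.refl _ _⟩).mono le_rfl (fun _ h => h.1)
  intro i hi s' hs'
  exact (hc i hi s' hs'.2 hs'.1).frame.mono le_rfl fun s'' h => ⟨h.1, hs'.2.trans h.2⟩

/-! ## The hash table -/

/-- `Chain nx y l`: following the pointers `nx` from `y` visits the positions `l`. A pointer to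
position `u` is stored as `u + 1`, and `0` ends the chain. -/
def Chain (nx : ℕ → ℝ) : ℝ → List ℕ → Prop
  | y, [] => y = 0
  | y, u :: l => y = u + 1 ∧ Chain nx (nx u) l

theorem Chain.update {nx : ℕ → ℝ} {l : List ℕ} {i : ℕ} (v : ℝ) (hi : i ∉ l) : ∀ {y : ℝ},
    Chain nx y l → Chain (Function.update nx i v) y l := by
  induction l with
  | nil => exact fun h => h
  | cons u l ih =>
    intro y h
    simp only [List.mem_cons, not_or] at hi
    refine ⟨h.1, ?_⟩
    rw [Function.update_of_ne (Ne.symm hi.1)]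
    exact ih hi.2 h.2

/-- Slot `h` of the table leads to the positions in `K` that hash to `h`. -/
def Table (m : ℕ) (hash : ℕ → ℕ) (T nx : ℕ → ℝ) (K : Finset ℕ) : Prop :=
  ∀ h < m, ∃ l : List ℕ, l.Nodup ∧ Chain nx (T h) l ∧ ∀ u, u ∈ l ↔ u ∈ K ∧ hash u = h

theorem Table.empty (m : ℕ) (hash : ℕ → ℕ) : Table m hash (fun _ => 0) (fun _ => 0) ∅ :=
  fun _ _ => ⟨[], by simp, rfl, by simp⟩

/-- The new position goes to the front of its chain. Only its own link is overwritten, and no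
existing chain passes through it. -/
theorem Table.insert {m : ℕ} {hash : ℕ → ℕ} {T nx : ℕ → ℝ} {K : Finset ℕ} (h : Table m hash T nx K)
    {i : ℕ} (hi : i ∉ K) :
    Table m hash (Function.update T (hash i) (i + 1)) (Function.update nx i (T (hash i)))
      (insert i K) := by
  intro k hk
  obtain ⟨l, hl, hc, hm⟩ := h k hk
  have hil : i ∉ l := fun hil => hi ((hm i).1 hil).1
  by_cases hki : k = hash i
  · subst hki
    refine ⟨i :: l, List.nodup_cons.2 ⟨hil, hl⟩, ?_, ?_⟩
    · rw [Function.update_self]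
      refine ⟨rfl, ?_⟩
      rw [Function.update_self]
      exact hc.update _ hil
    · intro u
      simp only [List.mem_cons, Finset.mem_insert, hm]
      constructor
      · rintro (rfl | h)
        · exact ⟨Or.inl rfl, rfl⟩
        · exact ⟨Or.inr h.1, h.2⟩
      · rintro ⟨rfl | h, h'⟩
        · exact Or.inl rfl
        · exact Or.inr ⟨h, h'⟩
  · refine ⟨l, hl, ?_, ?_⟩
    · rw [Function.update_of_ne hki]
      exact hc.update _ hil
    · intro u
      rw [hm, Finset.mem_insert]
      constructor
      · exact fun h => ⟨Or.inr h.1, h.2⟩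
      · rintro ⟨rfl | h, h'⟩
        · exact absurd h'.symm hki
        · exact ⟨h, h'⟩

/-- Register `rX` := a pointer to the stored position with key `rQ`, or `0`. -/
def follow (d : ℕ) : Cmd :=
  .loop (.lt (.const 0) (.mul (.var rX) (.mul
      (.sub (.get (d + 5) (.sub (.var rX) (.const 1))) (.var rQ))
      (.sub (.get (d + 5) (.sub (.var rX) (.const 1))) (.var rQ)))))
    (.assign rX (.get (d + 4) (.sub (.var rX) (.const 1))))

def lookup (d : ℕ) : Cmd := .seq (.assign rX (.get (d + 3) (slotE (.var rQ)))) (follow d)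

theorem run_follow {d m : ℕ} {nx kf : ℕ → ℝ} {q : ℝ} (l : List ℕ) : ∀ {s : State},
    Chain nx (s.reg rX) l → (∀ u ∈ l, u < m) → s.arr (d + 4) = tab m nx →
    s.arr (d + 5) = tab m kf → s.reg rQ = q →
    Run (follow d) s (25 * (l.length + 1)) fun s' =>
      (s'.reg rX = 0 ∧ ∀ u ∈ l, kf u ≠ q) ∨ ∃ u ∈ l, s'.reg rX = u + 1 ∧ kf u = q := by
  induction l with
  | nil =>
    intro s hc _ _ _ _
    refine (Run.loop_false ?_ ?_).mono (by simp [Test.ops, Expr.ops]) (fun _ => id)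
    · simp only [Chain] at hc
      simp [Test.holds, Expr.eval, hc]
    · exact Or.inl ⟨hc, by simp⟩
  | cons u l ih =>
    intro s hc hl hnx hk hq
    have hu : u < m := hl u (by simp)
    have hX : s.reg rX = u + 1 := hc.1
    -- One comparison encodes two conditions: pointer times squared key difference is positive
    -- exactly when the pointer is nonzero and the key is wrong.
    have hb : (Test.lt (.const 0) (.mul (.var rX) (.mul
      (.sub (.get (d + 5) (.sub (.var rX) (.const 1))) (.var rQ))
      (.sub (.get (d + 5) (.sub (.var rX) (.const 1))) (.var rQ))))).holds s ↔ kf u ≠ q := by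
      simp only [Test.holds, Expr.eval, hX, Int.cast_one, add_sub_cancel_right, Nat.floor_natCast,
        hk, tab_getD _ hu, hq, Int.cast_zero]
      rw [← sub_ne_zero]
      have h1 : (0 : ℝ) < u + 1 := by positivity
      rw [mul_pos_iff_of_pos_left h1]
      exact mul_self_pos
    by_cases hkq : kf u = q
    · refine (Run.loop_false (fun h => hb.1 h hkq) ?_).mono (by simp [Test.ops, Expr.ops]; omega)
        (fun _ => id)
      exact Or.inr ⟨u, by simp, hX, hkq⟩
    · refine (Run.loop_true (hb.2 hkq) (Run.assign (Q := fun s' => s' = s.setReg rX (nx u)) ?_)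
        (T₂ := 25 * (l.length + 1)) (Q := fun s' =>
      (s'.reg rX = 0 ∧ ∀ u ∈ l, kf u ≠ q) ∨ ∃ u ∈ l, s'.reg rX = u + 1 ∧ kf u = q) ?_).mono ?_ ?_
      · simp only [Expr.eval, hX, Int.cast_one, add_sub_cancel_right, Nat.floor_natCast, hnx,
          tab_getD _ hu]
      · rintro s' rfl
        exact ih (by simpa using hc.2) (fun v hv => hl v (by simp [hv])) (by simpa) (by simpa)
          (by simpa)
      · simp [Test.ops, Expr.ops]; omega
      · rintro s' (⟨h1, h2⟩ | ⟨v, hv, h⟩)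
        · exact Or.inl ⟨h1, by simpa [hkq] using h2⟩
        · exact Or.inr ⟨v, by simp [hv], h⟩

/-- The time is governed by the length of the chain in the slot of `q`, that is, by the number of
keys coinciding with `q`; this is the quantity averaged over the multiplier later. -/
theorem run_lookup {d m N r : ℕ} (hm0 : 0 < m) {T nx kf : ℕ → ℝ} {key : ℕ → ℤ} {K : Finset ℕ} {q : ℤ}
    {s : State} (hT : s.arr (d + 3) = tab m T) (hnx : s.arr (d + 4) = tab m nx)
    (hk : s.arr (d + 5) = tab m kf) (hkey : ∀ u ∈ K, kf u = key u) (hK : K ⊆ Finset.range m)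
    (htab : Table m (fun u => slot m N r (key u)) T nx K)
    (hm : s.reg rM = m) (hN : s.reg rN = N) (hr : s.reg rR = r) (hq : s.reg rQ = q) :
    Run (lookup d) s
      (50 + 25 * (K.filter fun u => slot m N r (key u) = slot m N r q).card) fun s' =>
      (s'.reg rX = 0 ∧ ∀ u ∈ K, key u ≠ q) ∨ ∃ u ∈ K, s'.reg rX = u + 1 ∧ key u = q := by
  obtain ⟨l, hl, hc, hmem⟩ := htab (slot m N r q) (slot_lt hm0 _ _ _)
  have hlen : l.length = (K.filter fun u => slot m N r (key u) = slot m N r q).card := by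
    rw [← List.toFinset_card_of_nodup hl]
    congr 1
    ext u
    simp [hmem]
  have hslot := floor_eval_slotE hm hN hr (e := .var rQ) (q := q) (by simpa [Expr.eval] using hq)
  refine (Run.seq (Run.assign (Q := fun s' => s' = s.setReg rX (T (slot m N r q))) ?_)
    (T₂ := 25 * (l.length + 1)) (Q := fun s' => (s'.reg rX = 0 ∧ ∀ u ∈ l, kf u ≠ q) ∨
      ∃ u ∈ l, s'.reg rX = u + 1 ∧ kf u = q) ?_).mono ?_ ?_
  · simp only [Expr.eval, hslot, hT, tab_getD _ (slot_lt hm0 N r q)]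
  · rintro s' rfl
    exact run_follow l (by simpa using hc) (fun u hu => Finset.mem_range.1 (hK ((hmem u).1 hu).1))
      (by simpa) (by simpa) (by simpa)
  · rw [hlen]; simp [slotE, Expr.ops]; omega
  · rintro s' (⟨h1, h2⟩ | ⟨u, hu, h1, h2⟩)
    · refine Or.inl ⟨h1, fun u hu huq => h2 u ((hmem u).2 ⟨hu, by simp [huq]⟩) ?_⟩
      rw [hkey u hu, huq]
    · refine Or.inr ⟨u, ((hmem u).1 hu).1, h1, ?_⟩
      rw [hkey u ((hmem u).1 hu).1] at h2
      exact_mod_cast h2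

/-! ## Neighbouring cells -/

/-- All vectors with entries in `{-R, …, R}`. -/
noncomputable def offsets (d R : ℕ) : List (ℕ → ℤ) :=
  (Fintype.piFinset fun _ : Fin d => Finset.Icc (-(R : ℤ)) R).toList.map
    fun δ a => if h : a < d then δ ⟨a, h⟩ else 0

theorem abs_le_of_mem_offsets {d R : ℕ} {δ : ℕ → ℤ} (h : δ ∈ offsets d R) {a : ℕ} (ha : a < d) :
    |δ a| ≤ R := by
  obtain ⟨f, hf, rfl⟩ := List.mem_map.1 h
  simp only [Finset.mem_toList, Fintype.mem_piFinset, Finset.mem_Icc] at hf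
  simp only [ha, dif_pos]
  exact abs_le.2 (hf _)

theorem exists_mem_offsets {d R : ℕ} {v : ℕ → ℤ} (hv : ∀ a < d, |v a| ≤ R) :
    ∃ δ ∈ offsets d R, ∀ a < d, δ a = v a := by
  refine ⟨_, List.mem_map.2 ⟨fun a => v a, ?_, rfl⟩, fun a ha => by simp [ha]⟩
  simp only [Finset.mem_toList, Fintype.mem_piFinset, Finset.mem_Icc]
  exact fun a => abs_le.1 (hv a a.2)

section Key

variable {d : ℕ} {S : ℝ} {y z : EuclideanSpace ℝ (Fin d)} {b B : ℤ}

/-- The key of the cell of a point. -/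
noncomputable def pointKey (S : ℝ) (B : ℤ) (y : EuclideanSpace ℝ (Fin d)) : ℤ :=
  horner B (cell S y) d

/-- The difference of the two keys has digits of size at most `2b + R`. As the base is larger, all
of them vanish, so the shifted cell is found exactly and not just up to carries. -/
theorem near_of_pointKey_eq {k R : ℕ} {δ : ℕ → ℤ} (hy : ∀ a < d, |cell S y a| ≤ b)
    (hz : ∀ a < d, |cell S z a| ≤ b) (hB : 2 * b + R < B) (hk : k ≤ R) (hδ : δ ∈ offsets d k)
    (h : pointKey S B z = pointKey S B y + horner B δ d) : Near S k y z := by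
  have h0 : horner B (fun a => cell S z a - (cell S y a + δ a)) d = 0 := by
    rw [← horner_sub, ← horner_add]
    unfold pointKey at h
    linarith
  intro a ha
  have h1 := eq_zero_of_horner_eq_zero ?_ h0 a ha
  · have : cell S z a - cell S y a = δ a := by linarith
    rw [this]
    exact abs_le_of_mem_offsets hδ ha
  · intro a ha
    have h1 := abs_le.1 (hy a ha)
    have h2 := abs_le.1 (hz a ha)
    have h3 := abs_le.1 (abs_le_of_mem_offsets hδ ha)
    have h4 : (k : ℤ) ≤ R := by exact_mod_cast hk
    rw [abs_lt]
    constructor <;> linarith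

theorem exists_pointKey_eq {k : ℕ} (h : Near S k y z) :
    ∃ δ ∈ offsets d k, pointKey S B z = pointKey S B y + horner B δ d := by
  obtain ⟨δ, hδ, hδ'⟩ := exists_mem_offsets h
  refine ⟨δ, hδ, ?_⟩
  unfold pointKey
  rw [horner_add]
  exact horner_congr fun a ha => by rw [hδ' a ha]; ring

theorem near_of_pointKey_eq' {R : ℕ} (hy : ∀ a < d, |cell S y a| ≤ b)
    (hz : ∀ a < d, |cell S z a| ≤ b) (hB : 2 * b + R < B) (h : pointKey S B z = pointKey S B y) :
    Near S 0 y z := by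
  obtain ⟨δ, hδ, h'⟩ := exists_pointKey_eq (B := B) (Near.refl S le_rfl y : Near S (0 : ℕ) y y)
  exact near_of_pointKey_eq hy hz hB (Nat.zero_le R) hδ (h.trans h')

end Key

/-! ## Building the net -/

/-- Look up the cell of the current point, shifted by `δ`. -/
def probe (d : ℕ) (δ : ℕ → ℤ) : Cmd :=
  .seq (.assign rQ (.add (.get (d + 5) (.var rI)) (offE δ d))) (lookup d)

/-- Insert the current point into the table. -/
def insertCmd (d R : ℕ) : Cmd :=
  .seq (.store (d + 4) (.var rI) (.get (d + 3) (slotE (.get (d + 5) (.var rI)))))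
    (.seq (.store (d + 3) (slotE (.get (d + 5) (.var rI))) (.add (.var rI) (.const 1)))
      (.store (d + 2) (.var rI) (.mul (.const R) (.var rS))))

def markCmd (d : ℕ) (δ : ℕ → ℤ) : Cmd :=
  .seq (probe d δ) (.ite (.lt (.const 0) (.var rX)) (.assign rF (.const 1)) .skip)

def nextCmd : Cmd := .assign rI (.add (.var rI) (.const 1))

noncomputable def netStep (d R : ℕ) : Cmd :=
  .seq (.store (d + 5) (.var rI) (keyE d d)) (.seq (.assign rF (.const 0))
    (.seq (forEach (offsets d 1) (markCmd d))
      (.seq (.ite (.le (.var rF) (.const 0)) (insertCmd d R) .skip) nextCmd)))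

noncomputable def netLoop (d R : ℕ) : Cmd :=
  .seq (.assign rI (.const 0)) (.loop (.lt (.var rI) (.var rM)) (netStep d R))

/-- The memory during the two passes over the grid. -/
structure GridCtx {d : ℕ} (x : ℕ → EuclideanSpace ℝ (Fin d)) (n m : ℕ) (w : ℕ → ℕ) (S : ℝ)
    (B N r : ℕ) (s : State) : Prop where
  active : Active x n m w s
  rm : s.reg rM = m
  rs : s.reg rS = S
  rb : s.reg rB = B
  rn : s.reg rN = N
  rr : s.reg rR = r

theorem GridCtx.congr {d n m B N r : ℕ} {x : ℕ → EuclideanSpace ℝ (Fin d)} {w : ℕ → ℕ} {S : ℝ}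
    {s s' : State} (h : GridCtx x n m w S B N r s) (ha : ∀ a ≤ d, s'.arr a = s.arr a)
    (h2 : s'.reg rM = s.reg rM) (h7 : s'.reg rS = s.reg rS) (h11 : s'.reg rB = s.reg rB)
    (h12 : s'.reg rN = s.reg rN) (h13 : s'.reg rR = s.reg rR) : GridCtx x n m w S B N r s' :=
  ⟨h.active.congr ha, h2.trans h.rm, h7.trans h.rs, h11.trans h.rb, h12.trans h.rn,
    h13.trans h.rr⟩

/-- Number of members of `K` in the slot of `q`. -/
noncomputable def load (m N r : ℕ) (K : Finset ℕ) (key : ℕ → ℤ) (q : ℤ) : ℕ :=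
  (K.filter fun u => slot m N r (key u) = slot m N r q).card

theorem load_mono {m N r : ℕ} {K K' : Finset ℕ} (h : K ⊆ K') (key : ℕ → ℤ) (q : ℤ) :
    load m N r K key q ≤ load m N r K' key q :=
  Finset.card_le_card (Finset.filter_subset_filter _ h)

theorem offE_ops (δ : ℕ → ℤ) (k : ℕ) : (offE δ k).ops = 4 * k + 1 := by
  induction k with
  | zero => simp [offE, Expr.ops]
  | succ k ih => simp [offE, Expr.ops, ih]; ring

section Passes

variable {d n m B N r : ℕ} {x : ℕ → EuclideanSpace ℝ (Fin d)} {w : ℕ → ℕ} {S : ℝ} {s : State}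
  {T nx kf : ℕ → ℝ} {key : ℕ → ℤ} {K : Finset ℕ} {i : ℕ}

theorem run_probe (h : GridCtx x n m w S B N r s) (hT : s.arr (d + 3) = tab m T)
    (hnx : s.arr (d + 4) = tab m nx) (hk : s.arr (d + 5) = tab m kf)
    (hkey : ∀ u ∈ K, kf u = key u) (hK : K ⊆ Finset.range m)
    (htab : Table m (fun u => slot m N r (key u)) T nx K) (hi : i < m) (hki : kf i = key i)
    (hI : s.reg rI = i) (δ : ℕ → ℤ) :
    Run (probe d δ) s (60 + 4 * d + 25 * load m N r K key (key i + horner B δ d)) fun s' =>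
      (s'.reg rX = 0 ∧ ∀ u ∈ K, key u ≠ key i + horner B δ d) ∨
        ∃ u ∈ K, s'.reg rX = u + 1 ∧ key u = key i + horner B δ d := by
  have hoff := eval_offE (s := s) (B := B) (by simpa using h.rb) δ d
  refine (Run.seq (Run.assign (Q := fun s' => s' = s.setReg rQ ((key i + horner B δ d : ℤ) : ℝ)) ?_)
    (T₂ := 50 + 25 * load m N r K key (key i + horner B δ d)) ?_).mono ?_ (fun _ => id)
  · simp only [Expr.eval, hoff, hI, Nat.floor_natCast, hk, tab_getD _ hi, hki]
    push_cast; rfl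
  · rintro s' rfl
    exact run_lookup (by omega) (by simpa using hT) (by simpa using hnx) (by simpa using hk) hkey hK
      htab (by simpa using h.rm) (by simpa using h.rn) (by simpa using h.rr) (by simp)
  · simp only [Expr.ops, offE_ops]; omega

/-- The state of the table and of the result array while the net is being built. -/
structure NetInv (d m N r : ℕ) (y : ℕ → EuclideanSpace ℝ (Fin d)) (S : ℝ) (B R : ℕ) (i : ℕ)
    (s : State) : Prop where
  ri : s.reg rI = i
  exists_table : ∃ T nx : ℕ → ℝ, s.arr (d + 3) = tab m T ∧ s.arr (d + 4) = tab m nx ∧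
    Table m (fun u => slot m N r (pointKey S B (y u))) T nx (net S y i)
  keys : s.arr (d + 5) = tab m fun j => if j < i then (pointKey S B (y j) : ℝ) else 0
  vals : s.arr (d + 2) = tab m fun j => if j ∈ net S y i then R * S else 0

/-- Probing the `3 ^ d` surrounding cells decides the greedy rule: the flag stays zero exactly when
the point has to enter the net. -/
theorem run_mark {R : ℕ} {b : ℤ} {y : ℕ → EuclideanSpace ℝ (Fin d)}
    (hcell : ∀ i < m, ∀ a < d, |cell S (y i) a| ≤ b) (hB : 2 * b + R < B) (hR : 1 ≤ R)
    (h : GridCtx x n m w S B N r s) (hT : s.arr (d + 3) = tab m T)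
    (hnx : s.arr (d + 4) = tab m nx)
    (hk : s.arr (d + 5) = tab m fun j => if j < i + 1 then (pointKey S B (y j) : ℝ) else 0)
    (htab : Table m (fun u => slot m N r (pointKey S B (y u))) T nx (net S y i)) (hi : i < m)
    (hI : s.reg rI = i) (hF : s.reg rF = 0) :
    Run (forEach (offsets d 1) (markCmd d)) s
      (((offsets d 1).map fun δ => 70 + 4 * d + 25 * load m N r (net S y m)
        (fun u => pointKey S B (y u)) (pointKey S B (y i) + horner B δ d) + 1).sum + 1)
      fun s' => (s'.reg rF ≤ 0 ↔ ¬ ∃ u ∈ net S y i, Near S 1 (y i) (y u)) := by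
  have hnm := net_mono_of_le S y hi.le
  have hlt : ∀ u ∈ net S y i, u < i := fun u hu => Finset.mem_range.1 (net_subset S y i hu)
  refine (Run.forEach (offsets d 1) (markCmd d) (fun pre s' => s'.reg rF ≤ 0 ↔
    ¬ ∃ δ ∈ pre, ∃ u ∈ net S y i, pointKey S B (y u) = pointKey S B (y i) + horner B δ d)
    (fun δ => 70 + 4 * d + 25 * load m N r (net S y m)
        (fun u => pointKey S B (y u)) (pointKey S B (y i) + horner B δ d)) s (by simp [hF]) ?_).mono
    le_rfl ?_
  · intro pre δ hδ s' hA hI'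
    have ha : ∀ a, s'.arr a = s.arr a := fun a => hA.2 a (by
      simp [forEach_writesArr, markCmd, probe, lookup, follow, Cmd.writesArr])
    have hr : ∀ a, a ≠ rQ → a ≠ rX → a ≠ rF → s'.reg a = s.reg a := fun a h1 h2 h3 => hA.1 a (by
      simp [forEach_writesReg, markCmd, probe, lookup, follow, Cmd.writesReg, h1, h2, h3])
    have h' : GridCtx x n m w S B N r s' := h.congr (fun a _ => ha a) (hr _ (by simp) (by simp)
      (by simp)) (hr _ (by simp) (by simp) (by simp)) (hr _ (by simp) (by simp) (by simp))
      (hr _ (by simp) (by simp) (by simp)) (hr _ (by simp) (by simp) (by simp))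
    have hp := (run_probe (K := net S y i) (key := fun u => pointKey S B (y u)) h'
      (by rw [ha, hT]) (by rw [ha, hnx]) (by rw [ha, hk])
      (fun u hu => by simp [(hlt u hu).trans (Nat.lt_succ_self i)])
      ((net_subset S y i).trans (Finset.range_mono hi.le)) htab hi (by simp)
      ((hr _ (by simp) (by simp) (by simp)).trans hI) δ).frame
    refine (Run.seq hp (fun s'' hs'' => Run.of_simple (c := .ite (.lt (.const 0) (.var rX))
      (.assign rF (.const 1)) .skip) (by simp [Cmd.Simple]) ?_) (Q := fun s' => s'.reg rF ≤ 0 ↔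
    ¬ ∃ δ' ∈ pre ++ [δ], ∃ u ∈ net S y i,
      pointKey S B (y u) = pointKey S B (y i) + horner B δ' d)).mono ?_ (fun _ => id)
    · have hF' : s''.reg rF = s'.reg rF :=
        hs''.2.1 _ (by simp [probe, lookup, follow, Cmd.writesReg])
      simp only [Cmd.exec, Test.holds, Expr.eval, Int.cast_zero, Int.cast_one]
      rcases hs''.1 with ⟨h0, h1⟩ | ⟨u, hu, h0, h1⟩
      · simp only [h0, lt_irrefl, if_false, hF', hI', List.mem_append, List.mem_singleton]
        apply not_congr
        constructor
        · rintro ⟨δ', h2, h3⟩; exact ⟨δ', Or.inl h2, h3⟩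
        · rintro ⟨δ', h2 | rfl, u, hu, h3⟩
          · exact ⟨δ', h2, u, hu, h3⟩
          · exact absurd h3 (h1 u hu)
      · have : (0 : ℝ) < u + 1 := by positivity
        simp only [h0, this, if_true, setReg_reg]
        have h2 : ¬ ((1 : ℝ) ≤ 0) := by norm_num
        simp only [h2, false_iff, not_not]
        exact ⟨δ, by simp, u, hu, h1⟩
    · have := load_mono (m := m) (N := N) (r := r) hnm (fun u => pointKey S B (y u))
        (pointKey S B (y i) + horner B δ d)
      simp [Cmd.size, Test.ops, Expr.ops]
      omega
  · intro s' hs'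
    rw [hs']
    apply not_congr
    constructor
    · rintro ⟨δ, hδ, u, hu, h1⟩
      exact ⟨u, hu, by simpa using
        near_of_pointKey_eq (hcell i hi) (hcell u ((hlt u hu).trans hi)) hB hR hδ h1⟩
    · rintro ⟨u, hu, h1⟩
      obtain ⟨δ, hδ, h2⟩ := exists_pointKey_eq (B := B) (k := 1) (by simpa using h1)
      exact ⟨δ, hδ, u, hu, h2⟩

end Passes

section Net

variable {d n m B N r : ℕ} {x : ℕ → EuclideanSpace ℝ (Fin d)} {w : ℕ → ℕ} {S : ℝ} {s : State}
  {i R : ℕ} {b : ℤ}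

/-- Time for probing the cells around position `i`. -/
noncomputable def probeTime (m N r : ℕ) (y : ℕ → EuclideanSpace ℝ (Fin d)) (S : ℝ) (B k c i : ℕ) : ℕ :=
  ((offsets d k).map fun δ => c + 4 * d + 25 * load m N r (net S y m)
        (fun u => pointKey S B (y u)) (pointKey S B (y i) + horner B δ d) + 1).sum + 1

theorem run_netStep (hcell : ∀ i < m, ∀ a < d, |cell S (x (w i)) a| ≤ b) (hB : 2 * b + R < B)
    (hR : 1 ≤ R) (h : GridCtx x n m w S B N r s)
    (hI : NetInv d m N r (fun i => x (w i)) S B R i s) (hi : i < m) :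
    Run (netStep d R) s
      ((netStep d R).size + probeTime m N r (fun i => x (w i)) S B 1 70 i)
      (NetInv d m N r (fun i => x (w i)) S B R (i + 1)) := by
  set y := fun i => x (w i) with hy
  obtain ⟨T, nx, hT, hnx, htab⟩ := hI.exists_table
  set s₁ := s.setArr (d + 5) (tab m fun j => if j < i + 1 then (pointKey S B (y j) : ℝ) else 0)
    with hs₁
  set s₂ := s₁.setReg rF 0 with hs₂
  have hctx₂ : GridCtx x n m w S B N r s₂ :=
    h.congr (fun a ha => by simp [hs₂, hs₁, show a ≠ d + 5 by omega]) (by simp [hs₂, hs₁])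
      (by simp [hs₂, hs₁]) (by simp [hs₂, hs₁]) (by simp [hs₂, hs₁]) (by simp [hs₂, hs₁])
  have hmark := (run_mark (R := R) (y := y) (i := i) (T := T) (nx := nx) hcell hB hR hctx₂
    (by simpa [hs₂, hs₁] using hT) (by simpa [hs₂, hs₁] using hnx) (by simp [hs₂, hs₁]) htab hi
    (by simpa [hs₂, hs₁] using hI.ri) (by simp [hs₂])).frame
  have hin : i ∉ net S y i := fun hin => by
    simpa using net_subset S y i hin
  have hlast : ∀ s₃, ((s₃.reg rF ≤ 0 ↔ ¬ ∃ u ∈ net S y i, Near S 1 (y i) (y u)) ∧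
      Agree (forEach (offsets d 1) (markCmd d)) s₂ s₃) →
      Run (.seq (.ite (.le (.var rF) (.const 0)) (insertCmd d R) .skip) nextCmd) s₃
        (Cmd.seq (.ite (.le (.var rF) (.const 0)) (insertCmd d R) .skip) nextCmd).size
        (NetInv d m N r y S B R (i + 1)) := by
    rintro s₃ ⟨hF, hA⟩
    have ha : s₃.arr = s₂.arr := funext fun a => hA.2 a (by
      simp [forEach_writesArr, markCmd, probe, lookup, follow, Cmd.writesArr])
    have hr : ∀ a, a ≠ rQ → a ≠ rX → a ≠ rF → s₃.reg a = s₂.reg a := fun a h1 h2 h3 => hA.1 a (by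
      simp [forEach_writesReg, markCmd, probe, lookup, follow, Cmd.writesReg, h1, h2, h3])
    have h8 : s₃.reg rI = i := by
      rw [hr _ (by simp) (by simp) (by simp)]; simpa [hs₂, hs₁] using hI.ri
    have hctx₃ : GridCtx x n m w S B N r s₃ := hctx₂.congr (fun a _ => by rw [ha])
      (hr _ (by simp) (by simp) (by simp)) (hr _ (by simp) (by simp) (by simp))
      (hr _ (by simp) (by simp) (by simp)) (hr _ (by simp) (by simp) (by simp))
      (hr _ (by simp) (by simp) (by simp))
    have a5 : s₃.arr (d + 5) = tab m fun j => if j < i + 1 then (pointKey S B (y j) : ℝ) else 0 := by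
      rw [ha]; simp [hs₂, hs₁]
    have a4 : s₃.arr (d + 4) = tab m nx := by rw [ha]; simpa [hs₂, hs₁] using hnx
    have a3 : s₃.arr (d + 3) = tab m T := by rw [ha]; simpa [hs₂, hs₁] using hT
    have a2 : s₃.arr (d + 2) = tab m fun j => if j ∈ net S y i then R * S else 0 := by
      rw [ha]; simpa [hs₂, hs₁] using hI.vals
    refine Run.of_simple (by simp [Cmd.Simple, insertCmd, nextCmd]) ?_
    have hcond : (Test.le (.var rF) (.const 0)).holds s₃ ↔
        ¬ ∃ u ∈ net S y i, Near S 1 (y i) (y u) := by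
      simpa [Test.holds, Expr.eval] using hF
    have hkeyE : ∀ s' : State, s'.reg rI = i → s'.arr (d + 5) = s₃.arr (d + 5) →
        (Expr.get (d + 5) (.var rI)).eval s' = (pointKey S B (y i) : ℝ) := by
      intro s' h1 h2
      rw [Expr.eval, Expr.eval, h1, h2, a5, Nat.floor_natCast, tab_getD _ hi]
      simp
    have hslot : ∀ s' : State, s'.reg = s₃.reg → s'.arr (d + 5) = s₃.arr (d + 5) →
        ⌊(slotE (.get (d + 5) (.var rI))).eval s'⌋₊ = slot m N r (pointKey S B (y i)) := by
      intro s' h1 h2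
      exact floor_eval_slotE (by rw [h1, hctx₃.rm]) (by rw [h1, hctx₃.rn]) (by rw [h1, hctx₃.rr])
        (hkeyE s' (by rw [h1, h8]) h2)
    have hsl := slot_lt (by omega : 0 < m) N r (pointKey S B (y i))
    by_cases hex : ∃ u ∈ net S y i, Near S 1 (y i) (y u)
    · have hnet : net S y (i + 1) = net S y i := by rw [net, if_pos hex]
      have hno : ¬ (Test.le (.var rF) (.const 0)).holds s₃ := fun hh => hcond.1 hh hex
      simp only [Cmd.exec, hno, if_false, nextCmd, Expr.eval]
      refine ⟨by simp [h8], ⟨T, nx, by simpa using a3, by simpa using a4, by rw [hnet]; exact htab⟩,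
        by simpa using a5, ?_⟩
      rw [hnet]; simpa using a2
    · have hnet : net S y (i + 1) = insert i (net S y i) := by rw [net, if_neg hex]
      have hyes : (Test.le (.var rF) (.const 0)).holds s₃ := hcond.2 hex
      have e1 : (insertCmd d R).exec s₃ = ((s₃.setArr (d + 4)
          (tab m (Function.update nx i (T (slot m N r (pointKey S B (y i))))))).setArr (d + 3)
          (tab m (Function.update T (slot m N r (pointKey S B (y i))) (i + 1)))).setArr (d + 2)
          (tab m fun j => if j ∈ net S y (i + 1) then R * S else 0) := by
        simp only [insertCmd, Cmd.exec]
        have q1 : (Expr.get (d + 3) (slotE (.get (d + 5) (.var rI)))).eval s₃ =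
            T (slot m N r (pointKey S B (y i))) := by
          rw [Expr.eval, hslot s₃ rfl rfl, a3, tab_getD _ hsl]
        rw [q1]
        have q2 : (Expr.var rI).eval s₃ = i := h8
        rw [q2, Nat.floor_natCast, a4, tab_set]
        rw [hslot _ (by simp) (by simp)]
        simp only [Expr.eval, setArr_reg, setArr_arr, h8, a3, a2, tab_set,
          Int.cast_one, hctx₃.rs, Nat.floor_natCast, Int.cast_natCast,
          show d + 3 ≠ d + 4 by omega, show d + 2 ≠ d + 3 by omega, show d + 2 ≠ d + 4 by omega,
          if_false]
        congr 1
        refine tab_congr fun j hj => ?_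
        rw [hnet]
        by_cases hji : j = i
        · subst hji; simp
        · simp [hji]
      simp only [Cmd.exec, hyes, if_true, nextCmd]
      rw [e1]
      refine ⟨by simp [Expr.eval, h8], ⟨_, _, by simp; rfl, by simp; rfl, ?_⟩, by simpa using a5,
        by simp⟩
      rw [hnet]
      exact htab.insert hin
  refine (Run.seq (Run.store (Q := fun s' => s' = s₁) ?_) (fun s' hs' => ?_)
    (T₂ := 1 + (1 + (Expr.const 0).ops) + (1 + probeTime m N r y S B 1 70 i +
      (Cmd.seq (.ite (.le (.var rF) (.const 0)) (insertCmd d R) .skip) nextCmd).size))).mono ?_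
      (fun _ => id)
  · have q1 := eval_keyE h.active hi hI.ri (B := B) (by simpa using h.rb) le_rfl
    have q2 : (Expr.var rI).eval s = i := hI.ri
    rw [q1, q2, Nat.floor_natCast, hI.keys, tab_set, hs₁, h.rs]
    congr 1
    refine tab_congr fun j hj => ?_
    by_cases hji : j = i
    · subst hji; simp [pointKey, hy]
    · rw [Function.update_of_ne hji]
      have : j < i + 1 ↔ j < i := by omega
      simp only [this]
  · subst hs'
    refine Run.seq (Run.assign (Q := fun s' => s' = s₂) (by simp [hs₂, Expr.eval]))
      fun s' hs' => ?_
    subst hs'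
    exact Run.seq hmark hlast
  · simp [netStep, Cmd.size]; omega

theorem run_netLoop (hcell : ∀ i < m, ∀ a < d, |cell S (x (w i)) a| ≤ b) (hB : 2 * b + R < B)
    (hR : 1 ≤ R) (h : GridCtx x n m w S B N r s)
    (h3 : s.arr (d + 3) = tab m fun _ => 0) (h4 : s.arr (d + 4) = tab m fun _ => 0)
    (h5 : s.arr (d + 5) = tab m fun _ => 0) (h2 : s.arr (d + 2) = tab m fun _ => 0) :
    Run (netLoop d R) s
      (∑ i ∈ Finset.range m,
        ((netStep d R).size + probeTime m N r (fun i => x (w i)) S B 1 70 i + 4) + 10)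
      (NetInv d m N r (fun i => x (w i)) S B R m) := by
  refine (Run.seq (Run.assign (Q := fun s' => s' = s.setReg rI 0) (by simp [Expr.eval]))
    (T₂ := ∑ i ∈ Finset.range m,
        ((netStep d R).size + probeTime m N r (fun i => x (w i)) S B 1 70 i + 4) + 4)
    (fun s' hs' => ?_)).mono (by simp [Expr.ops]; omega) (fun _ => id)
  subst hs'
  have hw : ∀ a, (netStep d R).writesArr a → d < a := by
    intro a ha
    simp [netStep, forEach_writesArr, markCmd, probe, lookup, follow, Cmd.writesArr, insertCmd,
      nextCmd] at ha
    omega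
  have hwr : ∀ a, (netStep d R).writesReg a → a = rQ ∨ a = rX ∨ a = rF ∨ a = rI := by
    intro a ha
    simp [netStep, forEach_writesReg, markCmd, probe, lookup, follow, Cmd.writesReg, insertCmd,
      nextCmd] at ha
    omega
  refine Run.for_loop_agree m _ _ (fun i s hs => hs.ri) (by simpa using h.rm)
    (fun h => by have := hwr _ h; omega) (fun i hi s' hA hI => ?_) ?_
  · refine run_netStep hcell hB hR (h.congr (fun a ha => ?_) ?_ ?_ ?_ ?_ ?_) hI hi
    · exact (hA.2 a fun h => by have := hw _ h; omega)
    all_goals exact (hA.1 _ fun h => by have := hwr _ h; omega).trans (by simp)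
  · exact ⟨by simp, ⟨_, _, by simpa using h3, by simpa using h4, Table.empty _ _⟩,
      by simpa using h5, by simpa [net] using h2⟩

end Net

/-! ## Nearest neighbour distances over the net -/

/-- Update the distance of the net point in the cell of the current point, shifted by `δ`. -/
def relaxCmd (d : ℕ) (δ : ℕ → ℤ) : Cmd :=
  .seq (probe d δ) (.ite (.lt (.const 0) (.var rX))
    (.seq (.assign rD (distE d (.sub (.var rX) (.const 1)) (.var rI)))
      (.ite (.lt (.const 0) (.var rD))
        (.ite (.lt (.var rD) (.get (d + 2) (.sub (.var rX) (.const 1))))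
          (.store (d + 2) (.sub (.var rX) (.const 1)) (.var rD)) .skip) .skip)) .skip)

noncomputable def relaxStep (d R : ℕ) : Cmd := .seq (forEach (offsets d R) (relaxCmd d)) nextCmd

noncomputable def relaxLoop (d R : ℕ) : Cmd :=
  .seq (.assign rI (.const 0)) (.loop (.lt (.var rI) (.var rM)) (relaxStep d R))

/-- `V` holds, for the members of the net, upper bounds of their nearest neighbour distances, which
take into account the pairs in `done`. -/
structure RelaxInv {d : ℕ} (m : ℕ) (y : ℕ → EuclideanSpace ℝ (Fin d)) (S : ℝ) (R : ℕ)
    (done : ℕ → ℕ → Prop) (V : ℕ → ℝ) : Prop where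
  zero : ∀ u < m, u ∉ net S y m → V u = 0
  le : ∀ u ∈ net S y m, V u ≤ R * S
  upd : ∀ u ∈ net S y m, ∀ v, done u v → v ≠ u → V u ≤ dist (y u) (y v)
  attained : ∀ u ∈ net S y m, V u = R * S ∨ ∃ v < m, v ≠ u ∧ V u = dist (y u) (y v)

theorem RelaxInv.congr {d m R : ℕ} {y : ℕ → EuclideanSpace ℝ (Fin d)} {S : ℝ}
    {done done' : ℕ → ℕ → Prop} {V : ℕ → ℝ} (h : RelaxInv m y S R done V)
    (hd : ∀ u ∈ net S y m, ∀ v, v ≠ u → done' u v → done u v) : RelaxInv m y S R done' V :=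
  ⟨h.zero, h.le, fun u hu v hv hvu => h.upd u hu v (hd u hu v hvu hv) hvu, h.attained⟩

/-- A nearest neighbour within `R * S` lies at most `R` cells away in each coordinate, so its pair
was examined. Conversely every stored value is the cutoff or a genuine distance. -/
theorem RelaxInv.eq_min {d m R : ℕ} {y : ℕ → EuclideanSpace ℝ (Fin d)} {S : ℝ} (hS : 0 < S)
    (hm : 2 ≤ m) {V : ℕ → ℝ}
    (h : RelaxInv m y S R (fun u v => v < m ∧ Near S R (y v) (y u)) V) {u : ℕ}
    (hu : u ∈ net S y m) : V u = min (R * S) (nnd y (Finset.range m) u) := by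
  refine le_antisymm (le_min (h.le u hu) ?_) ?_
  · obtain ⟨v, hv, hvu, he⟩ := exists_eq_nnd (x := y) (S := Finset.range m) (by simpa) u
    rw [he]
    rcases le_total (dist (y u) (y v)) (R * S) with h1 | h1
    · exact h.upd u hu v ⟨Finset.mem_range.1 hv, (near_of_dist_le hS h1).symm⟩ hvu
    · exact (h.le u hu).trans h1
  · rcases h.attained u hu with h1 | ⟨v, hv, hvu, h1⟩
    · rw [h1]; exact min_le_left _ _
    · rw [h1]; exact (min_le_right _ _).trans (nnd_le (Finset.mem_range.2 hv) hvu)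

section Relax

variable {d n m B N r : ℕ} {x : ℕ → EuclideanSpace ℝ (Fin d)} {w : ℕ → ℕ} {S : ℝ} {s : State}
  {i R : ℕ} {b : ℤ} {T nx : ℕ → ℝ}

theorem run_relax {y : ℕ → EuclideanSpace ℝ (Fin d)} (hy : y = fun i => x (w i))
    (hinj : Set.InjOn y (Finset.range m))
    (hcell : ∀ i < m, ∀ a < d, |cell S (y i) a| ≤ b) (hB : 2 * b + R < B)
    (h : GridCtx x n m w S B N r s) (hT : s.arr (d + 3) = tab m T)
    (hnx : s.arr (d + 4) = tab m nx)
    (hk : s.arr (d + 5) = tab m fun j => if j < m then (pointKey S B (y j) : ℝ) else 0)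
    (htab : Table m (fun u => slot m N r (pointKey S B (y u))) T nx (net S y m)) (hi : i < m)
    (hI : s.reg rI = i) {done : ℕ → ℕ → Prop}
    (hV : ∃ V : ℕ → ℝ, s.arr (d + 2) = tab m V ∧ RelaxInv m y S R done V) :
    Run (forEach (offsets d R) (relaxCmd d)) s
      (probeTime m N r y S B R (70 + (relaxCmd d 0).size) i)
      fun s' => ∃ V : ℕ → ℝ, s'.arr (d + 2) = tab m V ∧ RelaxInv m y S R
        (fun u v => done u v ∨ (v = i ∧ Near S R (y i) (y u))) V := by
  have hsub := net_subset S y m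
  refine (Run.forEach (offsets d R) (relaxCmd d) (fun pre s' => ∃ V : ℕ → ℝ,
      s'.arr (d + 2) = tab m V ∧ RelaxInv m y S R (fun u v => done u v ∨ (v = i ∧
        ∃ δ ∈ pre, pointKey S B (y u) = pointKey S B (y i) + horner B δ d)) V)
    (fun δ => 70 + (relaxCmd d 0).size + 4 * d + 25 * load m N r (net S y m)
        (fun u => pointKey S B (y u)) (pointKey S B (y i) + horner B δ d)) s
        (by simpa using hV) ?_).mono le_rfl ?_
  · rintro pre δ hδ s' hA ⟨V, hV, hI'⟩
    have ha : ∀ a, a ≠ d + 2 → s'.arr a = s.arr a := fun a h0 => hA.2 a (by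
      simp [forEach_writesArr, relaxCmd, probe, lookup, follow, Cmd.writesArr, h0])
    have hr : ∀ a, a ≠ rQ → a ≠ rX → a ≠ rD → s'.reg a = s.reg a := fun a h1 h2 h3 => hA.1 a (by
      simp [forEach_writesReg, relaxCmd, probe, lookup, follow, Cmd.writesReg, h1, h2, h3])
    have h' : GridCtx x n m w S B N r s' := h.congr (fun a had => ha a (by omega)) (hr _ (by simp)
      (by simp) (by simp)) (hr _ (by simp) (by simp) (by simp)) (hr _ (by simp) (by simp) (by simp))
      (hr _ (by simp) (by simp) (by simp)) (hr _ (by simp) (by simp) (by simp))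
    have hp := (run_probe (K := net S y m) (key := fun u => pointKey S B (y u)) h'
      (by rw [ha _ (by omega), hT]) (by rw [ha _ (by omega), hnx]) (by rw [ha _ (by omega), hk])
      (fun u hu => by simp [Finset.mem_range.1 (hsub hu)])
      hsub htab hi (by simp [hi])
      ((hr _ (by simp) (by simp) (by simp)).trans hI) δ).frame
    refine (Run.seq hp (fun s'' hs'' => Run.of_simple (c := (.ite (.lt (.const 0) (.var rX))
    (.seq (.assign rD (distE d (.sub (.var rX) (.const 1)) (.var rI)))
      (.ite (.lt (.const 0) (.var rD))
        (.ite (.lt (.var rD) (.get (d + 2) (.sub (.var rX) (.const 1))))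
          (.store (d + 2) (.sub (.var rX) (.const 1)) (.var rD)) .skip) .skip)) .skip))
          (by simp [Cmd.Simple]) ?_) (Q := fun s' => ∃ V : ℕ → ℝ,
      s'.arr (d + 2) = tab m V ∧ RelaxInv m y S R (fun u v => done u v ∨ (v = i ∧
        ∃ δ' ∈ pre ++ [δ], pointKey S B (y u) = pointKey S B (y i) + horner B δ' d)) V)).mono
          ?_ (fun _ => id)
    · have ha'' : s''.arr = s'.arr := funext fun a => hs''.2.2 _ (by
        simp [probe, lookup, follow, Cmd.writesArr])
      have hr'' : ∀ a, a ≠ rQ → a ≠ rX → s''.reg a = s'.reg a := fun a h1 h2 => hs''.2.1 a (by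
        simp [probe, lookup, follow, Cmd.writesReg, h1, h2])
      have h8 : s''.reg rI = i := by
        rw [hr'' _ (by simp) (by simp), hr _ (by simp) (by simp) (by simp), hI]
      have hV'' : s''.arr (d + 2) = tab m V := by rw [ha'', hV]
      rcases hs''.1 with ⟨h0, h1⟩ | ⟨u, hu, h0, h1⟩
      · simp only [Cmd.exec, Test.holds, Expr.eval, Int.cast_zero, h0, lt_irrefl, if_false]
        refine ⟨V, hV'', hI'.congr fun u hu v hvu => ?_⟩
        rintro (h2 | ⟨rfl, δ', h2, h3⟩)
        · exact Or.inl h2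
        · rcases List.mem_append.1 h2 with h2 | h2
          · exact Or.inr ⟨rfl, δ', h2, h3⟩
          · rw [List.mem_singleton] at h2
            subst h2
            exact absurd h3 (h1 u hu)
      · have hum : u < m := Finset.mem_range.1 (hsub hu)
        have hpos : (0 : ℝ) < u + 1 := by positivity
        have hact : Active x n m w s'' := h'.active.congr fun a _ => by rw [ha'']
        have hdist := eval_distE hact hum hi (e := .sub (.var rX) (.const 1)) (f := .var rI)
          (by simp [Expr.eval, h0]) (by simp [Expr.eval, h8])
        have hdist' : (distE d (.sub (.var rX) (.const 1)) (.var rI)).eval s'' =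
          dist (y u) (y i) := by rw [hdist, hy]
        -- A cell holds at most one net point, so the single hit of the lookup accounts for the
        -- whole cell.
        have huniq : ∀ u' ∈ net S y m, pointKey S B (y u') = pointKey S B (y i) + horner B δ d →
            u' = u := by
          intro u' hu' h2
          by_contra hne
          refine net_separated S y m u hu u' hu' (Ne.symm hne) fun a ha => ?_
          have := near_of_pointKey_eq' (hcell u hum) (hcell u' (Finset.mem_range.1 (hsub hu'))) hB
            (h2.trans h1.symm) a ha
          linarith
        simp only [Cmd.exec, Test.holds, Expr.eval, Int.cast_zero, Int.cast_one, h0, hpos, if_true,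
          hdist', setReg_reg, setReg_arr, hV'', add_sub_cancel_right, Nat.floor_natCast,
          tab_getD _ hum, show (rX = rD) = False by simp, if_false]
        have hnew : ∀ V' : ℕ → ℝ, (∀ u', u' ≠ u → V' u' = V u') → V' u ≤ V u →
            (u ≠ i → V' u ≤ dist (y u) (y i)) →
            (V' u = V u ∨ (i ≠ u ∧ V' u = dist (y u) (y i))) →
            RelaxInv m y S R (fun u v => done u v ∨ (v = i ∧
              ∃ δ' ∈ pre ++ [δ], pointKey S B (y u) = pointKey S B (y i) + horner B δ' d)) V' := by
          intro V' e1 e2 e3 e4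
          have hle : ∀ u' , V' u' ≤ V u' := fun u' => by
            by_cases hh : u' = u
            · rw [hh]; exact e2
            · exact (e1 u' hh).le
          refine ⟨fun u' h1 h2 => ?_, fun u' h1 => (hle u').trans (hI'.le u' h1), ?_, ?_⟩
          · rw [e1 u' (fun h3 => h2 (h3 ▸ hu))]; exact hI'.zero u' h1 h2
          · rintro u' hu' v (h2 | ⟨rfl, δ', h2, h3⟩) hvu
            · exact (hle u').trans (hI'.upd u' hu' v (Or.inl h2) hvu)
            · rcases List.mem_append.1 h2 with h2 | h2
              · exact (hle u').trans (hI'.upd u' hu' v (Or.inr ⟨rfl, δ', h2, h3⟩) hvu)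
              · rw [List.mem_singleton] at h2
                subst h2
                obtain rfl := huniq u' hu' h3
                exact e3 hvu.symm
          · intro u' hu'
            by_cases hh : u' = u
            · subst hh
              rcases e4 with e4 | ⟨e4, e5⟩
              · rw [e4]; exact hI'.attained u' hu
              · exact Or.inr ⟨i, hi, e4, e5⟩
            · rw [e1 u' hh]; exact hI'.attained u' hu'
        split_ifs with c1 c2
        · refine ⟨Function.update V u (dist (y u) (y i)), ?_, hnew _ ?_ ?_ ?_ ?_⟩
          · simp [tab_set]
          · exact fun u' hu' => Function.update_of_ne hu' _ _
          · simpa using c2.le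
          · simp
          · right
            refine ⟨fun hiu => ?_, by simp⟩
            rw [hiu, dist_self] at c1
            exact lt_irrefl _ c1
        · refine ⟨V, by simpa using hV'', hnew V (fun _ _ => rfl) le_rfl (fun _ => not_lt.1 c2)
            (Or.inl rfl)⟩
        -- The points are distinct, so zero distance means that the point has met itself; such a
        -- pair must not be recorded.
        · refine ⟨V, by simpa using hV'', hnew V (fun _ _ => rfl) le_rfl (fun hui => ?_)
            (Or.inl rfl)⟩
          exfalso
          refine c1 (dist_pos.2 fun hxy => hui ?_)
          exact hinj (by simpa using hum) (by simpa using hi) hxy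
    · simp only [relaxCmd, Cmd.size]
      omega
  · rintro s' ⟨V, hV, hI'⟩
    refine ⟨V, hV, hI'.congr fun u hu v hvu => ?_⟩
    rintro (h1 | ⟨rfl, h1⟩)
    · exact Or.inl h1
    · obtain ⟨δ, hδ, h2⟩ := exists_pointKey_eq (B := B) h1
      exact Or.inr ⟨rfl, δ, hδ, h2⟩

theorem run_relaxLoop (hinj : Set.InjOn (fun i => x (w i)) (Finset.range m))
    (hcell : ∀ i < m, ∀ a < d, |cell S (x (w i)) a| ≤ b) (hB : 2 * b + R < B)
    (h : GridCtx x n m w S B N r s) (hS : 0 < S) (hm : 2 ≤ m)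
    (hnet : NetInv d m N r (fun i => x (w i)) S B R m s) :
    Run (relaxLoop d R) s
      (∑ i ∈ Finset.range m,
        (20 + probeTime m N r (fun i => x (w i)) S B R (70 + (relaxCmd d 0).size) i) + 10)
      fun s' => s'.arr (d + 2) = tab m fun u => if u ∈ net S (fun i => x (w i)) m then
        min (R * S) (nnd (fun i => x (w i)) (Finset.range m) u) else 0 := by
  set y := fun i => x (w i) with hy
  obtain ⟨T, nx, hT, hnx, htab⟩ := hnet.exists_table
  have hw : ∀ a, (relaxStep d R).writesArr a → a = d + 2 := by
    intro a ha
    simp [relaxStep, forEach_writesArr, relaxCmd, probe, lookup, follow, Cmd.writesArr,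
      nextCmd] at ha
    omega
  have hwr : ∀ a, (relaxStep d R).writesReg a → a = rQ ∨ a = rX ∨ a = rD ∨ a = rI := by
    intro a ha
    simp [relaxStep, forEach_writesReg, relaxCmd, probe, lookup, follow, Cmd.writesReg,
      nextCmd] at ha
    omega
  refine (Run.seq (Run.assign (Q := fun s' => s' = s.setReg rI 0) (by simp [Expr.eval]))
    (T₂ := ∑ i ∈ Finset.range m,
        (16 + probeTime m N r y S B R (70 + (relaxCmd d 0).size) i + 4) + 4)
    (Q := fun s' => s'.reg rI = m ∧ ∃ V : ℕ → ℝ, s'.arr (d + 2) = tab m V ∧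
      RelaxInv m y S R (fun u v => v < m ∧ Near S R (y v) (y u)) V)
    (fun s' hs' => ?_)).mono ?_ ?_
  · subst hs'
    refine Run.for_loop_agree m (fun i s' => s'.reg rI = i ∧ ∃ V : ℕ → ℝ,
      s'.arr (d + 2) = tab m V ∧ RelaxInv m y S R (fun u v => v < i ∧ Near S R (y v) (y u)) V) _
      (fun i s hs => hs.1) (by simpa using h.rm)
      (fun h => by have := hwr _ h; omega) (fun i hi s' hA hI => ?_) ?_
    · have hr : ∀ a, a ≠ rQ → a ≠ rX → a ≠ rD → a ≠ rI → s'.reg a = s.reg a := by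
        intro a h1 h2 h3 h4
        exact (hA.1 a fun h => by have := hwr _ h; omega).trans (by simp [h4])
      have ha : ∀ a, a ≠ d + 2 → s'.arr a = s.arr a := by
        intro a h1
        exact (hA.2 a fun h => h1 (hw _ h)).trans (by simp)
      have hctx : GridCtx x n m w S B N r s' := h.congr (fun a had => ha a (by omega))
        (hr _ (by simp) (by simp) (by simp) (by simp)) (hr _ (by simp) (by simp) (by simp) (by simp))
        (hr _ (by simp) (by simp) (by simp) (by simp)) (hr _ (by simp) (by simp) (by simp) (by simp))
        (hr _ (by simp) (by simp) (by simp) (by simp))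
      have h1 := (run_relax hy hinj hcell hB hctx (by rw [ha _ (by omega), hT])
        (by rw [ha _ (by omega), hnx]) (by rw [ha _ (by omega), hnet.keys]) htab hi hI.1 hI.2).frame
      refine (Run.seq h1 (fun s'' hs'' => Run.assign ?_)).mono ?_ (fun _ => id)
      · obtain ⟨⟨V, hV, hV'⟩, hA'⟩ := hs''
        have h8 : s''.reg rI = i := by
          rw [hA'.1 rI (by simp [forEach_writesReg, relaxCmd, probe, lookup, follow, Cmd.writesReg]),
            hI.1]
        refine ⟨by simp [Expr.eval, h8], V, by simpa using hV, hV'.congr fun u hu v hvu => ?_⟩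
        rintro ⟨hv, hn⟩
        rcases Nat.lt_succ_iff_lt_or_eq.1 hv with hv | rfl
        · exact Or.inl ⟨hv, hn⟩
        · exact Or.inr ⟨rfl, hn⟩
      · simp [Expr.ops]; omega
    · refine ⟨by simp, _, by simpa using hnet.vals, ⟨fun u _ hu => by simp [hu],
        fun u hu => by simp [hu], fun u _ v hv => by omega, fun u hu => Or.inl (by simp [hu])⟩⟩
  · simp only [Expr.ops, Finset.sum_add_distrib, Finset.sum_const, Finset.card_range, smul_eq_mul]
    omega
  · rintro s' ⟨-, V, hV, hV'⟩
    rw [hV]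
    refine tab_congr fun u hu => ?_
    split_ifs with hK
    · exact hV'.eq_min hS hm hK
    · exact hV'.zero u hu hK

end Relax

/-! ## The grid procedure -/

def sumStep (d : ℕ) : Cmd := .seq (.assign rB (.add (.var rB) (cellSqE d d))) nextCmd

noncomputable def gridPasses (d R : ℕ) : Cmd :=
  .seq (.alloc (d + 2) (.var rM)) (.seq (.alloc (d + 3) (.var rM)) (.seq (.alloc (d + 4) (.var rM))
    (.seq (.alloc (d + 5) (.var rM)) (.seq (netLoop d R) (relaxLoop d R)))))

/-- For the active points, with the grid of side `rS`: array `d + 2` := the nearest neighbour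
distances, cut off at `R` times the side, of a net; `0` outside the net. -/
noncomputable def grid (d R : ℕ) : Cmd :=
  .seq (.assign rB (.const 1)) (.seq (.assign rI (.const 0))
    (.seq (.loop (.lt (.var rI) (.var rM)) (sumStep d))
      (.seq (.assign rB (.add (.mul (.const 2) (.var rB)) (.const (R + 1))))
        (.seq (.assign rN (.mul (.mul (.const 4) (.var rM)) (powE d)))
          (.seq (.rand rR (.sub (.var rN) (.const 1))) (gridPasses d R))))))

theorem Run.seq_eq {c c' : Cmd} {s s' : State} {T₁ T₂ : ℕ} {Q : State → Prop}
    (hc : Run c s T₁ fun t => t = s') (hd : Run c' s' T₂ Q) : Run (.seq c c') s (1 + T₁ + T₂) Q :=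
  Run.seq hc fun t ht => by rw [ht]; exact hd

theorem Run.seq_assign {x : ℕ} {e : Expr} {c : Cmd} {s s' : State} {T : ℕ} {Q : State → Prop}
    (hs : s.setReg x (e.eval s) = s') (hd : Run c s' T Q) :
    Run (.seq (.assign x e) c) s (2 + e.ops + T) Q :=
  (Run.seq_eq (Run.assign hs) hd).mono (by omega) fun _ => id

section GridRun

variable {d n m B N r : ℕ} {x : ℕ → EuclideanSpace ℝ (Fin d)} {w : ℕ → ℕ} {S : ℝ} {s : State}
  {R : ℕ} {b : ℤ}

/-- The values that the grid procedure computes. -/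
noncomputable def gridVal {d : ℕ} (y : ℕ → EuclideanSpace ℝ (Fin d)) (m R : ℕ) (S : ℝ) (u : ℕ) : ℝ :=
  open Classical in
  if u ∈ net S y m then min (R * S) (nnd y (Finset.range m) u) else 0

/-- For a fixed multiplier `r` the time depends on the chain lengths, but the result does not. -/
theorem run_gridPasses (hinj : Set.InjOn (fun i => x (w i)) (Finset.range m))
    (hcell : ∀ i < m, ∀ a < d, |cell S (x (w i)) a| ≤ b) (hB : 2 * b + R < B) (hR : 1 ≤ R)
    (h : GridCtx x n m w S B N r s) (hS : 0 < S) (hm : 2 ≤ m) :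
    Run (gridPasses d R) s
      (∑ i ∈ Finset.range m, (((netStep d R).size + 24) +
        (probeTime m N r (fun i => x (w i)) S B 1 70 i +
          probeTime m N r (fun i => x (w i)) S B R (70 + (relaxCmd d 0).size) i)) + 4 * m + 40)
      fun s' => s'.arr (d + 2) = tab m (gridVal (fun i => x (w i)) m R S) := by
  set y := fun i => x (w i) with hy
  set z := tab m fun _ => (0 : ℝ) with hz
  have hal : ∀ a (s' : State), s'.reg rM = m → Run (.alloc a (.var rM)) s' (2 + m)
      fun s'' => s'' = s'.setArr a z := by
    intro a s' hs'
    refine (Run.alloc ?_).mono (by simp [Expr.ops, Expr.eval, hs']) (fun _ => id)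
    simp [Expr.eval, hs', replicate_eq_tab, hz]
  set s₄ := (((s.setArr (d + 2) z).setArr (d + 3) z).setArr (d + 4) z).setArr (d + 5) z with hs₄
  have hctx₄ : GridCtx x n m w S B N r s₄ := h.congr
    (fun a ha => by simp [hs₄, show a ≠ d + 2 by omega, show a ≠ d + 3 by omega,
      show a ≠ d + 4 by omega, show a ≠ d + 5 by omega]) (by simp [hs₄]) (by simp [hs₄])
      (by simp [hs₄]) (by simp [hs₄]) (by simp [hs₄])
  have h5 := (run_netLoop hcell hB hR hctx₄ (by simp [hs₄, hz]) (by simp [hs₄, hz])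
    (by simp [hs₄, hz]) (by simp [hs₄, hz])).frame
  have h6 := Run.seq h5 (d := relaxLoop d R) (T₂ := ∑ i ∈ Finset.range m,
        (20 + probeTime m N r (fun i => x (w i)) S B R (70 + (relaxCmd d 0).size) i) + 10)
    (Q := fun s' => s'.arr (d + 2) = tab m (gridVal y m R S)) (by
      rintro s' ⟨hI, hA⟩
      have hctx : GridCtx x n m w S B N r s' := hctx₄.congr (fun a had => hA.2 a (by
          simp [netLoop, netStep, forEach_writesArr, markCmd, probe, lookup, follow, Cmd.writesArr,
            insertCmd, nextCmd]; omega)) ?_ ?_ ?_ ?_ ?_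
      · refine (run_relaxLoop hinj hcell hB hctx hS hm hI).mono le_rfl fun s'' hs'' => ?_
        rw [hs'']
        refine tab_congr fun u _ => ?_
        unfold gridVal
        split_ifs <;> rfl
      all_goals exact hA.1 _ (by simp [netLoop, netStep, forEach_writesReg, markCmd, probe, lookup,
            follow, Cmd.writesReg, insertCmd, nextCmd]))
  refine (Run.seq_eq (hal _ s h.rm) (Run.seq_eq (hal _ _ h.rm) (Run.seq_eq (hal _ _ h.rm)
    (Run.seq_eq (hal _ _ h.rm) h6)))).mono ?_ (fun _ => id)
  simp only [← hy, Finset.sum_add_distrib, Finset.sum_const, Finset.card_range, smul_eq_mul]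
  omega

/-- Averaged over the multiplier, each probed cell meets at most `6` stored points, because the net
has at most `m` members with pairwise different keys. -/
theorem sum_probeTime_le (hb : 0 ≤ b) (hcell : ∀ i < m, ∀ a < d, |cell S (x (w i)) a| ≤ b) (hB : 2 * b + R < B)
    (hN : 4 * m * B ^ d = N) (hm : 0 < m) {k c i : ℕ} (hk : k ≤ R) (hi : i < m) :
    ∑ r ∈ Finset.range N, probeTime m N r (fun i => x (w i)) S B k c i ≤
      N * ((offsets d k).length * (c + 4 * d + 151) + 1) := by
  set y := fun i => x (w i) with hy
  have hB0 : (0 : ℤ) < B := lt_of_le_of_lt (by positivity) hB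
  have hload : ∀ δ ∈ offsets d k, ∑ r ∈ Finset.range N, load m N r (net S y m)
      (fun u => pointKey S B (y u)) (pointKey S B (y i) + horner B δ d) ≤ 6 * N := by
    intro δ hδ
    refine sum_card_slot_le hm _ (card_net_le S y m) _ ?_ _ ?_
    · intro u hu v hv huv
      by_contra hne
      refine net_separated S y m u hu v hv hne fun a ha => ?_
      have hu' := Finset.mem_range.1 (net_subset S y m hu)
      have hv' := Finset.mem_range.1 (net_subset S y m hv)
      have := near_of_pointKey_eq' (hcell u hu') (hcell v hv') hB huv.symm a ha
      linarith
    · intro u hu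
      have hu' := Finset.mem_range.1 (net_subset S y m hu)
      have h1 : |pointKey S B (y u)| < (B : ℤ) ^ d := by
        refine abs_horner_lt hB0 fun a ha => ?_
        have h1 := hcell u hu' a ha
        have h2 := abs_nonneg (cell S (x (w u)) a)
        simp only [hy]
        linarith [Int.natCast_nonneg R]
      have h2 : |pointKey S B (y i) + horner B δ d| < (B : ℤ) ^ d := by
        unfold pointKey
        rw [horner_add]
        refine abs_horner_lt hB0 fun a ha => ?_
        have h1 := hcell i hi a ha
        have h2 := abs_nonneg (cell S (x (w i)) a)
        have h3 := abs_add_le (cell S (y i) a) (δ a)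
        have h4 := abs_le_of_mem_offsets hδ ha
        have h5 : (k : ℤ) ≤ R := by exact_mod_cast hk
        simp only [hy] at h3 ⊢
        linarith
      -- This explains the modulus: hashing requires `2m` times the key difference to be at most
      -- `N`, and `2m · 2B^d = N`.
      have h3 : (pointKey S B (y u) - (pointKey S B (y i) + horner B δ d)).natAbs ≤ 2 * B ^ d := by
        zify
        have := abs_sub (pointKey S B (y u)) (pointKey S B (y i) + horner B δ d)
        linarith
      calc _ ≤ 2 * m * (2 * B ^ d) := Nat.mul_le_mul_left _ h3
        _ = N := by rw [← hN]; ring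
  unfold probeTime
  rw [Finset.sum_add_distrib, Finset.sum_const, Finset.card_range, smul_eq_mul, mul_add N]
  refine add_le_add ?_ le_rfl
  have : ∀ Δ : List (ℕ → ℤ), (∀ δ ∈ Δ, δ ∈ offsets d k) →
      ∑ r ∈ Finset.range N, (Δ.map fun δ => c + 4 * d + 25 * load m N r (net S y m)
        (fun u => pointKey S B (y u)) (pointKey S B (y i) + horner B δ d) + 1).sum ≤
      N * (Δ.length * (c + 4 * d + 151)) := by
    intro Δ
    induction Δ with
    | nil => simp
    | cons δ Δ ih =>
      intro hΔ
      simp only [List.map_cons, List.sum_cons, Finset.sum_add_distrib, Finset.sum_const,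
        Finset.card_range, smul_eq_mul, ← Finset.mul_sum, List.length_cons] at ih ⊢
      have h1 := ih fun δ' h => hΔ δ' (by simp [h])
      have h2 := hload δ (hΔ δ (by simp))
      nlinarith
  exact this _ fun _ => id

/-- The expected time of the grid procedure, per point. -/
noncomputable def gridTime (d R : ℕ) : ℕ :=
  (sumStep d).size + (netStep d R).size + (grid d R).size + 100 +
    ((offsets d 1).length * (70 + 4 * d + 151) + 1 +
      ((offsets d R).length * (70 + (relaxCmd d 0).size + 4 * d + 151) + 1))

theorem run_grid (hact : Active x n m w s) (hinj : Set.InjOn (fun i => x (w i)) (Finset.range m))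
    (hR : 1 ≤ R) (hS : 0 < S) (hm : 2 ≤ m) (hM : s.reg rM = m) (hs : s.reg rS = S) :
    Run (grid d R) s (gridTime d R * m)
      fun s' => s'.arr (d + 2) = tab m (gridVal (fun i => x (w i)) m R S) := by
  set y := fun i => x (w i) with hy
  -- A bound for all cell indices that is computable in linear time. Its magnitude is irrelevant,
  -- since arithmetic on large numbers has unit cost.
  set β : ℕ → ℕ := fun k => 1 + ∑ i ∈ Finset.range k, ∑ a ∈ Finset.range d,
    (cell S (y i) a).natAbs * (cell S (y i) a).natAbs with hβ
  have hcell : ∀ i < m, ∀ a < d, |cell S (x (w i)) a| ≤ (β m : ℤ) := by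
    intro i hi a ha
    rw [← Int.natCast_natAbs, Int.ofNat_le]
    calc (cell S (y i) a).natAbs ≤ (cell S (y i) a).natAbs * (cell S (y i) a).natAbs :=
          Nat.le_mul_self _
      _ ≤ ∑ a ∈ Finset.range d, (cell S (y i) a).natAbs * (cell S (y i) a).natAbs :=
          Finset.single_le_sum (f := fun a => (cell S (y i) a).natAbs * (cell S (y i) a).natAbs)
            (fun _ _ => Nat.zero_le _) (Finset.mem_range.2 ha)
      _ ≤ ∑ i ∈ Finset.range m, ∑ a ∈ Finset.range d,
            (cell S (y i) a).natAbs * (cell S (y i) a).natAbs :=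
          Finset.single_le_sum (f := fun i => ∑ a ∈ Finset.range d,
            (cell S (y i) a).natAbs * (cell S (y i) a).natAbs)
            (fun _ _ => Nat.zero_le _) (Finset.mem_range.2 hi)
      _ ≤ β m := by simp only [hβ]; omega
  obtain ⟨B, hBdef⟩ : ∃ B, B = 2 * β m + (R + 1) := ⟨_, rfl⟩
  obtain ⟨N, hN⟩ : ∃ N, 4 * m * B ^ d = N := ⟨_, rfl⟩
  have hB : 2 * (β m : ℤ) + R < B := by rw [hBdef]; push_cast; omega
  have hB0 : 0 < B := by omega
  have hN0 : 0 < N := by rw [← hN]; positivity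
  -- the sum of the squared cell indices
  have hsum : ∀ s₁ : State, Active x n m w s₁ → s₁.reg rM = m → s₁.reg rS = S →
      s₁.reg rB = 1 → s₁.reg rI = 0 →
      Run (.loop (.lt (.var rI) (.var rM)) (sumStep d)) s₁
        (∑ _i ∈ Finset.range m, ((sumStep d).size + 4) + 4) fun s' => s'.reg rB = β m := by
    intro s₁ hact₁ hM₁ hs₁ hB₁ hI₁
    refine (Run.for_loop_agree m (fun i s' => s'.reg rI = i ∧ s'.reg rB = β i)
      (fun _ => (sumStep d).size) (fun i s h => h.1) hM₁
      (by simp [sumStep, nextCmd, Cmd.writesReg]) (fun i hi s' hA hI => ?_)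
      (by simp [hβ, hB₁, hI₁])).mono le_rfl (fun _ h => h.2)
    have ha : s'.arr = s₁.arr := funext fun a => hA.2 a (by simp [sumStep, nextCmd, Cmd.writesArr])
    have h7 : s'.reg rS = S := (hA.1 _ (by simp [sumStep, nextCmd, Cmd.writesReg])).trans hs₁
    have hsq := eval_cellSqE (hact₁.congr (s' := s') fun a _ => by rw [ha]) hi hI.1 le_rfl
    refine Run.of_simple (by simp [sumStep, nextCmd, Cmd.Simple]) ?_
    simp only [sumStep, nextCmd, Cmd.exec, Expr.eval, hsq, h7, setReg_reg, hI.1, hI.2]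
    refine ⟨by simp, ?_⟩
    simp only [hβ, Finset.sum_range_succ]
    push_cast
    simp only [hy, Nat.cast_natAbs, ← Int.cast_mul, abs_mul_abs_self, add_assoc]
  set s₂ := (s.setReg rB 1).setReg rI 0 with hs₂
  have hact₂ : Active x n m w s₂ := hact.congr fun a _ => rfl
  have h3 := (hsum s₂ hact₂ (by simpa [hs₂] using hM) (by simpa [hs₂] using hs) (by simp [hs₂])
    (by simp [hs₂])).frame
  have h4 := Run.seq h3 (d := .seq (.assign rB (.add (.mul (.const 2) (.var rB)) (.const (R + 1))))
        (.seq (.assign rN (.mul (.mul (.const 4) (.var rM)) (powE d)))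
          (.seq (.rand rR (.sub (.var rN) (.const 1))) (gridPasses d R))))
    (T₂ := (2 + (Expr.add (.mul (.const 2) (.var rB)) (.const (R + 1))).ops) +
      ((2 + (Expr.mul (.mul (.const 4) (.var rM)) (powE d)).ops) +
      (2 + (Expr.sub (.var rN) (.const 1)).ops + (m * (((netStep d R).size + 24) +
        (((offsets d 1).length * (70 + 4 * d + 151) + 1) +
          ((offsets d R).length * (70 + (relaxCmd d 0).size + 4 * d + 151) + 1))) + 4 * m + 40))))
    (Q := fun s' => s'.arr (d + 2) = tab m (gridVal y m R S)) ?_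
  · refine (Run.seq_assign (s' := s.setReg rB 1) (by simp [Expr.eval])
      (Run.seq_assign (s' := s₂) (by simp [Expr.eval, hs₂]) h4)).mono ?_ (fun _ => id)
    simp only [gridTime, grid, Cmd.size, Test.ops, Expr.ops, Finset.sum_const, Finset.card_range,
      smul_eq_mul]
    nlinarith
  · rintro s₃ ⟨h11, hA⟩
    have hr : ∀ a, a ≠ rB → a ≠ rI → s₃.reg a = s.reg a := fun a h1 h2 =>
      (hA.1 a (by simp [sumStep, nextCmd, Cmd.writesReg, h1, h2])).trans (by simp [hs₂, h1, h2])
    have ha : ∀ a, s₃.arr a = s.arr a := fun a =>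
      hA.2 a (by simp [sumStep, nextCmd, Cmd.writesArr])
    refine Run.seq_assign (s' := s₃.setReg rB B) ?_
      (Run.seq_assign (s' := (s₃.setReg rB B).setReg rN N) ?_
        (Run.seq_rand (N := N) ?_ (fun r hr' => run_gridPasses (n := n) (N := N) (r := r) hinj hcell hB hR ?_ hS hm) ?_))
    · simp only [Expr.eval, h11, hBdef]; push_cast; rfl
    · simp only [Expr.eval, eval_powE]
      simp [← hN, hr, hM]
    · simp only [Expr.eval, setReg_reg, if_true, Int.cast_one]
      rw [← Nat.cast_one, ← Nat.cast_sub hN0, Nat.floor_natCast]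
      omega
    · exact ⟨hact.congr fun a _ => ha a, by simp [hr, hM], by simp [hr, hs], by simp, by simp,
        by simp⟩
    · rw [Finset.sum_add_distrib, Finset.sum_add_distrib, Finset.sum_comm]
      simp only [Finset.sum_add_distrib, Finset.sum_const, Finset.card_range, smul_eq_mul]
      have hp : ∀ k c, k ≤ R → ∑ i ∈ Finset.range m, ∑ r ∈ Finset.range N,
          probeTime m N r y S B k c i ≤
          m * (N * ((offsets d k).length * (c + 4 * d + 151) + 1)) := by
        intro k c hk
        refine (Finset.sum_le_card_nsmul _ _ _ fun i hi => sum_probeTime_le (by positivity) hcell hB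
          hN (by omega) hk (Finset.mem_range.1 hi)).trans ?_
        simp
      have p1 := hp 1 70 hR
      have p2 := hp R (70 + (relaxCmd d 0).size) le_rfl
      nlinarith

end GridRun

/-! ### Which distances a grid resolves -/

section GridVal

variable {d m R : ℕ} {y : ℕ → EuclideanSpace ℝ (Fin d)} {S t : ℝ} {u : ℕ}

theorem nnd_le_of_not_mem_net (hS : 0 < S) (hu : u < m) (h : u ∉ net S y m) :
    nnd y (Finset.range m) u ≤ 2 * d * S := by
  obtain ⟨v, hv, hn⟩ := net_covers S y m u hu h
  exact (nnd_le (net_subset S y m hv) fun hvu : v = u => h (hvu ▸ hv)).trans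
    (dist_le_of_near hS hn)

/-- Points outside the net carry the value `0`, but their true distance is at most `2dS`, hence also
below `t`; the cutoff `RS` is not below `t`. So the test against `t` is faithful. -/
theorem le_gridVal_iff (hS : 0 < S) (hu : u < m) (h1 : 2 * d * S < t) (h2 : t ≤ R * S) :
    t ≤ gridVal y m R S u ↔ t ≤ nnd y (Finset.range m) u := by
  unfold gridVal
  split_ifs with h
  · simp [h2]
  · have h3 := nnd_le_of_not_mem_net hS hu h
    have : 0 ≤ 2 * d * S := by positivity
    constructor <;> intro <;> linarith

theorem lt_gridVal_iff (hS : 0 < S) (hu : u < m) (h1 : 2 * d * S ≤ t) (h2 : t < R * S) :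
    t < gridVal y m R S u ↔ t < nnd y (Finset.range m) u := by
  unfold gridVal
  split_ifs with h
  · simp [h2]
  · have h3 := nnd_le_of_not_mem_net hS hu h
    have : 0 ≤ 2 * d * S := by positivity
    constructor <;> intro <;> linarith

theorem nnd_pos (hm : 2 ≤ m) (hinj : Set.InjOn y (Finset.range m)) (hu : u < m) :
    0 < nnd y (Finset.range m) u := by
  obtain ⟨v, hv, hvu, h⟩ := exists_eq_nnd (x := y) (S := Finset.range m) (by simpa) u
  rw [h]
  exact dist_pos.2 fun he => hvu (hinj hv (by simpa using hu) he.symm)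

/-- Lets the program read membership in the net from the array of distances. -/
theorem gridVal_pos_iff (hS : 0 < S) (hR : 1 ≤ R) (hm : 2 ≤ m)
    (hinj : Set.InjOn y (Finset.range m)) (hu : u < m) :
    0 < gridVal y m R S u ↔ u ∈ net S y m := by
  unfold gridVal
  split_ifs with h
  · have : (0 : ℝ) < R := by exact_mod_cast hR
    simp only [h, iff_true, lt_min_iff]
    exact ⟨by positivity, nnd_pos hm hinj hu⟩
  · simp [h]

end GridVal

theorem grid_writesReg {d R a : ℕ} (h : (grid d R).writesReg a) :
    a = rI ∨ a = rD ∨ (rB ≤ a ∧ a ≤ rF) := by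
  simp [grid, gridPasses, sumStep, netLoop, netStep, relaxLoop, relaxStep, relaxCmd,
    forEach_writesReg, markCmd, probe, lookup, follow, Cmd.writesReg, insertCmd, nextCmd] at h
  omega

theorem grid_writesArr {d R a : ℕ} (h : (grid d R).writesArr a) : d + 2 ≤ a := by
  simp [grid, gridPasses, sumStep, netLoop, netStep, relaxLoop, relaxStep, relaxCmd,
    forEach_writesArr, markCmd, probe, lookup, follow, Cmd.writesArr, insertCmd, nextCmd] at h
  omega

/-! ## Counting -/

/-- Register `rC` := the sum of `e` over the positions that satisfy `b`. -/
def countCmd (b : Test) (e : Expr) : Cmd :=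
  .seq (.assign rC (.const 0)) (.seq (.assign rI (.const 0))
    (.loop (.lt (.var rI) (.var rM)) (.seq (.ite b (.assign rC (.add (.var rC) e)) .skip) nextCmd)))

theorem countCmd_writesReg {b : Test} {e : Expr} {a : ℕ} (h : (countCmd b e).writesReg a) :
    a = rI ∨ a = rC := by
  simp [countCmd, nextCmd, Cmd.writesReg] at h
  omega

theorem countCmd_writesArr {b : Test} {e : Expr} {a : ℕ} : ¬ (countCmd b e).writesArr a := by
  simp [countCmd, nextCmd, Cmd.writesArr]

open Classical in
theorem run_count {b : Test} {e : Expr} {m : ℕ} {s : State} (hM : s.reg rM = m) (keep : ℕ → Prop)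
    (val : ℕ → ℕ) (hb : ∀ i : ℕ, i < m → ∀ s' : State, (∀ a, a ≠ rC → a ≠ rI → s'.reg a = s.reg a) →
      s'.arr = s.arr → s'.reg rI = (i : ℝ) → (b.holds s' ↔ keep i) ∧ e.eval s' = val i) :
    Run (countCmd b e) s ((countCmd b e).size * m + (countCmd b e).size + 4)
      fun s' => s'.reg rC = (∑ i ∈ (Finset.range m).filter keep, val i : ℕ) := by
  set body : Cmd := .seq (.ite b (.assign rC (.add (.var rC) e)) .skip) nextCmd with hbody
  have hl : Run (.loop (.lt (.var rI) (.var rM)) body) ((s.setReg rC 0).setReg rI 0)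
      (∑ i ∈ Finset.range m, (body.size + 4) + 4)
      fun s' => s'.reg rI = m ∧ s'.reg rC = (∑ i ∈ (Finset.range m).filter keep, val i : ℕ) := by
    refine Run.for_loop_agree m (fun i s' => s'.reg rI = i ∧
      s'.reg rC = (∑ i ∈ (Finset.range i).filter keep, val i : ℕ)) _ (fun i s h => h.1)
      (by simp [hM]) (by simp [hbody, nextCmd, Cmd.writesReg]) (fun i hi s' hA hI => ?_) (by simp)
    have hs' := hb i hi s' (fun a h1 h2 => (hA.1 a (by simp [hbody, nextCmd, Cmd.writesReg, h1, h2])).trans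
      (by simp [h1, h2])) (funext fun a => hA.2 a (by simp [hbody, nextCmd, Cmd.writesArr])) hI.1
    refine Run.of_simple (by simp [hbody, nextCmd, Cmd.Simple]) ?_
    simp only [hbody, nextCmd, Cmd.exec, Expr.eval, hs'.1, hs'.2, Finset.range_add_one,
      Finset.filter_insert]
    split_ifs with hk
    · rw [Finset.sum_insert (by simp)]
      simp [hI.1, hI.2, add_comm]
    · simp [hI.1, hI.2]
  refine (Run.seq_assign (s' := s.setReg rC 0) (by simp [Expr.eval])
    (Run.seq_assign (s' := (s.setReg rC 0).setReg rI 0) (by simp [Expr.eval]) hl)).mono ?_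
    fun s' h => h.2
  simp only [countCmd, ← hbody, Cmd.size, Expr.ops, Test.ops, Finset.sum_const, Finset.card_range,
    smul_eq_mul]
  nlinarith

/-! ## Deleting entries -/

/-- Keep only the entries of array `a`, among the first `rM`, whose position satisfies `b`; `rM` :=
their number. -/
def compactCmd (a : ℕ) (b : Test) : Cmd :=
  .seq (.assign rC (.const 0)) (.seq (.assign rI (.const 0))
    (.seq (.loop (.lt (.var rI) (.var rM))
      (.seq (.ite b (.seq (.store a (.var rC) (.get a (.var rI)))
        (.assign rC (.add (.var rC) (.const 1)))) .skip) nextCmd))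
      (.assign rM (.var rC))))

theorem compactCmd_writesReg {a : ℕ} {b : Test} {x : ℕ} (h : (compactCmd a b).writesReg x) :
    x = rI ∨ x = rC ∨ x = rM := by
  simp [compactCmd, nextCmd, Cmd.writesReg] at h
  omega

theorem compactCmd_writesArr {a : ℕ} {b : Test} {x : ℕ} (h : (compactCmd a b).writesArr x) :
    x = a := by
  simpa [compactCmd, nextCmd, Cmd.writesArr] using h

-- Compaction works in place: the write position never overtakes the read position, so entries not
-- yet read are intact. The test may therefore consult the very array that is being compacted.
open Classical in
theorem run_compact {a L m : ℕ} {b : Test} {s : State} {f : ℕ → ℝ} (hM : s.reg rM = m)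
    (hmL : m ≤ L) (ha : s.arr a = tab L f) (keep : ℕ → Prop)
    (hb : ∀ i : ℕ, i < m → ∀ s' : State, (∀ x, x ≠ rC → x ≠ rI → s'.reg x = s.reg x) →
      (∀ x, x ≠ a → s'.arr x = s.arr x) → s'.reg rI = (i : ℝ) →
      (∃ g, s'.arr a = tab L g ∧ g i = f i) → (b.holds s' ↔ keep i)) :
    Run (compactCmd a b) s ((compactCmd a b).size * m + (compactCmd a b).size + 8)
      fun s' => ∃ (e : ℕ → ℕ) (m' : ℕ), s'.reg rM = m' ∧ s'.arr a = tab L (fun i => f (e i)) ∧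
        Set.InjOn e (Finset.range m') ∧
        (Finset.range m').image e = (Finset.range m).filter keep := by
  set body : Cmd := .seq (.ite b (.seq (.store a (.var rC) (.get a (.var rI)))
        (.assign rC (.add (.var rC) (.const 1)))) .skip) nextCmd with hbody
  have hl : Run (.loop (.lt (.var rI) (.var rM)) body) ((s.setReg rC 0).setReg rI 0)
      (∑ i ∈ Finset.range m, (body.size + 4) + 4)
      fun s' => s'.reg rI = m ∧ ∃ (e : ℕ → ℕ) (c : ℕ), s'.reg rC = c ∧ c ≤ m ∧
        s'.arr a = tab L (fun i => f (e i)) ∧ (∀ k, m ≤ k → e k = k) ∧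
        Set.InjOn e (Finset.range c) ∧
        (Finset.range c).image e = (Finset.range m).filter keep := by
    refine Run.for_loop_agree m (fun i s' => s'.reg rI = i ∧ ∃ (e : ℕ → ℕ) (c : ℕ),
        s'.reg rC = c ∧ c ≤ i ∧
        s'.arr a = tab L (fun i => f (e i)) ∧ (∀ k, i ≤ k → e k = k) ∧
        Set.InjOn e (Finset.range c) ∧
        (Finset.range c).image e = (Finset.range i).filter keep) _ (fun i s h => h.1)
      (by simp [hM]) (by simp [hbody, nextCmd, Cmd.writesReg]) (fun i hi s' hA hI => ?_)
      ⟨by simp, id, 0, by simp [ha]⟩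
    obtain ⟨h8, e, c, hc, hci, harr, htail, hinj, himg⟩ := hI
    have hs' := hb i hi s' (fun x h1 h2 =>
      (hA.1 x (by simp [hbody, nextCmd, Cmd.writesReg, h1, h2])).trans (by simp [h1, h2]))
      (fun x hx => hA.2 x (by simp [hbody, nextCmd, Cmd.writesArr, hx])) h8
      ⟨_, harr, by simp [htail i le_rfl]⟩
    refine Run.of_simple (by simp [hbody, nextCmd, Cmd.Simple]) ?_
    simp only [hbody, nextCmd, Cmd.exec, Expr.eval, hs']
    split_ifs with hk
    · refine ⟨by simp [h8], Function.update e c i, c + 1, by simp [hc], by omega, ?_, ?_, ?_, ?_⟩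
      · simp only [hc, h8, Nat.floor_natCast, harr, tab_getD _ (hi.trans_le hmL),
          htail i le_rfl, tab_set, setReg_arr, setArr_arr, if_true]
        refine tab_congr fun k _ => ?_
        by_cases hkc : k = c
        · subst hkc; simp
        · simp [hkc]
      · intro k hk
        rw [Function.update_of_ne (by omega), htail k (by omega)]
      · have hne : ∀ k < c, e k ≠ i := by
          intro k hkc hki
          have : e k ∈ (Finset.range i).filter keep := by
            rw [← himg]; exact Finset.mem_image_of_mem _ (Finset.mem_range.2 hkc)
          rw [hki] at this
          simp at this
        intro k hk k' hk' hkk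
        simp only [Finset.coe_range, Set.mem_Iio] at hk hk'
        by_cases h1 : k = c <;> by_cases h2 : k' = c
        · rw [h1, h2]
        · rw [h1, Function.update_self, Function.update_of_ne h2] at hkk
          exact absurd hkk.symm (hne k' (by omega))
        · rw [h2, Function.update_self, Function.update_of_ne h1] at hkk
          exact absurd hkk (hne k (by omega))
        · rw [Function.update_of_ne h1, Function.update_of_ne h2] at hkk
          exact hinj (by simpa using (by omega : k < c)) (by simpa using (by omega : k' < c)) hkk
      · rw [Finset.range_add_one, Finset.image_insert, Function.update_self, Finset.range_add_one,
          Finset.filter_insert, if_pos hk, ← himg]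
        congr 1
        refine Finset.image_congr fun k hk => ?_
        have : k < c := by simpa using hk
        rw [Function.update_of_ne (by omega)]
    · refine ⟨by simp [h8], e, c, by simp [hc], by omega, by simpa using harr,
        fun k hk => htail k (by omega), hinj, ?_⟩
      rw [Finset.range_add_one, Finset.filter_insert, if_neg hk, himg]
  refine (Run.seq_assign (s' := s.setReg rC 0) (by simp [Expr.eval])
    (Run.seq_assign (s' := (s.setReg rC 0).setReg rI 0) (by simp [Expr.eval])
    (Run.seq hl (T₂ := 1 + (Expr.var rC).ops) fun s' hs' => Run.assign (Q := fun s' =>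
      ∃ (e : ℕ → ℕ) (m' : ℕ), s'.reg rM = m' ∧ s'.arr a = tab L (fun i => f (e i)) ∧
        Set.InjOn e (Finset.range m') ∧
        (Finset.range m').image e = (Finset.range m).filter keep) ?_))).mono ?_
    fun s' h => h
  · obtain ⟨-, e, c, hc, -, harr, -, hinj, himg⟩ := hs'
    exact ⟨e, c, by simp [Expr.eval, hc], by simpa using harr, hinj, himg⟩
  · simp only [compactCmd, ← hbody, Cmd.size, Expr.ops, Test.ops, Finset.sum_const,
      Finset.card_range, smul_eq_mul]
    nlinarith

/-! ## The nearest neighbour of the pivot -/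

/-- Register `rL` := distance of the active point at position `rP` to its nearest neighbour. -/
def pivotCmd (d : ℕ) : Cmd :=
  .seq (.assign rL (.add (distE d (.var rP) (.const 0)) (distE d (.var rP) (.const 1))))
    (.seq (.assign rI (.const 0))
      (.loop (.lt (.var rI) (.var rM))
        (.seq (.assign rD (distE d (.var rP) (.var rI)))
          (.seq (.ite (.lt (.const 0) (.var rD))
            (.ite (.lt (.var rD) (.var rL)) (.assign rL (.var rD)) .skip) .skip) nextCmd))))

theorem pivotCmd_writesReg {d x : ℕ} (h : (pivotCmd d).writesReg x) :
    x = rI ∨ x = rD ∨ x = rL := by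
  simp [pivotCmd, nextCmd, Cmd.writesReg] at h
  omega

theorem pivotCmd_writesArr {d x : ℕ} : ¬ (pivotCmd d).writesArr x := by
  simp [pivotCmd, nextCmd, Cmd.writesArr]

theorem run_pivot {d n m p : ℕ} {x : ℕ → EuclideanSpace ℝ (Fin d)} {w : ℕ → ℕ} {s : State}
    (hact : Active x n m w s) (hinj : Set.InjOn (fun i => x (w i)) (Finset.range m)) (hm : 2 ≤ m)
    (hM : s.reg rM = m) (hp : p < m) (hP : s.reg rP = p) :
    Run (pivotCmd d) s ((pivotCmd d).size * m + (pivotCmd d).size + 4)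
      fun s' => s'.reg rL = nnd (fun i => x (w i)) (Finset.range m) p := by
  set y := fun i => x (w i) with hy
  set body : Cmd := .seq (.assign rD (distE d (.var rP) (.var rI)))
          (.seq (.ite (.lt (.const 0) (.var rD))
            (.ite (.lt (.var rD) (.var rL)) (.assign rL (.var rD)) .skip) .skip) nextCmd) with hbody
  -- At least one of the positions `0` and `1` differs from `p`, so the sum is a valid initial upper
  -- bound whichever it is.
  obtain ⟨ℓ₀, hℓ₀⟩ : ∃ ℓ₀, ℓ₀ = dist (y p) (y 0) + dist (y p) (y 1) := ⟨_, rfl⟩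
  have hge : nnd y (Finset.range m) p ≤ ℓ₀ := by
    have h0 := dist_nonneg (x := y p) (y := y 0)
    have h1 := dist_nonneg (x := y p) (y := y 1)
    by_cases hp0 : (0 : ℕ) = p
    · have := nnd_le (x := y) (S := Finset.range m) (i := p) (j := 1) (by simp; omega) (by omega)
      linarith
    · have := nnd_le (x := y) (S := Finset.range m) (i := p) (j := 0) (by simp; omega) hp0
      linarith
  have hl : Run (.loop (.lt (.var rI) (.var rM)) body) ((s.setReg rL ℓ₀).setReg rI 0)
      (∑ i ∈ Finset.range m, (body.size + 4) + 4)
      fun s' => s'.reg rI = m ∧ nnd y (Finset.range m) p ≤ s'.reg rL ∧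
        ∀ j < m, j ≠ p → s'.reg rL ≤ dist (y p) (y j) := by
    refine Run.for_loop_agree m (fun i s' => s'.reg rI = i ∧ nnd y (Finset.range m) p ≤ s'.reg rL ∧
        ∀ j < i, j ≠ p → s'.reg rL ≤ dist (y p) (y j)) _ (fun i s h => h.1)
      (by simp [hM]) (by simp [hbody, nextCmd, Cmd.writesReg]) (fun i hi s' hA hI => ?_)
      ⟨by simp, by simpa using hge, by simp⟩
    obtain ⟨h8, h1, h2⟩ := hI
    have h5 : s'.reg rP = p := (hA.1 _ (by simp [hbody, nextCmd, Cmd.writesReg])).trans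
      (by simpa using hP)
    have hdist : (distE d (.var rP) (.var rI)).eval s' = dist (y p) (y i) :=
      eval_distE (hact.congr (s' := s') fun a _ => hA.2 a
        (by simp [hbody, nextCmd, Cmd.writesArr])) hp hi (e := .var rP) (f := .var rI)
        (by simp [Expr.eval, h5]) (by simp [Expr.eval, h8])
    refine Run.of_simple (by simp [hbody, nextCmd, Cmd.Simple]) ?_
    have hstep : ∀ v : ℝ, nnd y (Finset.range m) p ≤ v → v ≤ s'.reg rL →
        (i ≠ p → v ≤ dist (y p) (y i)) →
        nnd y (Finset.range m) p ≤ v ∧ ∀ j < i + 1, j ≠ p → v ≤ dist (y p) (y j) := by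
      intro v e1 e2 e3
      refine ⟨e1, fun j hj hjp => ?_⟩
      rcases Nat.lt_succ_iff_lt_or_eq.1 hj with hj | rfl
      · exact e2.trans (h2 j hj hjp)
      · exact e3 hjp
    have hres : ∀ v : ℝ, body.exec s' = ((s'.setReg rD (dist (y p) (y i))).setReg rL v).setReg rI
        ((i : ℝ) + 1) ∨ (body.exec s' = (s'.setReg rD (dist (y p) (y i))).setReg rI
        ((i : ℝ) + 1) ∧ v = s'.reg rL) → nnd y (Finset.range m) p ≤ v → v ≤ s'.reg rL →
        (i ≠ p → v ≤ dist (y p) (y i)) → (body.exec s').reg rI = (i + 1 : ℕ) ∧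
          nnd y (Finset.range m) p ≤ (body.exec s').reg rL ∧
          ∀ j < i + 1, j ≠ p → (body.exec s').reg rL ≤ dist (y p) (y j) := by
      intro v hv e1 e2 e3
      have h6 : (body.exec s').reg rL = v := by
        rcases hv with hv | ⟨hv, hv'⟩ <;> rw [hv]
        · simp
        · simp [hv']
      rw [h6]
      exact ⟨by rcases hv with hv | ⟨hv, hv'⟩ <;> rw [hv] <;> simp, hstep v e1 e2 e3⟩
    by_cases c1 : 0 < dist (y p) (y i)
    · have hip : i ≠ p := fun hip => by rw [hip, dist_self] at c1; exact lt_irrefl _ c1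
      by_cases c2 : dist (y p) (y i) < s'.reg rL
      · refine hres _ (Or.inl ?_) (nnd_le (by simpa using hi) hip) c2.le (fun _ => le_rfl)
        simp [hbody, nextCmd, Cmd.exec, Expr.eval, hdist, Test.holds, c1, c2, h8]
      · refine hres _ (Or.inr ⟨?_, rfl⟩) h1 le_rfl (fun _ => not_lt.1 c2)
        simp [hbody, nextCmd, Cmd.exec, Expr.eval, hdist, Test.holds, c1, c2, h8]
    · refine hres _ (Or.inr ⟨?_, rfl⟩) h1 le_rfl fun hip => absurd (dist_pos.2 fun he => hip ?_) c1
      · simp only [hbody, nextCmd, Cmd.exec, Expr.eval, hdist, Test.holds, setReg_reg, if_true,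
          Int.cast_zero, c1, if_false]
        simp [h8, hy]
      · exact (hinj (by simpa using hp) (by simpa using hi) he).symm
  have e0 : (Expr.add (distE d (.var rP) (.const 0)) (distE d (.var rP) (.const 1))).eval s =
      ℓ₀ := by
    rw [Expr.eval, eval_distE hact hp (by omega : 0 < m) (by simp [Expr.eval, hP])
      (by simp [Expr.eval]), eval_distE hact hp (by omega : 1 < m) (by simp [Expr.eval, hP])
      (by simp [Expr.eval]), hℓ₀]
  refine (Run.seq_assign (s' := s.setReg rL ℓ₀) (by rw [e0])
    (Run.seq_assign (s' := (s.setReg rL ℓ₀).setReg rI 0) (by simp [Expr.eval]) hl)).mono ?_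
    fun s' h => ?_
  · simp only [pivotCmd, ← hbody, Cmd.size, Expr.ops, Test.ops, Finset.sum_const,
      Finset.card_range, smul_eq_mul]
    nlinarith
  · obtain ⟨-, h1, h2⟩ := h
    refine le_antisymm ?_ h1
    obtain ⟨j, hj, hjp, he⟩ := exists_eq_nnd (x := y) (S := Finset.range m) (by simpa) p
    rw [he]
    exact h2 j (Finset.mem_range.1 hj) hjp

/-! ## Flags -/

/-- Clear the flags of the active points with a value of at most twice `d` times the side. -/
def unflagCmd (d : ℕ) : Cmd :=
  .seq (.assign rI (.const 0)) (.loop (.lt (.var rI) (.var rM))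
    (.seq (.ite (.le (.get (d + 2) (.var rI)) (.mul (.const (2 * d)) (.var rS)))
      (.store (d + 1) (.get d (.var rI)) (.const 0)) .skip) nextCmd))

theorem unflagCmd_writesReg {d x : ℕ} (h : (unflagCmd d).writesReg x) : x = rI := by
  simpa [unflagCmd, nextCmd, Cmd.writesReg] using h

theorem unflagCmd_writesArr {d x : ℕ} (h : (unflagCmd d).writesArr x) : x = d + 1 := by
  simpa [unflagCmd, nextCmd, Cmd.writesArr] using h

/-- The indicator function of a set of indices. -/
noncomputable def indic (A : Finset ℕ) (q : ℕ) : ℕ := if q ∈ A then 1 else 0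

theorem run_unflag {d n m : ℕ} {x : ℕ → EuclideanSpace ℝ (Fin d)} {w : ℕ → ℕ} {s : State}
    {V : ℕ → ℝ} {A : Finset ℕ} (hact : Active x n m w s) (hM : s.reg rM = m)
    (hV : s.arr (d + 2) = tab m V) (hA : s.arr (d + 1) = tab n fun q => (indic A q : ℝ)) :
    Run (unflagCmd d) s ((unflagCmd d).size * m + (unflagCmd d).size + 4)
      fun s' => s'.arr (d + 1) = tab n fun q =>
        (indic (A.filter fun q => ∀ k < m, w k = q → 2 * d * s.reg rS < V k) q : ℝ) := by
  set body : Cmd := .seq (.ite (.le (.get (d + 2) (.var rI)) (.mul (.const (2 * d)) (.var rS)))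
      (.store (d + 1) (.get d (.var rI)) (.const 0)) .skip) nextCmd with hbody
  have hl : Run (.loop (.lt (.var rI) (.var rM)) body) (s.setReg rI 0)
      (∑ i ∈ Finset.range m, (body.size + 4) + 4)
      fun s' => s'.reg rI = m ∧ s'.arr (d + 1) = tab n fun q =>
        (indic (A.filter fun q => ∀ k < m, w k = q → 2 * d * s.reg rS < V k) q : ℝ) := by
    refine Run.for_loop_agree m (fun i s' => s'.reg rI = i ∧ s'.arr (d + 1) = tab n fun q =>
        (indic (A.filter fun q => ∀ k < i, w k = q → 2 * d * s.reg rS < V k) q : ℝ)) _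
      (fun i s h => h.1)
      (by simp [hM]) (by simp [hbody, nextCmd, Cmd.writesReg]) (fun i hi s' hA' hI => ?_)
      ⟨by simp, by simpa using hA⟩
    obtain ⟨h8, h1⟩ := hI
    have h7 : s'.reg rS = s.reg rS := (hA'.1 _ (by simp [hbody, nextCmd, Cmd.writesReg])).trans
      (by simp)
    have a2 : s'.arr (d + 2) = tab m V := (hA'.2 _ (by simp [hbody, nextCmd, Cmd.writesArr])).trans
      (by simpa using hV)
    have a0 : s'.arr d = tab n fun i => (w i : ℝ) :=
      (hA'.2 _ (by simp [hbody, nextCmd, Cmd.writesArr])).trans (by simpa using hact.arr)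
    refine Run.of_simple (by simp [hbody, nextCmd, Cmd.Simple]) ?_
    simp only [hbody, nextCmd, Cmd.exec, Expr.eval, Test.holds, h8, h7, a2, a0, Nat.floor_natCast,
      tab_getD _ hi, tab_getD _ (hi.trans_le hact.le)]
    push_cast
    split_ifs with c
    · refine ⟨by simp [h8], ?_⟩
      simp only [setReg_arr, setArr_arr, if_true, h1, tab_set]
      refine tab_congr fun q _ => ?_
      by_cases hq : q = w i
      · subst hq
        have : ¬ ∀ k < i + 1, w k = w i → 2 * d * s.reg rS < V k := fun hh =>
          absurd (hh i (by omega) rfl) (not_lt.2 c)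
        simp only [Function.update_self, indic, Finset.mem_filter, this, and_false, if_false,
          Nat.cast_zero]
      · rw [Function.update_of_ne hq]
        have : (∀ k < i + 1, w k = q → 2 * d * s.reg rS < V k) ↔
            ∀ k < i, w k = q → 2 * d * s.reg rS < V k := by
          refine ⟨fun hh k hk => hh k (by omega), fun hh k hk hkq => ?_⟩
          rcases Nat.lt_succ_iff_lt_or_eq.1 hk with hk | rfl
          · exact hh k hk hkq
          · exact absurd hkq.symm hq
        simp only [indic, Finset.mem_filter, this]
    · refine ⟨by simp [h8], ?_⟩
      simp only [setReg_arr, h1]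
      refine tab_congr fun q _ => ?_
      have : (∀ k < i + 1, w k = q → 2 * d * s.reg rS < V k) ↔
          ∀ k < i, w k = q → 2 * d * s.reg rS < V k := by
        refine ⟨fun hh k hk => hh k (by omega), fun hh k hk hkq => ?_⟩
        rcases Nat.lt_succ_iff_lt_or_eq.1 hk with hk | rfl
        · exact hh k hk hkq
        · exact not_le.1 c
      simp only [indic, Finset.mem_filter, this]
  refine (Run.seq_assign (s' := s.setReg rI 0) (by simp [Expr.eval]) hl).mono ?_ fun s' h => h.2
  simp only [unflagCmd, ← hbody, Cmd.size, Expr.ops, Test.ops, Finset.sum_const,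
      Finset.card_range, smul_eq_mul]
  nlinarith

/-! ## Halving by random pivots -/

/-- A round costs at most `am + c` and lowers the potential, in total over all pivots, by at least
`m²/8`; the factor `8(a + c)` makes this drop pay for the round. -/
theorem sum_pivot_le {m κ a c : ℕ} (D : ℕ → ℝ) {T g : ℕ → ℕ} (hT : ∀ p < m, T p ≤ a * m)
    (hg : ∀ p < m, g p + min ((Finset.range m).filter fun b => D p ≤ D b).card
      ((Finset.range m).filter fun b => D b ≤ D p).card ≤ κ * m) :
    ∑ p ∈ Finset.range m, (T p + 8 * (a + c) * g p + c) ≤ m * (8 * (a + c) * (κ * m)) := by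
  have h1 := sq_card_le_sum_min (Finset.range m) D
  rw [Finset.card_range] at h1
  have h2 : ∑ p ∈ Finset.range m, g p + ∑ p ∈ Finset.range m,
      min ((Finset.range m).filter fun b => D p ≤ D b).card
        ((Finset.range m).filter fun b => D b ≤ D p).card ≤ m * (κ * m) := by
    rw [← Finset.sum_add_distrib]
    simpa using Finset.sum_le_card_nsmul (Finset.range m) _ _
      fun p hp => hg p (Finset.mem_range.1 hp)
  have h3 : ∑ p ∈ Finset.range m, T p ≤ m * (a * m) := by
    simpa using Finset.sum_le_card_nsmul (Finset.range m) _ _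
      fun p hp => hT p (Finset.mem_range.1 hp)
  rw [Finset.sum_add_distrib, Finset.sum_add_distrib, ← Finset.mul_sum, Finset.sum_const,
    Finset.card_range, smul_eq_mul]
  have h4 := Nat.mul_le_mul_left (8 * (a + c)) h2
  have h5 := Nat.mul_le_mul_left (a + c) h1
  have h6 : m * c ≤ c * (m * m) := by
    rcases Nat.eq_zero_or_pos m with rfl | hm
    · simp
    · rw [mul_comm]; exact Nat.mul_le_mul_left _ (Nat.le_mul_of_pos_left _ hm)
  nlinarith

theorem sum_indic {m : ℕ} {w : ℕ → ℕ} (hw : Set.InjOn w (Finset.range m)) (A : Finset ℕ)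
    (keep Q : ℕ → Prop) [DecidablePred keep] [DecidablePred Q]
    (h : ∀ i < m, keep i ↔ Q (w i)) :
    ∑ i ∈ (Finset.range m).filter keep, indic A (w i) =
      ((((Finset.range m).image w).filter (· ∈ A)).filter Q).card := by
  have h1 : (((Finset.range m).image w).filter (· ∈ A)).filter Q =
      (((Finset.range m).filter keep).filter fun i => w i ∈ A).image w := by
    ext q
    simp only [Finset.mem_filter, Finset.mem_image, Finset.mem_range]
    constructor
    · rintro ⟨⟨⟨i, hi, rfl⟩, hA⟩, hQ⟩
      exact ⟨i, ⟨⟨hi, (h i hi).2 hQ⟩, hA⟩, rfl⟩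
    · rintro ⟨i, ⟨⟨hi, hk⟩, hA⟩, rfl⟩
      exact ⟨⟨⟨i, hi, rfl⟩, hA⟩, (h i hi).1 hk⟩
  rw [h1, Finset.card_image_of_injOn (hw.mono fun i hi => by
    simp only [Finset.coe_filter, Set.mem_ofPred_eq, Finset.mem_filter] at hi; exact hi.1.1),
    Finset.card_filter]
  rfl

/-! ### The sieve: its invariant and its two reductions -/

section Main

variable {d n m J j : ℕ} {x : ℕ → EuclideanSpace ℝ (Fin d)} {w : ℕ → ℕ} {s : State}

theorem run_compact_active {b : Test} (hact : Active x n m w s)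
    (hw : Set.InjOn w (Finset.range m)) (hm : 1 ≤ m) (hM : s.reg rM = m) (Q : ℕ → Prop)
    [DecidablePred Q]
    (hb : ∀ i < m, ∀ s' : State, (∀ a, a ≠ rC → a ≠ rI → s'.reg a = s.reg a) →
      (∀ a, a ≠ d → s'.arr a = s.arr a) → s'.reg rI = (i : ℝ) → (b.holds s' ↔ Q (w i))) :
    Run (compactCmd d b) s ((2 * (compactCmd d b).size + 8) * m)
      fun s' => (∃ m' w', Active x n m' w' s' ∧ Set.InjOn w' (Finset.range m') ∧ s'.reg rM = m' ∧
        m' = ((Finset.range m).filter fun i => Q (w i)).card ∧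
        (Finset.range m').image w' = ((Finset.range m).image w).filter Q) ∧
        Agree (compactCmd d b) s s' := by
  classical
  refine (run_compact hM hact.le hact.arr (fun i => Q (w i)) fun i hi s' h1 h2 h3 _ =>
    hb i hi s' h1 h2 h3).frame.mono ?_ ?_
  · have := Nat.le_mul_of_pos_right ((compactCmd d b).size) hm
    simp only [add_mul, mul_assoc]
    omega
  · rintro s' ⟨⟨e, m', h1, h2, h3, h4⟩, hA⟩
    replace h4 : (Finset.range m').image e = (Finset.range m).filter fun i => Q (w i) :=
      h4.trans (by congr!)
    refine ⟨⟨m', fun i => w (e i), ?_, ?_, h1, ?_, ?_⟩, hA⟩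
    · have hcard : m' ≤ m := by
        rw [← Finset.card_range m', ← Finset.card_image_of_injOn h3, h4]
        simpa using Finset.card_filter_le (Finset.range m) _
      refine ⟨fun a ha => ?_, h2, hcard.trans hact.le, fun i hi => ?_⟩
      · rw [hA.2 a fun h => ha.ne (compactCmd_writesArr h)]
        exact hact.input a ha
      · have : e i ∈ (Finset.range m).filter fun i => Q (w i) :=
          h4 ▸ Finset.mem_image_of_mem e (Finset.mem_range.2 hi)
        exact hact.lt _ (Finset.mem_range.1 (Finset.mem_filter.1 this).1)
    · refine hw.comp h3 fun i hi => ?_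
      have : e i ∈ (Finset.range m).filter fun i => Q (w i) :=
        h4 ▸ Finset.mem_image_of_mem e hi
      exact (Finset.mem_filter.1 this).1
    · rw [← Finset.card_range m', ← Finset.card_image_of_injOn h3, h4]
    · rw [show (Finset.range m').image (fun i => w (e i)) = ((Finset.range m').image e).image w from
        (Finset.image_image).symm, h4, Finset.filter_image]

/-- The state of the sieve: `m` active points, `j` of the flagged ones are sought. -/
structure Sieve (x : ℕ → EuclideanSpace ℝ (Fin d)) (n J m : ℕ) (w : ℕ → ℕ) (A : Finset ℕ) (j : ℕ)
    (s : State) : Prop where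
  act : Active x n m w s
  inj : Set.InjOn w (Finset.range m)
  flags : s.arr (d + 1) = tab n fun q => (indic A q : ℝ)
  approx : Approx x n J ((Finset.range m).image w) (((Finset.range m).image w).filter (· ∈ A)) j
  rm : s.reg rM = m
  rj : s.reg rJ = j

theorem Sieve.congr {A : Finset ℕ} {s' : State} (h : Sieve x n J m w A j s)
    (ha : ∀ a ≤ d + 1, s'.arr a = s.arr a) (hM : s'.reg rM = s.reg rM) (hJ : s'.reg rJ = s.reg rJ) :
    Sieve x n J m w A j s' where
  act := h.act.congr fun a had => ha a (by omega)
  inj := h.inj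
  flags := (ha _ le_rfl).trans h.flags
  approx := h.approx
  rm := hM.trans h.rm
  rj := hJ.trans h.rj

theorem Sieve.two_le {A : Finset ℕ} (h : Sieve x n J m w A j s) : 2 ≤ m := by
  have := h.approx.two_le
  rwa [Finset.card_image_of_injOn h.inj, Finset.card_range] at this

theorem Sieve.nnd_eq {A : Finset ℕ} (h : Sieve x n J m w A j s) {i : ℕ} (hi : i < m) :
    nnd x ((Finset.range m).image w) (w i) = nnd (fun i => x (w i)) (Finset.range m) i :=
  nnd_comp_image x w h.inj (by simpa using hi)

theorem Sieve.injOn {A : Finset ℕ} (h : Sieve x n J m w A j s)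
    (hx : Set.InjOn x (Finset.range n)) : Set.InjOn (fun i => x (w i)) (Finset.range m) :=
  hx.comp h.inj fun i hi => by simpa using h.act.lt i (by simpa using hi)

/-! ### Counting flagged points -/

def flagE (d : ℕ) : Expr := .get (d + 1) (.get d (.var rI))

theorem Sieve.run_count {A : Finset ℕ} (h : Sieve x n J m w A j s) {b : Test}
    (Q : ℕ → Prop) [DecidablePred Q]
    (hb : ∀ i < m, ∀ s' : State, (∀ a, a ≠ rC → a ≠ rI → s'.reg a = s.reg a) →
      s'.arr = s.arr → s'.reg rI = (i : ℝ) → (b.holds s' ↔ Q (w i))) :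
    Run (countCmd b (flagE d)) s ((2 * (countCmd b (flagE d)).size + 4) * m) fun s' =>
      s'.reg rC = ((((Finset.range m).image w).filter (· ∈ A)).filter Q).card ∧
        Agree (countCmd b (flagE d)) s s' := by
  classical
  refine (RealRAM.run_count h.rm (fun i => Q (w i)) (fun i => indic A (w i))
    fun i hi s' h1 h2 h3 => ⟨hb i hi s' h1 h2 h3, ?_⟩).frame.mono ?_ ?_
  · have hin := hi.trans_le h.act.le
    simp only [flagE, Expr.eval, h2, h3, Nat.floor_natCast, h.act.arr, tab_getD _ hin, h.flags,
      tab_getD _ (h.act.lt i hi)]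
  · have h2 := h.two_le
    have := Nat.le_mul_of_pos_right ((countCmd b (flagE d)).size) (show 0 < m by omega)
    simp only [add_mul, mul_assoc]
    omega
  · rintro s' ⟨h1, hA⟩
    refine ⟨?_, hA⟩
    rw [h1, ← sum_indic h.inj A (fun i => Q (w i)) Q fun _ _ => Iff.rfl]
    congr!

/-! ### Discarding the points that are far from the others -/

def pruneCmd (d : ℕ) : Cmd :=
  .seq (.assign rJ (.sub (.var rJ) (.var rC))) (compactCmd d (.lt (.get (d + 2) (.var rI)) (.var rL)))

/-- The flags need no update: candidates are the flagged points that are still active, so deleting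
points from the list also removes them as candidates. -/
theorem Sieve.run_prune {A : Finset ℕ} (h : Sieve x n J m w A j s) {ℓ : ℝ} {V : ℕ → ℝ} {c : ℕ}
    (hL : s.reg rL = ℓ) (hV : s.arr (d + 2) = tab m V)
    (hVℓ : ∀ u < m, ℓ ≤ V u ↔ ℓ ≤ nnd (fun i => x (w i)) (Finset.range m) u)
    (hC : s.reg rC = c) (hc : c = ((((Finset.range m).image w).filter (· ∈ A)).filter fun q =>
      ℓ ≤ nnd x ((Finset.range m).image w) q).card) (hcj : c < j) :
    Run (pruneCmd d) s ((2 * (pruneCmd d).size + 16) * m) fun s' =>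
      s'.reg rGo = s.reg rGo ∧ ∃ m' w' j',
        m' + ((Finset.range m).filter fun b => ℓ ≤ nnd (fun i => x (w i)) (Finset.range m) b).card
          = m ∧ Sieve x n J m' w' A j' s' := by
  have h2 := h.two_le
  set s₁ := s.setReg rJ ((j - c : ℕ) : ℝ) with hs₁
  have hr := run_compact_active (b := .lt (.get (d + 2) (.var rI)) (.var rL)) (s := s₁)
    (h.act.congr fun a _ => rfl) h.inj (by omega) (by simpa [hs₁] using h.rm)
    (fun q => nnd x ((Finset.range m).image w) q < ℓ) (fun i hi s' h1 h2 h3 => by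
      simp only [Test.holds, Expr.eval, h3, Nat.floor_natCast, h2 (d + 2) (by omega), hs₁,
        setReg_arr, hV, tab_getD _ hi, h1 rL (by decide) (by decide), setReg_reg, hL]
      rw [h.nnd_eq hi, ← not_le, ← not_le, if_neg (by decide), hVℓ i hi])
  refine (Run.seq_assign (s' := s₁) ?_ hr).mono ?_ ?_
  · simp only [Expr.eval, h.rj, hC, hs₁, Nat.cast_sub hcj.le]
  · simp only [pruneCmd, Cmd.size, Expr.ops]
    nlinarith
  · rintro s' ⟨⟨m', w', h3, h4, h5, h6, h7⟩, hA⟩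
    have hreg : ∀ a, a ≠ rI → a ≠ rC → a ≠ rM → s'.reg a = s₁.reg a := fun a e1 e2 e3 =>
      hA.1 a fun hh => by rcases compactCmd_writesReg hh with h | h | h <;> contradiction
    refine ⟨by rw [hreg _ (by decide) (by decide) (by decide)]; simp [hs₁], m', w', j - c, ?_, h3, h4,
      ?_, ?_, h5, ?_⟩
    · have := Finset.card_filter_add_card_filter_not (s := Finset.range m)
        fun b => ℓ ≤ nnd (fun i => x (w i)) (Finset.range m) b
      rw [Finset.card_range] at this
      rw [h6]
      refine Eq.trans ?_ ((add_comm _ _).trans this)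
      congr 2
      refine Finset.filter_congr fun i hi => ?_
      rw [h.nnd_eq (Finset.mem_range.1 hi), not_le]
    · rw [hA.2 _ fun hh => by have := compactCmd_writesArr hh; omega]
      simpa [hs₁] using h.flags
    · have := h.approx.prune (ℓ := ℓ) (hc ▸ hcj)
      rw [h7, Finset.filter_comm, hc]
      exact this
    · rw [hreg _ (by decide) (by decide) (by decide)]; simp [hs₁]

/-! ### Thinning out the points -/

def thinCmd (d : ℕ) : Cmd :=
  .seq (unflagCmd d) (compactCmd d (.lt (.const 0) (.get (d + 2) (.var rI))))

/-- Net points with a small distance stay active without being candidates: they represent their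
surroundings, so that the distances of the remaining candidates stay approximately right. -/
theorem Sieve.run_thin {A : Finset ℕ} (h : Sieve x n J m w A j s) {R p : ℕ} {S : ℝ}
    (hx : Set.InjOn x (Finset.range n)) (hd : 0 < d) (hp : p < m)
    (hR : 2 * d < R)
    (hS : S = 8 * d * nnd (fun i => x (w i)) (Finset.range m) p) (hrS : s.reg rS = S)
    (hV : s.arr (d + 2) = tab m (gridVal (fun i => x (w i)) m R S))
    (hc : j ≤ ((((Finset.range m).image w).filter (· ∈ A)).filter fun q =>
      2 * d * S < nnd x ((Finset.range m).image w) q).card) :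
    Run (thinCmd d) s ((2 * (thinCmd d).size + 16) * m) fun s' =>
      s'.reg rGo = s.reg rGo ∧ ∃ m' w' A',
        m' = (net S (fun i => x (w i)) m).card ∧ Sieve x n J m' w' A' j s' := by
  classical
  have h2 := h.two_le
  have hxw := h.injOn hx
  set y := fun i => x (w i) with hy
  set W := (Finset.range m).image w with hW
  have hS0 : 0 < S := by
    rw [hS]; have := nnd_pos h2 hxw hp; positivity
  have hR1 : 1 ≤ R := by omega
  have hR' : (2 * d : ℝ) < R := by exact_mod_cast hR
  have hu := (run_unflag h.act h.rm hV h.flags).frame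
  refine (Run.seq hu (T₂ := (2 * (compactCmd d (.lt (.const 0) (.get (d + 2) (.var rI)))).size + 8) * m)
    (Q := fun s' => s'.reg rGo = s.reg rGo ∧ ∃ m' w' A',
        m' = (net S y m).card ∧ Sieve x n J m' w' A' j s') ?_).mono ?_ fun _ => id
  · rintro s₁ ⟨hfl, hA₁⟩
    rw [hrS] at hfl
    have hreg₁ : ∀ a, a ≠ rI → s₁.reg a = s.reg a := fun a e1 =>
      hA₁.1 a fun hh => e1 (unflagCmd_writesReg hh)
    have harr₁ : ∀ a, a ≠ d + 1 → s₁.arr a = s.arr a := fun a e1 =>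
      hA₁.2 a fun hh => e1 (unflagCmd_writesArr hh)
    have hQ : ∀ i < m, w i ∈ (net S y m).image w ↔ i ∈ net S y m := by
      intro i hi
      simp only [Finset.mem_image]
      constructor
      · rintro ⟨k, hk, hki⟩
        rwa [← h.inj (net_subset S y m hk) (by simpa using hi) hki]
      · exact fun hh => ⟨i, hh, rfl⟩
    refine (run_compact_active (b := .lt (.const 0) (.get (d + 2) (.var rI))) (s := s₁)
      (h.act.congr fun a ha => harr₁ a (by omega)) h.inj (by omega)
      ((hreg₁ _ (by decide)).trans h.rm) (fun q => q ∈ (net S y m).image w)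
      (fun i hi s' h1 h2' h3 => ?_)).mono le_rfl ?_
    · simp only [Test.holds, Expr.eval, h3, Nat.floor_natCast, h2' (d + 2) (by omega),
        harr₁ (d + 2) (by omega), hV, tab_getD _ hi, Int.cast_zero]
      rw [gridVal_pos_iff hS0 hR1 h2 hxw hi, hQ i hi]
    · rintro s' ⟨⟨m', w', h3, h4, h5, h6, h7⟩, hA⟩
      have hreg : ∀ a, a ≠ rI → a ≠ rC → a ≠ rM → s'.reg a = s.reg a := fun a e1 e2 e3 =>
        (hA.1 a fun hh => by rcases compactCmd_writesReg hh with h | h | h <;> contradiction).trans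
          (hreg₁ a e1)
      have hK : W.filter (fun q => q ∈ (net S y m).image w) = (net S y m).image w := by
        rw [Finset.filter_mem_eq_inter, Finset.inter_eq_right]
        exact Finset.image_subset_image (net_subset S y m)
      rw [hK] at h7
      refine ⟨hreg _ (by decide) (by decide) (by decide), m', w', _, ?_, h3, h4,
        (hA.2 _ fun hh => by have := compactCmd_writesArr hh; omega).trans hfl, ?_, h5,
        (hreg _ (by decide) (by decide) (by decide)).trans h.rj⟩
      · rw [h6]
        congr 1
        ext i
        simp only [Finset.mem_filter, Finset.mem_range]
        exact ⟨fun hh => (hQ i hh.1).1 hh.2, fun hh =>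
          have hi := Finset.mem_range.1 (net_subset S y m hh); ⟨hi, (hQ i hi).2 hh⟩⟩
      · have hap := h.approx.net (K := (net S y m).image w) (p := w p) (s := S) hd
          (Finset.mem_image_of_mem w (by simpa using hp)) (by rw [hS, h.nnd_eq hp])
          (Finset.image_subset_image (net_subset S y m)) ?_ ?_ hc
        · rw [h7]
          convert hap using 1
          -- The threshold `2dS` is the lowest one that the grid resolves strictly, so clearing
          -- flags by grid values agrees with clearing them by true distances.
          have hkey : ∀ i < m, 2 * d * S < gridVal y m R S i ↔
              2 * d * S < nnd x W (w i) := by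
            intro i hi
            rw [lt_gridVal_iff hS0 hi le_rfl (by gcongr), h.nnd_eq hi]
          ext q
          simp only [Finset.mem_filter, Finset.mem_image]
          constructor
          · rintro ⟨⟨i, hi, rfl⟩, hqA, hall⟩
            have him := Finset.mem_range.1 (net_subset S y m hi)
            exact ⟨⟨⟨i, net_subset S y m hi, rfl⟩, hqA⟩,
              (hkey i him).1 (hall i him rfl)⟩
          · rintro ⟨⟨⟨i, hi, rfl⟩, hqA⟩, hlt⟩
            have him := Finset.mem_range.1 hi
            refine ⟨⟨i, ?_, rfl⟩, hqA, fun k hk hki => ?_⟩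
            · rw [← gridVal_pos_iff (R := R) hS0 hR1 h2 hxw him]
              exact lt_of_le_of_lt (by positivity) ((hkey i him).2 hlt)
            · rw [hkey k hk, hki]
              exact hlt
        · intro u hu v hv huv
          obtain ⟨a, ha, rfl⟩ := Finset.mem_image.1 hu
          obtain ⟨b, hb, rfl⟩ := Finset.mem_image.1 hv
          exact lt_dist_of_mem_net (x := y) hS0 ha hb fun hab => huv (by rw [hab])
        · intro q hq hqK
          obtain ⟨i, hi, rfl⟩ := Finset.mem_image.1 hq
          have him := Finset.mem_range.1 hi
          obtain ⟨u, hu, hn⟩ := net_covers S y m i him fun hh => hqK ((hQ i him).2 hh)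
          exact ⟨w u, Finset.mem_image_of_mem w hu, dist_le_of_near hS0 hn⟩
  · simp only [thinCmd, Cmd.size]
    nlinarith

end Main

/-! ### One round of the sieve, and its expected total cost -/

section Sieve

variable {d n m J j : ℕ} {x : ℕ → EuclideanSpace ℝ (Fin d)} {w : ℕ → ℕ} {s : State}

/-- Register `rL` holds a constant factor approximation of the sought distance. -/
def Stopped (x : ℕ → EuclideanSpace ℝ (Fin d)) (n J : ℕ) (s : State) : Prop :=
  HasInput x n s ∧ 0 < s.reg rL ∧
    J ≤ ((Finset.range n).filter fun q =>
      s.reg rL / (1 + 8 * d) ^ 2 ≤ nnd x (Finset.range n) q).card ∧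
    ((Finset.range n).filter fun q =>
      (1 + 8 * d) * (2 * d * (8 * d * s.reg rL)) < nnd x (Finset.range n) q).card < J

/-- The potential is `3 ^ d + 1` times the number of active points, because thinning is only
guaranteed to drop that fraction of the close points. After stopping, every `M` is allowed, in
particular `0`. -/
def SieveInv (x : ℕ → EuclideanSpace ℝ (Fin d)) (n J M : ℕ) (s : State) : Prop :=
  (s.reg rGo = 1 ∧ ∃ m w A j, (3 ^ d + 1) * m ≤ M ∧ Sieve x n J m w A j s) ∨
    (s.reg rGo = 0 ∧ Stopped x n J s)

noncomputable def farCmd (d R : ℕ) : Cmd :=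
  .seq (.assign rS (.mul (.const (8 * d)) (.var rL))) (.seq (grid d R)
    (.seq (countCmd (.lt (.mul (.const (2 * d)) (.var rS)) (.get (d + 2) (.var rI))) (flagE d))
      (.ite (.le (.var rJ) (.var rC)) (thinCmd d) (.assign rGo (.const 0)))))

theorem Sieve.after_grid {A : Finset ℕ} {s' : State} {R : ℕ} (h : Sieve x n J m w A j s)
    (hA : Agree (grid d R) s s') : Sieve x n J m w A j s' :=
  h.congr (fun a ha => hA.2 a fun hh => by have := grid_writesArr hh; omega)
    (hA.1 _ fun hh => by have := grid_writesReg hh; omega)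
    (hA.1 _ fun hh => by have := grid_writesReg hh; omega)

theorem Sieve.after_count {A : Finset ℕ} {s' : State} {b : Test} {e : Expr}
    (h : Sieve x n J m w A j s) (hA : Agree (countCmd b e) s s') : Sieve x n J m w A j s' :=
  h.congr (fun a _ => hA.2 a countCmd_writesArr)
    (hA.1 _ fun hh => by have := countCmd_writesReg hh; omega)
    (hA.1 _ fun hh => by have := countCmd_writesReg hh; omega)

/-- The answer is known not to be much below `ℓ`. Either at least `j` candidates exceed `16d²ℓ` and
the set can be thinned, or `ℓ` is a good approximation. -/
theorem Sieve.run_far {A : Finset ℕ} (h : Sieve x n J m w A j s) {R p : ℕ}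
    (hx : Set.InjOn x (Finset.range n)) (hd : 0 < d) (hp : p < m) (hR : 2 * d < R)
    (hGo : s.reg rGo = 1) (hL : s.reg rL = nnd (fun i => x (w i)) (Finset.range m) p)
    (hj : j ≤ ((((Finset.range m).image w).filter (· ∈ A)).filter fun q =>
      s.reg rL ≤ nnd x ((Finset.range m).image w) q).card) :
    Run (farCmd d R) s ((2 * (farCmd d R).size + gridTime d R + 50) * m) fun s' =>
      ∃ M, M + ((Finset.range m).filter fun b => nnd (fun i => x (w i)) (Finset.range m) b ≤
          nnd (fun i => x (w i)) (Finset.range m) p).card ≤ (3 ^ d + 1) * m ∧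
        SieveInv x n J M s' := by
  have h2 := h.two_le
  have hxw := h.injOn hx
  set y := fun i => x (w i) with hy
  set W := (Finset.range m).image w with hW
  obtain ⟨ℓ, hℓ⟩ : ∃ ℓ, ℓ = nnd y (Finset.range m) p := ⟨_, rfl⟩
  have hℓ0 : 0 < ℓ := hℓ ▸ nnd_pos h2 hxw hp
  obtain ⟨S, hS⟩ : ∃ S, S = 8 * d * ℓ := ⟨_, rfl⟩
  have hd1 : (1 : ℝ) ≤ d := by exact_mod_cast hd
  have hS0 : 0 < S := by rw [hS]; positivity
  have hR' : (2 * d : ℝ) < R := by exact_mod_cast hR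
  rw [← hℓ] at hL ⊢
  rw [hL] at hj
  set D := (Finset.range m).filter fun b => nnd y (Finset.range m) b ≤ ℓ with hD
  set b : Test := .lt (.mul (.const (2 * d)) (.var rS)) (.get (d + 2) (.var rI)) with hb
  set s₁ := s.setReg rS S with hs₁
  have h₁ : Sieve x n J m w A j s₁ := h.congr (fun a _ => rfl) (by simp [hs₁]) (by simp [hs₁])
  refine (Run.seq_assign (s' := s₁) (by simp [Expr.eval, hL, hS, hs₁]) (Run.seq
    (run_grid h₁.act hxw (by omega : 1 ≤ R) hS0 h2 h₁.rm (by simp [hs₁])).frame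
    (T₂ := 1 + (2 * (countCmd b (flagE d)).size + 4) * m +
      (1 + (Test.le (.var rJ) (.var rC)).ops + ((2 * (thinCmd d).size + 16) * m + 2)))
    (Q := fun s' => ∃ M, M + D.card ≤ (3 ^ d + 1) * m ∧ SieveInv x n J M s') ?_)).mono ?_ fun _ => id
  · rintro s₂ ⟨hV, hA₂⟩
    have h₂ := h₁.after_grid hA₂
    have hr₂ : ∀ a ≤ 7, s₂.reg a = s₁.reg a := fun a ha =>
      hA₂.1 a fun hh => by have := grid_writesReg hh; omega
    refine Run.seq (h₂.run_count (b := b) (fun q => 2 * d * S < nnd x W q) fun i hi s' e1 e2 e3 => ?_)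
      ?_
    · simp only [hb, Test.holds, Expr.eval, e2, e3, Nat.floor_natCast, hV, tab_getD _ hi,
        e1 rS (by decide) (by decide), hr₂ rS (by decide)]
      rw [show s₁.reg rS = S by simp [hs₁], h.nnd_eq hi]
      push_cast
      exact lt_gridVal_iff hS0 hi le_rfl (by gcongr)
    · rintro s₃ ⟨hC, hA₃⟩
      have h₃ := h₂.after_count hA₃
      have hr₃ : ∀ a ≤ 7, s₃.reg a = s₁.reg a := fun a ha =>
        (hA₃.1 a fun hh => by have := countCmd_writesReg hh; omega).trans (hr₂ a ha)
      have hGo₃ : s₃.reg rGo = 1 := (hr₃ _ (by decide)).trans (by simpa [hs₁] using hGo)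
      have hL₃ : s₃.reg rL = ℓ := (hr₃ _ (by decide)).trans (by simpa [hs₁] using hL)
      have hDm : D.card ≤ m := by simpa using Finset.card_filter_le (Finset.range m) _
      refine Run.ite (fun hb' => ?_) fun hb' => ?_
      · simp only [Test.holds, Expr.eval, h₃.rj, hC, Nat.cast_le] at hb'
        refine (h₃.run_thin (R := R) hx hd hp hR (by rw [← hℓ, hS])
          ((hr₃ _ (by decide)).trans (by simp [hs₁]))
          ((hA₃.2 _ countCmd_writesArr).trans hV) hb').mono (by omega) ?_
        rintro s' ⟨hgo, m', w', A', hm', hs'⟩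
        refine ⟨(3 ^ d + 1) * m', ?_, Or.inl ⟨hgo.trans hGo₃, m', w', A', j, le_rfl, hs'⟩⟩
        -- All points ranked at or below the pivot have a neighbour within `ℓ ≤ S`, so the net at
        -- scale `S` drops a fixed fraction of them.
        have hcl := card_close_le (x := y) hS0 h2 (t := ℓ) (by rw [hS]; nlinarith)
        rw [← hm'] at hcl
        have hle : m' ≤ m := hm' ▸ card_net_le S y m
        calc _ ≤ (3 ^ d + 1) * m' + (3 ^ d + 1) * (m - m') := by gcongr
          _ = _ := by rw [← mul_add, Nat.add_sub_cancel' hle]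
      · simp only [Test.holds, Expr.eval, h₃.rj, hC, Nat.cast_le, not_le] at hb'
        refine (Run.assign (Q := fun s' => ∃ M, M + D.card ≤ (3 ^ d + 1) * m ∧
          SieveInv x n J M s') ?_).mono (by simp [Expr.ops]) fun _ => id
        -- The sieve stops, and the remaining potential is zero.
        refine ⟨0, by rw [zero_add]; exact hDm.trans (Nat.le_mul_of_pos_left _ (by positivity)), Or.inr ⟨by simp [Expr.eval], fun a ha => h₃.act.input a ha, ?_⟩⟩
        have hst := h.approx.bounds (ℓ := ℓ) (θ := 2 * d * S) hℓ0.le (by positivity) hj hb'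
        simp only [setReg_reg, hL₃, hS] at hst ⊢
        exact ⟨hℓ0, hst⟩
  · simp only [farCmd, ← hb, Cmd.size, Expr.ops, Test.ops]
    nlinarith

noncomputable def sieveBody (d R : ℕ) : Cmd :=
  .seq (pivotCmd d) (.seq (.assign rS (.div (.var rL) (.const (4 * d)))) (.seq (grid d R)
    (.seq (countCmd (.le (.var rL) (.get (d + 2) (.var rI))) (flagE d))
      (.ite (.lt (.var rC) (.var rJ)) (pruneCmd d) (farCmd d R)))))

noncomputable def sieveTime (d R : ℕ) : ℕ := 4 * (sieveBody d R).size + 2 * gridTime d R + 200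

/-- Which side of the pivot is reduced depends on the unknown answer, so the guaranteed gain is the
smaller of the two ranks. -/
theorem Sieve.run_body {A : Finset ℕ} (h : Sieve x n J m w A j s) {R p : ℕ}
    (hx : Set.InjOn x (Finset.range n)) (hd : 0 < d) (hp : p < m) (hR : 4 * d < R)
    (hGo : s.reg rGo = 1) (hP : s.reg rP = p) :
    Run (sieveBody d R) s (sieveTime d R * m) fun s' =>
      ∃ M, M + min ((Finset.range m).filter fun b => nnd (fun i => x (w i)) (Finset.range m) p ≤
          nnd (fun i => x (w i)) (Finset.range m) b).card
        ((Finset.range m).filter fun b => nnd (fun i => x (w i)) (Finset.range m) b ≤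
          nnd (fun i => x (w i)) (Finset.range m) p).card ≤ (3 ^ d + 1) * m ∧
        SieveInv x n J M s' := by
  have h2 := h.two_le
  have hxw := h.injOn hx
  set y := fun i => x (w i) with hy
  set W := (Finset.range m).image w with hW
  obtain ⟨ℓ, hℓ⟩ : ∃ ℓ, ℓ = nnd y (Finset.range m) p := ⟨_, rfl⟩
  have hℓ0 : 0 < ℓ := hℓ ▸ nnd_pos h2 hxw hp
  obtain ⟨S, hS⟩ : ∃ S, S = ℓ / (4 * d) := ⟨_, rfl⟩
  have hd1 : (1 : ℝ) ≤ d := by exact_mod_cast hd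
  have hS0 : 0 < S := by rw [hS]; positivity
  have hSℓ : 4 * d * S = ℓ := by rw [hS]; field_simp
  have hR' : (4 * d : ℝ) < R := by exact_mod_cast hR
  set b : Test := .le (.var rL) (.get (d + 2) (.var rI)) with hb
  refine (Run.seq (run_pivot h.act hxw h2 h.rm hp hP).frame
    (T₂ := (2 + (Expr.div (.var rL) (.const (4 * d))).ops + (1 + gridTime d R * m + (1 +
      (2 * (countCmd b (flagE d)).size + 4) * m +
      (1 + (Test.lt (.var rC) (.var rJ)).ops + ((2 * (pruneCmd d).size + 16) * m +
        (2 * (farCmd d R).size + gridTime d R + 50) * m))))))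
    (Q := fun s' => ∃ M, M + min ((Finset.range m).filter fun b => nnd y (Finset.range m) p ≤
          nnd y (Finset.range m) b).card
        ((Finset.range m).filter fun b => nnd y (Finset.range m) b ≤
          nnd y (Finset.range m) p).card ≤ (3 ^ d + 1) * m ∧
        SieveInv x n J M s') ?_).mono ?_ fun _ => id
  · rintro s₁ ⟨hL₁, hA₁⟩
    rw [← hy, ← hℓ] at hL₁
    rw [← hℓ]
    have hr₁ : ∀ a ≤ 5, s₁.reg a = s.reg a := fun a ha =>
      hA₁.1 a fun hh => by have := pivotCmd_writesReg hh; omega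
    have h₁ : Sieve x n J m w A j s₁ := h.congr (fun a _ => hA₁.2 a pivotCmd_writesArr)
      (hr₁ _ (by decide)) (hr₁ _ (by decide))
    set s₂ := s₁.setReg rS S with hs₂
    have h₂ : Sieve x n J m w A j s₂ := h₁.congr (fun a _ => rfl) (by simp [hs₂]) (by simp [hs₂])
    refine Run.seq_assign (s' := s₂) (by simp [Expr.eval, hL₁, hS, hs₂]) (Run.seq
      (run_grid h₂.act hxw (by omega : 1 ≤ R) hS0 h2 h₂.rm (by simp [hs₂])).frame ?_)
    rintro s₃ ⟨hV, hA₃⟩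
    have h₃ := h₂.after_grid hA₃
    have hr₃ : ∀ a ≤ 7, s₃.reg a = s₂.reg a := fun a ha =>
      hA₃.1 a fun hh => by have := grid_writesReg hh; omega
    -- The side `ℓ/(4d)` places `ℓ` inside the resolved range: `2dS = ℓ/2 < ℓ = 4dS < RS`.
    have hVℓ : ∀ i < m, ℓ ≤ gridVal y m R S i ↔ ℓ ≤ nnd y (Finset.range m) i := fun i hi =>
      le_gridVal_iff hS0 hi (by nlinarith) (by rw [← hSℓ]; gcongr)
    refine Run.seq (h₃.run_count (b := b) (fun q => ℓ ≤ nnd x W q) fun i hi s' e1 e2 e3 => ?_) ?_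
    · simp only [hb, Test.holds, Expr.eval, e2, e3, Nat.floor_natCast, hV, tab_getD _ hi,
        e1 rL (by decide) (by decide), hr₃ rL (by decide)]
      rw [show s₂.reg rL = ℓ by simp [hs₂, hL₁], h.nnd_eq hi]
      exact hVℓ i hi
    · rintro s₄ ⟨hC, hA₄⟩
      have h₄ := h₃.after_count hA₄
      have hr₄ : ∀ a ≤ 7, s₄.reg a = s₂.reg a := fun a ha =>
        (hA₄.1 a fun hh => by have := countCmd_writesReg hh; omega).trans (hr₃ a ha)
      have hGo₄ : s₄.reg rGo = 1 := (hr₄ _ (by decide)).trans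
        (by simpa [hs₂, hr₁ rGo (by decide)] using hGo)
      have hL₄ : s₄.reg rL = ℓ := (hr₄ _ (by decide)).trans (by simpa [hs₂] using hL₁)
      refine Run.ite (fun hb' => ?_) fun hb' => ?_
      · simp only [Test.holds, Expr.eval, h₄.rj, hC, Nat.cast_lt] at hb'
        refine (h₄.run_prune hL₄ ((hA₄.2 _ countCmd_writesArr).trans hV) hVℓ hC rfl hb').mono
          (by omega) ?_
        rintro s' ⟨hgo, m', w', j', hm', hs'⟩
        refine ⟨(3 ^ d + 1) * m', ?_, Or.inl ⟨hgo.trans hGo₄, m', w', A, j', le_rfl, hs'⟩⟩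
        calc _ ≤ (3 ^ d + 1) * m' + (3 ^ d + 1) *
              ((Finset.range m).filter fun b => ℓ ≤ nnd y (Finset.range m) b).card := by
              refine Nat.add_le_add_left ((min_le_left _ _).trans ?_) _
              exact Nat.le_mul_of_pos_left _ (by positivity)
          _ = _ := by rw [← mul_add, hm']
      · simp only [Test.holds, Expr.eval, h₄.rj, hC, Nat.cast_lt, not_lt] at hb'
        refine (h₄.run_far (R := R) hx hd hp (by omega) hGo₄ (hL₄.trans hℓ)
          (by rw [hL₄]; exact hb')).mono (by omega) ?_
        rintro s' ⟨M, hM, hs'⟩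
        rw [← hy, ← hℓ] at hM
        exact ⟨M, (Nat.add_le_add_left (min_le_right _ _) _).trans hM, hs'⟩
  · simp only [sieveTime, sieveBody, ← hb, Cmd.size, Expr.ops, Test.ops]
    nlinarith

noncomputable def sieveCmd (d R : ℕ) : Cmd :=
  .loop (.lt (.const 0) (.var rGo)) (.seq (.rand rP (.sub (.var rM) (.const 1))) (sieveBody d R))

theorem run_sieve {A : Finset ℕ} (h : Sieve x n J m w A j s) {R : ℕ}
    (hx : Set.InjOn x (Finset.range n)) (hd : 0 < d) (hR : 4 * d < R) (hGo : s.reg rGo = 1) :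
    Run (sieveCmd d R) s (8 * (sieveTime d R + 9) * ((3 ^ d + 1) * m) + 4) (Stopped x n J) := by
  refine (Run.loop_pivot (SieveInv x n J) (8 * (sieveTime d R + 9)) (fun M s hI hb => ?_)
    (fun M s hI hb => ?_) (Or.inl ⟨hGo, m, w, A, j, le_rfl, h⟩)).mono
    (by simp [Test.ops, Expr.ops]) fun _ => id
  · rcases hI with ⟨h1, -⟩ | ⟨-, h2⟩
    · simp [Test.holds, Expr.eval, h1] at hb
    · exact h2
  · rcases hI with ⟨h1, m, w, A, j, hM, h⟩ | ⟨h1, -⟩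
    · have h2 := h.two_le
      have hfl : ⌊(Expr.sub (.var rM) (.const 1)).eval s⌋₊ + 1 = m := by
        simp only [Expr.eval, h.rm, Int.cast_one]
        rw [← Nat.cast_one, ← Nat.cast_sub (by omega), Nat.floor_natCast]
        omega
      rw [hfl]
      set D : ℕ → ℝ := fun i => nnd (fun i => x (w i)) (Finset.range m) i
      set r : ℕ → ℕ := fun p => min ((Finset.range m).filter fun b => D p ≤ D b).card
        ((Finset.range m).filter fun b => D b ≤ D p).card with hr
      have hrm : ∀ p, r p ≤ m := fun p =>
        (min_le_left _ _).trans (by simpa using Finset.card_filter_le (Finset.range m) _)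
      refine ⟨fun _ => sieveTime d R * m, fun p => (3 ^ d + 1) * m - r p, fun p hp => ?_, ?_⟩
      · refine ((h.congr (s' := s.setReg rP p) (fun a _ => rfl) (by simp) (by simp)).run_body hx hd
          hp hR (by simpa using h1) (by simp)).mono le_rfl ?_
        rintro s' ⟨M', hM', hs'⟩
        exact ⟨M', Nat.le_sub_of_add_le hM', hs'⟩
      · refine (sum_pivot_le (κ := 3 ^ d + 1) (c := 9) D (fun _ _ => le_rfl) fun p _ => ?_).trans
          (by gcongr)
        exact (Nat.sub_add_cancel ((hrm p).trans (Nat.le_mul_of_pos_left _ (by positivity)))).le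
    · simp [Test.holds, Expr.eval, h1] at hb

end Sieve

/-! ## Selection -/

/-- As `j` values exceed `v`, the `j`-th largest also exceeds `v`, so values up to `v` do not
influence it. -/
theorem IsLargest.of_filter_lt {S : Finset ℕ} {V : ℕ → ℝ} {j : ℕ} {u v : ℝ}
    (hj : j ≤ (S.filter fun q => v < V q).card)
    (h : IsLargest (S.filter fun q => v < V q) V j u) : IsLargest S V j u := by
  have huv : v < u := by
    by_contra hc
    have h1 := h.1
    rw [Finset.filter_true_of_mem fun q hq =>
      (not_lt.1 hc).trans_lt (Finset.mem_filter.1 hq).2] at h1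
    omega
  unfold IsLargest at h ⊢
  simp only [Finset.filter_filter] at h
  rw [Finset.filter_congr (p := fun q => u < V q) (q := fun q => v < V q ∧ u < V q) fun q _ => ?_,
    Finset.filter_congr (p := fun q => u ≤ V q) (q := fun q => v < V q ∧ u ≤ V q) fun q _ => ?_]
  · exact h
  · exact ⟨fun hh => ⟨huv.trans_le hh, hh⟩, fun hh => hh.2⟩
  · exact ⟨fun hh => ⟨huv.trans hh, hh⟩, fun hh => hh.2⟩

/-- The removed values all lie above the answer, so both counts shift by the same number as the
rank. -/
theorem IsLargest.of_filter_gt {S : Finset ℕ} {V : ℕ → ℝ} {j : ℕ} {u v : ℝ}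
    (hj : (S.filter fun q => v ≤ V q).card < j)
    (h : IsLargest (S.filter fun q => V q < v) V (j - (S.filter fun q => v ≤ V q).card) u) :
    IsLargest S V j u := by
  have huv : u < v := by
    obtain ⟨q, hq⟩ := Finset.card_pos.1 (lt_of_lt_of_le (Nat.sub_pos_of_lt hj) h.2)
    simp only [Finset.mem_filter] at hq
    exact hq.2.trans_lt hq.1.2
  have key : ∀ p : ℕ → Prop, ∀ _ : DecidablePred p, (∀ q, v ≤ V q → p q) →
      (S.filter p).card = ((S.filter fun q => V q < v).filter p).card +
        (S.filter fun q => v ≤ V q).card := by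
    intro p _ hp
    rw [← Finset.card_filter_add_card_filter_not (s := S.filter p) (fun q => V q < v),
      Finset.filter_comm, Finset.filter_filter (p := p)]
    congr 2
    refine Finset.filter_congr fun q _ => ?_
    rw [not_lt]
    exact ⟨fun hh => hh.2, fun hh => ⟨hp q hh, hh⟩⟩
  unfold IsLargest at h ⊢
  rw [key (fun q => u < V q) _ fun q hq => huv.trans_le hq,
    key (fun q => u ≤ V q) _ fun q hq => huv.le.trans hq]
  omega

/-- The entries of array `a` are values `V`, and the `J`-th largest of all values is the `j`-th
largest among the first `m` entries. -/
structure Selecting (V : ℕ → ℝ) (a L J m : ℕ) (e : ℕ → ℕ) (j : ℕ) (s : State) : Prop where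
  arr : s.arr a = tab L fun i => V (e i)
  le : m ≤ L
  inj : Set.InjOn e (Finset.range m)
  rm : s.reg rM = m
  rj : s.reg rJ = j
  pos : 1 ≤ j
  le_card : j ≤ m
  largest : ∀ v, IsLargest ((Finset.range m).image e) V j v → IsLargest (Finset.range L) V J v

theorem Selecting.congr {V : ℕ → ℝ} {a L J m j : ℕ} {e : ℕ → ℕ} {s s' : State}
    (h : Selecting V a L J m e j s) (ha : s'.arr a = s.arr a) (hM : s'.reg rM = s.reg rM)
    (hJ : s'.reg rJ = s.reg rJ) : Selecting V a L J m e j s' :=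
  ⟨ha.trans h.arr, h.le, h.inj, hM.trans h.rm, hJ.trans h.rj, h.pos, h.le_card, h.largest⟩

theorem card_filter_image {m : ℕ} {e : ℕ → ℕ} (he : Set.InjOn e (Finset.range m)) (p : ℕ → Prop)
    [DecidablePred p] : (((Finset.range m).image e).filter p).card =
      ((Finset.range m).filter fun i => p (e i)).card := by
  rw [Finset.filter_image, Finset.card_image_of_injOn
    (he.mono fun i hi => (Finset.mem_filter.1 hi).1)]

theorem Selecting.run_count {V : ℕ → ℝ} {a L J m j : ℕ} {e : ℕ → ℕ} {s : State}
    (h : Selecting V a L J m e j s) {b : Test} (Q : ℕ → Prop) [DecidablePred Q]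
    (hb : ∀ i < m, ∀ s' : State, (∀ a, a ≠ rC → a ≠ rI → s'.reg a = s.reg a) →
      s'.arr = s.arr → s'.reg rI = (i : ℝ) → (b.holds s' ↔ Q (e i))) :
    Run (countCmd b (.const 1)) s ((2 * (countCmd b (.const 1)).size + 4) * m) fun s' =>
      s'.reg rC = (((Finset.range m).image e).filter Q).card ∧
        Agree (countCmd b (.const 1)) s s' := by
  classical
  refine (RealRAM.run_count h.rm (fun i => Q (e i)) (fun _ => 1)
    fun i hi s' h1 h2 h3 => ⟨hb i hi s' h1 h2 h3, by simp [Expr.eval]⟩).frame.mono ?_ ?_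
  · have h2 := h.pos.trans h.le_card
    have := Nat.le_mul_of_pos_right ((countCmd b (.const 1)).size) (show 0 < m by omega)
    simp only [add_mul, mul_assoc]
    omega
  · rintro s' ⟨h1, hA⟩
    refine ⟨?_, hA⟩
    rw [h1, card_filter_image h.inj, Finset.card_eq_sum_ones]
    congr!

theorem Selecting.run_compact {V : ℕ → ℝ} {a L J m j j' : ℕ} {e : ℕ → ℕ} {s s' : State}
    (h : Selecting V a L J m e j s) (Q : ℕ → Prop) [DecidablePred Q]
    (hj : 1 ≤ j') (hj' : j' ≤ (((Finset.range m).image e).filter Q).card)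
    (hl : ∀ v, IsLargest (((Finset.range m).image e).filter Q) V j' v →
      IsLargest ((Finset.range m).image e) V j v)
    (ha : s'.arr a = s.arr a) (hM : s'.reg rM = s.reg rM) (hJ : s'.reg rJ = j') {b : Test}
    (hb : ∀ i < m, ∀ t : State, (∀ y, y ≠ rC → y ≠ rI → t.reg y = s'.reg y) →
      t.reg rI = (i : ℝ) → (t.arr a).getD i 0 = V (e i) → (b.holds t ↔ Q (e i))) :
    Run (compactCmd a b) s' ((2 * (compactCmd a b).size + 8) * m) fun t =>
      t.reg rGo = s'.reg rGo ∧ ∃ m' e', m' = ((Finset.range m).filter fun i => Q (e i)).card ∧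
        Selecting V a L J m' e' j' t := by
  classical
  refine (RealRAM.run_compact (hM.trans h.rm) h.le (ha.trans h.arr) (fun i => Q (e i))
    fun i hi t h1 _ h3 h4 => hb i hi t h1 h3 ?_).frame.mono ?_ ?_
  · obtain ⟨g, hg, hgi⟩ := h4
    rw [hg, tab_getD _ (hi.trans_le h.le), hgi]
  · have h2 := h.pos.trans h.le_card
    have := Nat.le_mul_of_pos_right ((compactCmd a b).size) (show 0 < m by omega)
    simp only [add_mul, mul_assoc]
    omega
  · rintro t ⟨⟨e', m', h1, h2, h3, h4⟩, hA⟩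
    replace h4 : (Finset.range m').image e' = (Finset.range m).filter fun i => Q (e i) :=
      h4.trans (by congr!)
    have hreg : ∀ y, y ≠ rI → y ≠ rC → y ≠ rM → t.reg y = s'.reg y := fun y e1 e2 e3 =>
      hA.1 y fun hh => by rcases compactCmd_writesReg hh with h | h | h <;> contradiction
    have hm' : m' = ((Finset.range m).filter fun i => Q (e i)).card := by
      rw [← h4, Finset.card_image_of_injOn h3, Finset.card_range]
    refine ⟨hreg _ (by decide) (by decide) (by decide), m', fun i => e (e' i), hm', h2, ?_, ?_, h1,
      (hreg _ (by decide) (by decide) (by decide)).trans hJ, hj, ?_, fun v hv => h.largest v (hl v ?_)⟩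
    · rw [hm']
      exact (by simpa using Finset.card_filter_le (Finset.range m) _ : _ ≤ m).trans h.le
    · refine h.inj.comp h3 fun i hi => ?_
      have : e' i ∈ (Finset.range m).filter fun i => Q (e i) :=
        h4 ▸ Finset.mem_image_of_mem e' hi
      exact (Finset.mem_filter.1 this).1
    · rw [hm', ← card_filter_image h.inj]
      exact hj'
    · rwa [show (Finset.range m').image (fun i => e (e' i)) = ((Finset.range m').image e').image e
        from (Finset.image_image).symm, h4, ← Finset.filter_image] at hv

def selectBody (a : ℕ) : Cmd :=
  .seq (.assign rL (.get a (.var rP)))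
    (.seq (countCmd (.lt (.var rL) (.get a (.var rI))) (.const 1))
      (.ite (.le (.var rJ) (.var rC)) (compactCmd a (.lt (.var rL) (.get a (.var rI))))
        (.seq (countCmd (.le (.var rL) (.get a (.var rI))) (.const 1))
          (.ite (.le (.var rJ) (.var rC)) (.seq (.assign 0 (.var rL)) (.assign rGo (.const 0)))
            (.seq (.assign rJ (.sub (.var rJ) (.var rC)))
              (compactCmd a (.lt (.get a (.var rI)) (.var rL))))))))

def SelectInv (V : ℕ → ℝ) (a L J M : ℕ) (s : State) : Prop :=
  (s.reg rGo = 1 ∧ ∃ m e j, m ≤ M ∧ Selecting V a L J m e j s) ∨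
    (s.reg rGo = 0 ∧ IsLargest (Finset.range L) V J (s.reg 0))

/-- A three-way quickselect step. Values equal to the pivot never survive a reduction, so ties do no
harm; when the rank falls among them, the pivot is the answer. -/
theorem Selecting.run_body {V : ℕ → ℝ} {a L J m j p : ℕ} {e : ℕ → ℕ} {s : State}
    (h : Selecting V a L J m e j s) (hp : p < m) (hGo : s.reg rGo = 1) (hP : s.reg rP = p) :
    Run (selectBody a) s ((4 * (selectBody a).size + 50) * m) fun s' =>
      ∃ M, M + min ((Finset.range m).filter fun b => V (e p) ≤ V (e b)).card
        ((Finset.range m).filter fun b => V (e b) ≤ V (e p)).card ≤ 1 * m ∧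
        SelectInv V a L J M s' := by
  have hm : 1 ≤ m := by omega
  obtain ⟨v, hv⟩ : ∃ v, v = V (e p) := ⟨_, rfl⟩
  set S := (Finset.range m).image e with hS
  set up := ((Finset.range m).filter fun b => V (e p) ≤ V (e b)).card with hup
  set dn := ((Finset.range m).filter fun b => V (e b) ≤ V (e p)).card with hdn
  have hupm : up ≤ m := by simpa using Finset.card_filter_le (Finset.range m) _
  have hup' : ((Finset.range m).filter fun b => V (e b) < v).card + up = m := by
    have := Finset.card_filter_add_card_filter_not (s := Finset.range m) fun b => v ≤ V (e b)
    simp only [not_le, Finset.card_range] at this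
    rw [hup, ← hv]
    omega
  have hdn' : ((Finset.range m).filter fun b => v < V (e b)).card + dn = m := by
    have := Finset.card_filter_add_card_filter_not (s := Finset.range m) fun b => V (e b) ≤ v
    simp only [not_le, Finset.card_range] at this
    rw [hdn, ← hv]
    omega
  set b₁ : Test := .lt (.var rL) (.get a (.var rI)) with hb₁
  set b₂ : Test := .le (.var rL) (.get a (.var rI)) with hb₂
  set b₃ : Test := .lt (.get a (.var rI)) (.var rL) with hb₃
  set s₁ := s.setReg rL v with hs₁
  have h₁ : Selecting V a L J m e j s₁ := h.congr rfl (by simp [hs₁]) (by simp [hs₁])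
  have hcount : ∀ {s s' : State} {b : Test}, Selecting V a L J m e j s →
      Agree (countCmd b (.const 1)) s s' → Selecting V a L J m e j s' ∧
        ∀ y ≤ 7, s'.reg y = s.reg y := by
    intro s s' b h hA
    have hr : ∀ y ≤ 7, s'.reg y = s.reg y := fun y hy =>
      hA.1 y fun hh => by have := countCmd_writesReg hh; omega
    exact ⟨h.congr (hA.2 _ countCmd_writesArr) (hr _ (by decide)) (hr _ (by decide)), hr⟩
  refine (Run.seq_assign (s' := s₁) ?_ (Run.seq (h₁.run_count (b := b₁) (fun q => v < V q) ?_)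
    (T₂ := 1 + (Test.le (.var rJ) (.var rC)).ops + ((2 * (compactCmd a b₁).size + 8) * m +
      (1 + (2 * (countCmd b₂ (.const 1)).size + 4) * m + (1 + (Test.le (.var rJ) (.var rC)).ops +
        (5 + (2 + (Expr.sub (.var rJ) (.var rC)).ops + (2 * (compactCmd a b₃).size + 8) * m))))))
    (Q := fun s' => ∃ M, M + min up dn ≤ 1 * m ∧ SelectInv V a L J M s') ?_)).mono ?_ fun _ => id
  · simp only [Expr.eval, hP, Nat.floor_natCast, h.arr, tab_getD _ (hp.trans_le h.le), hs₁, hv]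
  · intro i hi t e1 e2 e3
    simp only [hb₁, Test.holds, Expr.eval, e2, e3, Nat.floor_natCast, e1 rL (by decide) (by decide),
      h₁.arr, tab_getD _ (hi.trans_le h.le)]
    simp [hs₁]
  · rintro s₂ ⟨hC₂, hA₂⟩
    obtain ⟨h₂, hr₂⟩ := hcount h₁ hA₂
    have hL₂ : s₂.reg rL = v := (hr₂ _ (by decide)).trans (by simp [hs₁])
    have hGo₂ : s₂.reg rGo = 1 := (hr₂ _ (by decide)).trans (by simpa [hs₁] using hGo)
    refine Run.ite (fun hb => ?_) fun hb => ?_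
    · simp only [Test.holds, Expr.eval, h₂.rj, hC₂, Nat.cast_le] at hb
      refine (h₂.run_compact (b := b₁) (fun q => v < V q) h.pos hb
        (fun u hu => hu.of_filter_lt hb) rfl rfl h₂.rj fun i hi t e1 e3 e4 => ?_).mono (by omega) ?_
      · simp only [hb₁, Test.holds, Expr.eval, e3, Nat.floor_natCast, e4, e1 rL (by decide) (by decide),
          hL₂]
      · rintro t ⟨hgo, m', e', hm', hs'⟩
        exact ⟨m', by have := min_le_right up dn; omega,
          Or.inl ⟨hgo.trans hGo₂, m', e', j, le_rfl, hs'⟩⟩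
    · simp only [Test.holds, Expr.eval, h₂.rj, hC₂, Nat.cast_le, not_le] at hb
      refine (Run.seq (h₂.run_count (b := b₂) (fun q => v ≤ V q) ?_) (T₂ := (1 +
        (Test.le (.var rJ) (.var rC)).ops +
        (5 + (2 + (Expr.sub (.var rJ) (.var rC)).ops + (2 * (compactCmd a b₃).size + 8) * m))))
        (Q := fun s' => ∃ M, M + min up dn ≤ 1 * m ∧ SelectInv V a L J M s') ?_).mono
        (by omega) fun _ => id
      · intro i hi t e1 e2 e3
        simp only [hb₂, Test.holds, Expr.eval, e2, e3, Nat.floor_natCast,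
          e1 rL (by decide) (by decide), h₂.arr, tab_getD _ (hi.trans_le h.le), hL₂]
      · rintro s₃ ⟨hC₃, hA₃⟩
        obtain ⟨h₃, hr₃⟩ := hcount h₂ hA₃
        have hL₃ : s₃.reg rL = v := (hr₃ _ (by decide)).trans hL₂
        have hGo₃ : s₃.reg rGo = 1 := (hr₃ _ (by decide)).trans hGo₂
        refine Run.ite (fun hb' => ?_) fun hb' => ?_
        · simp only [Test.holds, Expr.eval, h₃.rj, hC₃, Nat.cast_le] at hb'
          refine (Run.of_simple (c := .seq (.assign 0 (.var rL)) (.assign rGo (.const 0)))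
            (Q := fun s' => ∃ M, M + min up dn ≤ 1 * m ∧ SelectInv V a L J M s')
            ⟨trivial, trivial⟩ ⟨0, by have := min_le_left up dn; omega, Or.inr ⟨?_, ?_⟩⟩).mono ?_
            fun _ => id
          · simp [Cmd.exec, Expr.eval]
          · simp only [Cmd.exec, Expr.eval, setReg_reg, hL₃]
            exact h.largest v ⟨hb, hb'⟩
          · simp only [Cmd.size, Expr.ops]; omega
        · simp only [Test.holds, Expr.eval, h₃.rj, hC₃, Nat.cast_le, not_le] at hb'
          set c := (S.filter fun q => v ≤ V q).card with hc
          set s₄ := s₃.setReg rJ ((j - c : ℕ) : ℝ) with hs₄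
          have hcard : (S.filter fun q => V q < v).card + c = m := by
            rw [hc, card_filter_image h.inj, card_filter_image h.inj]
            rwa [hup, ← hv] at hup'
          have hjm := h.le_card
          refine (Run.seq_assign (s' := s₄) ?_ (h₃.run_compact (b := b₃) (fun q => V q < v)
            (j' := j - c) (by omega)
            (show j - c ≤ (S.filter fun q => V q < v).card by omega) (fun u hu => hu.of_filter_gt hb') ?_ ?_ ?_
            fun i hi t e1 e3 e4 => ?_)).mono (by omega) ?_
          · simp only [Expr.eval, h₃.rj, hC₃, hs₄, Nat.cast_sub hb'.le]
          · simp [hs₄]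
          · simp [hs₄]
          · simp [hs₄]
          · simp only [hb₃, Test.holds, Expr.eval, e3, Nat.floor_natCast, e4,
              e1 rL (by decide) (by decide)]
            simp [hs₄, hL₃]
          · rintro t ⟨hgo, m', e', hm', hs'⟩
            exact ⟨m', by have := min_le_left up dn; omega, Or.inl
              ⟨hgo.trans (by simpa [hs₄] using hGo₃), m', e', j - c, le_rfl, hs'⟩⟩
  · simp only [selectBody, ← hb₁, ← hb₂, ← hb₃, Cmd.size, Expr.ops, Test.ops]
    nlinarith

def selectCmd (a : ℕ) : Cmd :=
  .loop (.lt (.const 0) (.var rGo)) (.seq (.rand rP (.sub (.var rM) (.const 1))) (selectBody a))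

theorem run_select {V : ℕ → ℝ} {a L J m j : ℕ} {e : ℕ → ℕ} {s : State}
    (h : Selecting V a L J m e j s) (hGo : s.reg rGo = 1) :
    Run (selectCmd a) s (8 * ((4 * (selectBody a).size + 50) + 9) * m + 4) fun s' =>
      IsLargest (Finset.range L) V J (s'.reg 0) := by
  refine (Run.loop_pivot (SelectInv V a L J) (8 * ((4 * (selectBody a).size + 50) + 9))
    (fun M s hI hb => ?_) (fun M s hI hb => ?_) (Or.inl ⟨hGo, m, e, j, le_rfl, h⟩)).mono
    (by simp [Test.ops, Expr.ops]) fun _ => id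
  · rcases hI with ⟨h1, -⟩ | ⟨-, h2⟩
    · simp [Test.holds, Expr.eval, h1] at hb
    · exact h2
  · rcases hI with ⟨h1, m, e, j, hM, h⟩ | ⟨h1, -⟩
    · have h2 := h.pos.trans h.le_card
      have hfl : ⌊(Expr.sub (.var rM) (.const 1)).eval s⌋₊ + 1 = m := by
        simp only [Expr.eval, h.rm, Int.cast_one]
        rw [← Nat.cast_one, ← Nat.cast_sub (by omega), Nat.floor_natCast]
        omega
      rw [hfl]
      set D : ℕ → ℝ := fun i => V (e i)
      set r : ℕ → ℕ := fun p => min ((Finset.range m).filter fun b => D p ≤ D b).card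
        ((Finset.range m).filter fun b => D b ≤ D p).card with hr
      have hrm : ∀ p, r p ≤ m := fun p =>
        (min_le_left _ _).trans (by simpa using Finset.card_filter_le (Finset.range m) _)
      refine ⟨fun _ => (4 * (selectBody a).size + 50) * m, fun p => 1 * m - r p,
        fun p hp => ?_, ?_⟩
      · refine ((h.congr (s' := s.setReg rP p) rfl (by simp) (by simp)).run_body hp
          (by simpa using h1) (by simp)).mono le_rfl ?_
        rintro s' ⟨M', hM', hs'⟩
        exact ⟨M', Nat.le_sub_of_add_le hM', hs'⟩
      · refine (sum_pivot_le (κ := 1) (c := 9) D (fun _ _ => le_rfl) fun p _ => ?_).trans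
          (by rw [one_mul]; gcongr)
        exact (Nat.sub_add_cancel ((hrm p).trans (by omega))).le
    · simp [Test.holds, Expr.eval, h1] at hb

/-! ## The program -/

/-- Array `a` := the values of `e` at positions `0, …, n - 1`, where register `0` holds `n`. -/
def fillCmd (a : ℕ) (e : Expr) : Cmd :=
  .seq (.alloc a (.var 0)) (.seq (.assign rI (.const 0))
    (.loop (.lt (.var rI) (.var 0)) (.seq (.store a (.var rI) e) nextCmd)))

theorem fillCmd_writesReg {a y : ℕ} {e : Expr} (h : (fillCmd a e).writesReg y) : y = rI := by
  simpa [fillCmd, nextCmd, Cmd.writesReg] using h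

theorem fillCmd_writesArr {a y : ℕ} {e : Expr} (h : (fillCmd a e).writesArr y) : y = a := by
  simpa [fillCmd, nextCmd, Cmd.writesArr] using h

theorem run_fill {a n : ℕ} {e : Expr} {s : State} (hn : 1 ≤ n) (h0 : s.reg 0 = n) (val : ℕ → ℝ)
    (he : ∀ i < n, ∀ t : State, t.reg rI = (i : ℝ) → e.eval t = val i) :
    Run (fillCmd a e) s ((2 * (fillCmd a e).size + 20) * n)
      fun t => t.arr a = tab n val ∧ Agree (fillCmd a e) s t := by
  refine (Run.frame (Q := fun t => t.arr a = tab n val) ?_)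
  set body : Cmd := .seq (.store a (.var rI) e) nextCmd with hbody
  set s₁ := s.setArr a (tab n fun _ => 0) with hs₁
  have hl : Run (.loop (.lt (.var rI) (.var 0)) body) (s₁.setReg rI 0)
      (∑ i ∈ Finset.range n, (body.size + 4) + 4)
      fun t => t.reg rI = n ∧ t.arr a = tab n fun k => if k < n then val k else 0 := by
    refine Run.for_loop_agree n (fun i t => t.reg rI = i ∧
      t.arr a = tab n fun k => if k < i then val k else 0) _ (fun i s h => h.1)
      (by simp [hs₁, h0]) (by simp [hbody, nextCmd, Cmd.writesReg]) (fun i hi t _ hI => ?_)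
      (by simp [hs₁])
    refine Run.of_simple (by simp [hbody, nextCmd, Cmd.Simple]) ?_
    simp only [hbody, nextCmd, Cmd.exec, Expr.eval, hI.1, hI.2, Nat.floor_natCast, he i hi t hI.1,
      tab_set]
    refine ⟨by simp [hI.1], ?_⟩
    simp only [setReg_arr, setArr_arr, if_true]
    refine tab_congr fun k _ => ?_
    by_cases hk : k = i
    · subst hk; simp
    · rw [Function.update_of_ne hk]
      simp only [show k < i + 1 ↔ k < i by omega]
  refine (Run.seq_eq (s' := s₁) (Run.alloc (by simp [Expr.eval, h0, replicate_eq_tab, hs₁]))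
    (Run.seq_assign (s' := s₁.setReg rI 0) (by simp [Expr.eval]) hl)).mono ?_ fun t h => ?_
  · simp only [fillCmd, ← hbody, Cmd.size, Expr.ops, Test.ops, Expr.eval, h0, Nat.floor_natCast,
      Finset.sum_const, Finset.card_range, smul_eq_mul]
    nlinarith
  · rw [h.2]
    exact tab_congr fun k hk => if_pos hk

/-- A grid of side `1 / (4 d (1 + 8 d) ^ 2)` resolves distances up to `16 d ^ 2 (1 + 8 d)`. -/
def radius (d : ℕ) : ℕ := 64 * d ^ 3 * (1 + 8 * d) ^ 3 + 1

/-- Register `rJ` := the rank from above of the `k`-th smallest of `n` values. -/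
def rankCmd : Cmd := .seq (.assign rJ (.add (.sub (.var 0) (.var 1)) (.const 1)))
  (.seq (.assign rM (.var 0)) (.assign rGo (.const 1)))

theorem run_rank {n k : ℕ} {s : State} (hk : k ≤ n) (h0 : s.reg 0 = n) (h1 : s.reg 1 = k) :
    Run rankCmd s rankCmd.size fun t => t =
      ((s.setReg rJ ((n - k + 1 : ℕ) : ℝ)).setReg rM n).setReg rGo 1 := by
  refine Run.of_simple (by simp [rankCmd, Cmd.Simple]) ?_
  simp only [rankCmd, Cmd.exec, Expr.eval, h0, h1]
  push_cast [Nat.cast_sub hk]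
  simp [h0]

noncomputable def approxCmd (d : ℕ) : Cmd :=
  .seq (fillCmd d (.var rI)) (.seq (fillCmd (d + 1) (.const 1))
    (.seq rankCmd (sieveCmd d (radius d))))

noncomputable def exactCmd (d : ℕ) : Cmd :=
  .seq (fillCmd d (.var rI)) (.seq rankCmd
    (.seq (.assign rS (.div (.var rL) (.const (4 * d * (1 + 8 * d) ^ 2))))
      (.seq (grid d (radius d)) (selectCmd (d + 2)))))

/-- Registers `0` and `1` hold `n` and `k`; the exact phase needs them again, because it restarts
with all points and the original rank. -/
theorem sieveCmd_not_writesReg {d R a : ℕ} (ha : a < 2) : ¬ (sieveCmd d R).writesReg a := by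
  intro h
  simp only [sieveCmd, sieveBody, farCmd, thinCmd, pruneCmd, Cmd.writesReg] at h
  have h1 := @grid_writesReg d R a
  have h2 := @pivotCmd_writesReg d a
  have h3 := @unflagCmd_writesReg d a
  have h4 : ∀ b, (compactCmd d b).writesReg a → 2 ≤ a := fun b h => by
    have := compactCmd_writesReg h; omega
  have h5 : ∀ b, (countCmd b (flagE d)).writesReg a → 2 ≤ a := fun b h => by
    have := countCmd_writesReg h; omega
  rcases h with h | h | h | h | h | (h | h) | h | h | h | (h | h) | h
  all_goals first
    | omega
    | (have := h1 h; omega)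
    | (have := h2 h; omega)
    | (have := h3 h; omega)
    | (have := h4 _ h; omega)
    | (have := h5 _ h; omega)

section Program

variable {d n k : ℕ} {x : ℕ → EuclideanSpace ℝ (Fin d)} {s : State}

theorem Active.id (hin : HasInput x n s) (ha : s.arr d = tab n fun i => (i : ℝ)) :
    Active x n n id s := ⟨hin, ha, le_rfl, fun _ => _root_.id⟩

noncomputable def approxTime (d : ℕ) : ℕ :=
  2 * (approxCmd d).size + 8 * (sieveTime d (radius d) + 9) * (3 ^ d + 1) + 60

theorem four_mul_lt_radius (hd : 0 < d) : 4 * d < radius d := by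
  have h1 : d ≤ d ^ 3 := Nat.le_self_pow (by norm_num) d
  have h2 : 1 ≤ (1 + 8 * d) ^ 3 := Nat.one_le_pow _ _ (by omega)
  unfold radius
  nlinarith

theorem run_approx (hd : 0 < d) (hn : 2 ≤ n) (hk : 1 ≤ k) (hkn : k ≤ n) (hin : HasInput x n s)
    (hx : Set.InjOn x (Finset.range n)) (h0 : s.reg 0 = n) (h1 : s.reg 1 = k) :
    Run (approxCmd d) s (approxTime d * n) fun t => Stopped x n (n - k + 1) t ∧
      t.reg 0 = n ∧ t.reg 1 = k := by
  refine (Run.seq (run_fill (by omega) h0 (fun i => (i : ℝ)) fun i _ t ht => by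
      simpa [Expr.eval] using ht)
    (T₂ := 1 + (2 * (fillCmd (d + 1) (.const 1)).size + 20) * n + (1 + rankCmd.size +
      (8 * (sieveTime d (radius d) + 9) * ((3 ^ d + 1) * n) + 4)))
    (Q := fun t => Stopped x n (n - k + 1) t ∧ t.reg 0 = n ∧ t.reg 1 = k) ?_).mono ?_ fun _ => id
  · rintro s₁ ⟨ha₁, hA₁⟩
    have hr₁ : ∀ y < 2, s₁.reg y = s.reg y := fun y hy =>
      hA₁.1 y fun hh => by have := fillCmd_writesReg hh; omega
    refine Run.seq (run_fill (by omega) ((hr₁ _ (by decide)).trans h0) (fun _ => 1)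
      fun i _ t ht => by simp [Expr.eval]) ?_
    rintro s₂ ⟨ha₂, hA₂⟩
    have hr₂ : ∀ y < 2, s₂.reg y = s.reg y := fun y hy =>
      (hA₂.1 y fun hh => by have := fillCmd_writesReg hh; omega).trans (hr₁ y hy)
    refine Run.seq_eq (run_rank hkn ((hr₂ _ (by decide)).trans h0) ((hr₂ _ (by decide)).trans h1)) ?_
    set s₃ := ((s₂.setReg rJ ((n - k + 1 : ℕ) : ℝ)).setReg rM n).setReg rGo 1 with hs₃
    have hs : Sieve x n (n - k + 1) n id (Finset.range n) (n - k + 1) s₃ := by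
      refine ⟨Active.id (fun a ha => ?_) ?_, Set.injOn_id _, ?_, ?_, by simp [hs₃], by simp [hs₃]⟩
      · simp only [hs₃, setReg_arr]
        rw [hA₂.2 a fun hh => by have := fillCmd_writesArr hh; omega,
          hA₁.2 a fun hh => by have := fillCmd_writesArr hh; omega]
        exact hin a ha
      · simp only [hs₃, setReg_arr]
        rw [hA₂.2 d fun hh => by have := fillCmd_writesArr hh; omega, ha₁]
      · simp only [hs₃, setReg_arr]
        rw [ha₂]
        exact tab_congr fun i hi => by simp [indic, hi]
      · rw [Finset.image_id, Finset.filter_true_of_mem fun _ => _root_.id]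
        exact Approx.init hn (by omega) (by omega) hx
    refine (run_sieve hs hx hd (four_mul_lt_radius hd) (by simp [hs₃])).frame.mono le_rfl ?_
    rintro t ⟨ht, hA⟩
    refine ⟨ht, ?_, ?_⟩
    · rw [hA.1 0 (sieveCmd_not_writesReg (by decide))]
      simpa [hs₃] using (hr₂ 0 (by decide)).trans h0
    · rw [hA.1 1 (sieveCmd_not_writesReg (by decide))]
      simpa [hs₃] using (hr₂ 1 (by decide)).trans h1
  · simp only [approxTime, approxCmd, Cmd.size]
    nlinarith

/-- The approximation confines `v` to `[lo, hi]`, which lies within the range resolved by the grid.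
The counts above `v` are therefore the same for grid values and for true distances. -/
theorem IsLargest.gridVal {J R : ℕ} {S lo hi v : ℝ} (hS : 0 < S)
    (h1 : J ≤ ((Finset.range n).filter fun q => lo ≤ nnd x (Finset.range n) q).card)
    (h2 : ((Finset.range n).filter fun q => hi < nnd x (Finset.range n) q).card < J)
    (hlo : 2 * d * S < lo) (hhi : hi < R * S)
    (hv : IsLargest (Finset.range n) (nnd x (Finset.range n)) J v) :
    IsLargest (Finset.range n) (gridVal x n R S) J v := by
  have h3 : lo ≤ v := by
    by_contra hc
    have := Finset.card_le_card (Finset.monotone_filter_right (Finset.range n)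
      (p := fun q => lo ≤ nnd x (Finset.range n) q) (q := fun q => v < nnd x (Finset.range n) q)
      fun q _ hq => (not_le.1 hc).trans_le hq)
    have := hv.1
    omega
  have h4 : v ≤ hi := by
    by_contra hc
    have := Finset.card_le_card (Finset.monotone_filter_right (Finset.range n)
      (p := fun q => v ≤ nnd x (Finset.range n) q) (q := fun q => hi < nnd x (Finset.range n) q)
      fun q _ hq => (not_le.1 hc).trans_le hq)
    have := hv.2
    omega
  unfold IsLargest at hv ⊢
  rw [Finset.filter_congr fun q hq =>
      lt_gridVal_iff hS (Finset.mem_range.1 hq) (hlo.le.trans h3) (h4.trans_lt hhi),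
    Finset.filter_congr fun q hq =>
      le_gridVal_iff hS (Finset.mem_range.1 hq) (hlo.trans_le h3) (h4.trans hhi.le)]
  exact hv

noncomputable def exactTime (d : ℕ) : ℕ :=
  2 * (exactCmd d).size + gridTime d (radius d) + 8 * ((4 * (selectBody (d + 2)).size + 50) + 9) + 60

theorem run_exact (hd : 0 < d) (hn : 2 ≤ n) (hk : 1 ≤ k) (hkn : k ≤ n)
    (hx : Set.InjOn x (Finset.range n)) (hst : Stopped x n (n - k + 1) s) (h0 : s.reg 0 = n)
    (h1 : s.reg 1 = k) :
    Run (exactCmd d) s (exactTime d * n) fun t =>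
      t.reg 0 = kthSmallest ((Finset.range n).val.map (nnd x (Finset.range n))) k := by
  obtain ⟨hin, hℓ, hlo, hhi⟩ := hst
  obtain ⟨ℓ, hℓ'⟩ : ∃ ℓ, ℓ = s.reg rL := ⟨_, rfl⟩
  rw [← hℓ'] at hℓ hlo hhi
  have hd0 : (0 : ℝ) < d := by exact_mod_cast hd
  obtain ⟨S, hS⟩ : ∃ S, S = ℓ / (4 * d * (1 + 8 * d) ^ 2) := ⟨_, rfl⟩
  have hS0 : 0 < S := by rw [hS]; positivity
  have hlargest := (isLargest_kthSmallest (S := Finset.range n) (D := nnd x (Finset.range n)) hk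
    (by simpa using hkn))
  rw [Finset.card_range] at hlargest
  -- The lower bound is `4dS`, twice the resolution limit `2dS`; the upper bound `16d²(1 + 8d)ℓ`
  -- equals `64d³(1 + 8d)³S`, one `S` short of the cutoff.
  have hgrid := hlargest.gridVal (R := radius d) hS0 hlo hhi (by
      have : ℓ / (1 + 8 * d) ^ 2 = 4 * d * S := by rw [hS]; field_simp
      rw [this]; nlinarith) (by
      have : ℓ = 4 * d * (1 + 8 * d) ^ 2 * S := by rw [hS]; field_simp
      have h : ((radius d : ℕ) : ℝ) = 64 * d ^ 3 * (1 + 8 * d) ^ 3 + 1 := by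
        unfold radius; push_cast; ring
      rw [this, h]
      nlinarith)
  refine (Run.seq (run_fill (by omega) h0 (fun i => (i : ℝ)) fun i _ t ht => by
      simpa [Expr.eval] using ht)
    (T₂ := 1 + rankCmd.size + (2 + (Expr.div (.var rL) (.const (4 * d * (1 + 8 * d) ^ 2))).ops +
      (1 + gridTime d (radius d) * n +
        (8 * ((4 * (selectBody (d + 2)).size + 50) + 9) * n + 4))))
    (Q := fun t => t.reg 0 = kthSmallest ((Finset.range n).val.map (nnd x (Finset.range n))) k)
    ?_).mono ?_ fun _ => id
  · rintro s₁ ⟨ha₁, hA₁⟩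
    have hr₁ : ∀ y < 8, s₁.reg y = s.reg y := fun y hy =>
      hA₁.1 y fun hh => by have := fillCmd_writesReg hh; omega
    refine Run.seq_eq (run_rank hkn ((hr₁ _ (by decide)).trans h0) ((hr₁ _ (by decide)).trans h1)) ?_
    set s₂ := ((s₁.setReg rJ ((n - k + 1 : ℕ) : ℝ)).setReg rM n).setReg rGo 1 with hs₂
    have hact : Active x n n id s₁ := Active.id (fun a ha => by
      rw [hA₁.2 a fun hh => by have := fillCmd_writesArr hh; omega]
      exact hin a ha) ha₁
    refine Run.seq_assign (s' := s₂.setReg rS S) ?_ (Run.seq (run_grid (w := id)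
      (hact.congr fun a _ => by simp [hs₂]) hx (by unfold radius; omega : 1 ≤ radius d) hS0 hn
      (by simp [hs₂]) (by simp)).frame ?_)
    · simp only [Expr.eval, hs₂, setReg_reg, hr₁ rL (by decide), ← hℓ', hS]
      simp
    · rintro s₃ ⟨hV, hA₃⟩
      have hr₃ : ∀ y ≤ 7, s₃.reg y = (s₂.setReg rS S).reg y := fun y hy =>
        hA₃.1 y fun hh => by have := grid_writesReg hh; omega
      have hsel : Selecting (gridVal x n (radius d) S) (d + 2) n (n - k + 1) n id (n - k + 1) s₃ :=
        { arr := hV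
          le := le_rfl
          inj := Set.injOn_id _
          rm := (hr₃ _ (by decide)).trans (by simp [hs₂])
          rj := (hr₃ _ (by decide)).trans (by simp [hs₂])
          pos := by omega
          le_card := by omega
          largest := fun v hv => by rwa [Finset.image_id] at hv }
      refine (run_select hsel ((hr₃ _ (by decide)).trans (by simp [hs₂]))).mono le_rfl fun t ht =>
        ht.unique hgrid
  · simp only [exactTime, exactCmd, Cmd.size]
    nlinarith

noncomputable def nnCmd (d : ℕ) : Cmd := .seq (approxCmd d) (exactCmd d)

theorem run_nn (hd : 0 < d) (hn : 2 ≤ n) (hk : 1 ≤ k) (hkn : k ≤ n) (hin : HasInput x n s)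
    (hx : Set.InjOn x (Finset.range n)) (h0 : s.reg 0 = n) (h1 : s.reg 1 = k) :
    Run (nnCmd d) s ((approxTime d + exactTime d + 1) * n) fun t =>
      t.reg 0 = kthSmallest ((Finset.range n).val.map (nnd x (Finset.range n))) k := by
  refine (Run.seq (run_approx hd hn hk hkn hin hx h0 h1) fun t ht =>
    run_exact hd hn hk hkn hx ht.1 ht.2.1 ht.2.2).mono ?_ fun _ => id
  nlinarith

end Program

/-! ## Point sets -/

section Points

variable {d n : ℕ} (p : Fin n ↪ EuclideanSpace ℝ (Fin d))

/-- The points, as a sequence. -/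
noncomputable def pointSeq (i : ℕ) : EuclideanSpace ℝ (Fin d) := if h : i < n then p ⟨i, h⟩ else 0

theorem pointSeq_fin (i : Fin n) : pointSeq p i = p i := by simp [pointSeq]

theorem injOn_pointSeq : Set.InjOn (pointSeq p) (Finset.range n) := by
  intro i hi j hj h
  have hi : i < n := by simpa using hi
  have hj : j < n := by simpa using hj
  simp only [pointSeq, hi, hj, dif_pos] at h
  exact congrArg Fin.val (p.injective h)

theorem hasInput_inputState : HasInput (pointSeq p) n (inputState p) := by
  intro a ha
  simp only [inputState, ha, dif_pos]
  apply List.ext_getElem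
  · simp [tab]
  · intro i h1 h2
    have hi : i < n := by simpa using h1
    simp [tab, coord, pointSeq, hi, ha]

theorem nearestDist_map (i : Fin n) :
    nearestDist (Finset.univ.map p) (p i) = nnd (pointSeq p) (Finset.range n) i := by
  unfold nearestDist nnd
  rw [pointSeq_fin]
  congr 1
  ext r
  simp only [Set.mem_image, Set.mem_sdiff, Finset.coe_map, Finset.coe_univ, Set.image_univ,
    Set.mem_range, Set.mem_singleton_iff, Finset.coe_erase, Finset.coe_range, Set.mem_Iio]
  constructor
  · rintro ⟨_, ⟨⟨j, rfl⟩, hj⟩, rfl⟩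
    exact ⟨j, ⟨j.2, fun h => hj (by rw [Fin.ext h])⟩, by rw [pointSeq_fin]⟩
  · rintro ⟨j, ⟨hj, hji⟩, rfl⟩
    refine ⟨p ⟨j, hj⟩, ⟨⟨_, rfl⟩, fun h => hji (congrArg Fin.val (p.injective h))⟩, ?_⟩
    rw [← pointSeq_fin p ⟨j, hj⟩]

theorem map_nearestDist :
    (Finset.univ.map p).val.map (nearestDist (Finset.univ.map p)) =
      (Finset.range n).val.map (nnd (pointSeq p) (Finset.range n)) := by
  have h : Finset.range n = (Finset.univ : Finset (Fin n)).map Fin.valEmbedding := by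
    ext i; simp
  conv_rhs => rw [show (Finset.range n).val = ((Finset.univ : Finset (Fin n)).map
    Fin.valEmbedding).val from congrArg _ h]
  rw [Finset.map_val, Finset.map_val, Multiset.map_map, Multiset.map_map]
  exact Multiset.map_congr rfl fun i _ => nearestDist_map p i

theorem kthNNDist_eq (k : ℕ) : kthNNDist (Finset.univ.map p) k =
    kthSmallest ((Finset.range n).val.map (nnd (pointSeq p) (Finset.range n))) k := by
  rw [kthNNDist, map_nearestDist]

/-- For `k = n` the rank from above is `1`: no distance exceeds the value and some distance attains
it. -/
theorem furthestNNDist_eq (hn : 1 ≤ n) :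
    furthestNNDist (Finset.univ.map p) = kthNNDist (Finset.univ.map p) n := by
  set D := nnd (pointSeq p) (Finset.range n) with hD
  have h := isLargest_kthSmallest (S := Finset.range n) (D := D) hn (by simp)
  rw [kthNNDist_eq, ← hD]
  set v := kthSmallest ((Finset.range n).val.map D) n
  rw [Finset.card_range, Nat.sub_self, zero_add] at h
  have himg : nearestDist (Finset.univ.map p) '' (Finset.univ.map p : Set _) = D '' Set.Iio n := by
    ext r
    simp only [Finset.coe_map, Finset.coe_univ, Set.image_univ, Set.mem_image, Set.mem_range,
      exists_exists_eq_and, nearestDist_map, Set.mem_Iio]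
    exact ⟨fun ⟨i, hi⟩ => ⟨i, i.2, hi⟩, fun ⟨i, hi, hr⟩ => ⟨⟨i, hi⟩, hr⟩⟩
  have hle : ∀ i < n, D i ≤ v := by
    have h1 := Finset.card_eq_zero.1 (Nat.lt_one_iff.1 h.1)
    intro i hi
    by_contra hc
    have : i ∈ (Finset.range n).filter fun i => v < D i := by simpa [hi] using hc
    rw [h1] at this
    simp at this
  rw [furthestNNDist, himg]
  refine IsGreatest.csSup_eq ⟨?_, ?_⟩
  · obtain ⟨i, hi⟩ := Finset.card_pos.1 h.2
    simp only [Finset.mem_filter, Finset.mem_range] at hi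
    exact ⟨i, hi.1, le_antisymm (hle i hi.1) hi.2⟩
  · rintro _ ⟨i, hi, rfl⟩
    exact hle i hi

end Points

/-- Dimension zero has a single point, so that case is void; elsewhere grid sides are obtained by
division by `d`. -/
theorem dim_pos {d n : ℕ} (p : Fin n ↪ EuclideanSpace ℝ (Fin d)) (hn : 2 ≤ n) : 0 < d := by
  rcases Nat.eq_zero_or_pos d with rfl | h
  · have : (⟨0, by omega⟩ : Fin n) = ⟨1, by omega⟩ := p.injective (Subsingleton.elim _ _)
    simp at this
  · exact h

end RealRAM

/-! ### The main theorem -/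

theorem mainTheorem5 (d : ℕ) :
    (∃ (P : RealRAM.Cmd) (C : ℕ), ∀ (n : ℕ), 2 ≤ n →
      ∀ (p : Fin n ↪ EuclideanSpace ℝ (Fin d)) (k : ℕ), 1 ≤ k → k ≤ n →
        RealRAM.Computes P ((RealRAM.inputState p).setReg 1 (k : ℝ))
          (kthNNDist (Finset.univ.map p) k) ((C : ENNReal) * (n : ENNReal))) ∧
    (∃ (P : RealRAM.Cmd) (C : ℕ), ∀ (n : ℕ), 2 ≤ n →
      ∀ (p : Fin n ↪ EuclideanSpace ℝ (Fin d)),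
        RealRAM.Computes P (RealRAM.inputState p)
          (furthestNNDist (Finset.univ.map p)) ((C : ENNReal) * (n : ENNReal))) := by
  open RealRAM in
  have main : ∀ (n : ℕ), 2 ≤ n → ∀ (p : Fin n ↪ EuclideanSpace ℝ (Fin d)) (k : ℕ), 1 ≤ k → k ≤ n →
      Run (nnCmd d) ((inputState p).setReg 1 (k : ℝ)) ((approxTime d + exactTime d + 1) * n)
        fun t => t.reg 0 = kthNNDist (Finset.univ.map p) k := by
    intro n hn p k hk hkn
    rw [kthNNDist_eq]
    exact run_nn (dim_pos p hn) hn hk hkn (hasInput_inputState p) (injOn_pointSeq p)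
      (by simp [inputState]) (by simp)
  refine ⟨⟨RealRAM.nnCmd d, RealRAM.approxTime d + RealRAM.exactTime d + 1,
      fun n hn p k hk hkn => ?_⟩,
    ⟨.seq (.assign 1 (.var 0)) (RealRAM.nnCmd d), RealRAM.approxTime d + RealRAM.exactTime d + 4,
      fun n hn p => ?_⟩⟩
  · exact_mod_cast (main n hn p k hk hkn).computes
  -- The second program first copies `n` into register `1`, thereby setting `k = n`; the larger
  -- constant absorbs this assignment.
  · rw [RealRAM.furthestNNDist_eq p (by omega)]
    have h := RealRAM.Run.seq_assign (x := 1) (e := .var 0) (s := RealRAM.inputState p)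
      (by simp [RealRAM.Expr.eval, RealRAM.inputState]) (main n hn p n (by omega) le_rfl)
    exact_mod_cast (h.mono (T' := (RealRAM.approxTime d + RealRAM.exactTime d + 4) * n) (by
      simp only [RealRAM.Expr.ops]; nlinarith) fun _ => id).computes
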